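/- Work on the deterministic word RAM with $O(\log n)$-bit words, and let "$O(\log n)$-bit integers" mean integers of absolute value at most $n^c$ for an arbitrary constant $c$. The APSP Hypothesis asserts that for no $\delta>0$ can all-pairs shortest-path distances in an arbitrary directed graph with $n$ vertices, $O(\log n)$-bit integer edge weights and no negative cycle be computed in $O(n^{3-\delta})$ time. (Formally: for every $\delta>0$ there is a constant $c$ such that no word RAM program with words of $O(\log n)$ bits solves all instances with weights in $[-n^c,n^c]$ in $O(n^{3-\delta})$ time.) An orthant in $\mathbb{R}^2$ is a product of two closed half-lines, each unbounded in either direction (so orthants come in four orientations). In the weighted size-3 set cover problem, we are given a set $P$ of $n$ points and a set $R$ of $n$ objects in $\mathbb{R}^2$ with nonnegative weights, and must find three distinct objects in $R$ of minimum total weight whose union contains $P$, or report that no three objects of $R$ cover $P$. Theorem. Assume the APSP Hypothesis. Then for every constant $\delta>0$, weighted size-3 set cover for orthants in $\mathbb{R}^2$ requires $\Omega(n^{3/2-\delta})$ time, in the sense that there is no $O(n^{3/2-\delta})$-time algorithm for it; this holds already when all coordinates and weights are $O(\log n)$-bit integers. The same lower bound holds for weighted size-3 set cover for (closed, axis-parallel)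 unit squares in $\mathbb{R}^2$, already when the coordinates are fractions with a common denominator, given with the input, and all numerators, the denominator and the weights are $O(\log n)$-bit integers. (In both cases, formally: for every $\delta>0$ there is a constant $c$ such that no word RAM program with words of $O(\log n)$ bits solves all instances whose integers have absolute value at most $n^c$ in $O(n^{3/2-\delta})$ time.) -/

import Mathlib

/-! ## The word RAM

Programs are structured (`while`) programs acting on word-sized registers and on random-access
arrays whose cells hold words.  A program mentions only finitely many registers and arrays.  Every
instruction and every test costs one unit of time.  Words are signed integers in two's complement
range; an instruction whose result leaves that range has no successor state, so a program that
overflows has no run.  Reading or writing an array cell takes unit time, whatever its address. -/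

namespace WordRAM

/-- The binary word operations. -/
inductive BinOp where
  | add | sub | mul | div | mod | and | or | xor | shl | shr | lt | eq

/-- The value of a binary operation, before the range check. Comparisons return `1` or `0`. -/
def BinOp.eval : BinOp → ℤ → ℤ → ℤ
  | .add, x, y => x + y
  | .sub, x, y => x - y
  | .mul, x, y => x * y
  | .div, x, y => x / y
  | .mod, x, y => x % y
  | .and, x, y => Int.land x y
  | .or, x, y => Int.lor x y
  | .xor, x, y => Int.xor x y
  | .shl, x, y => x * 2 ^ y.toNat
  | .shr, x, y => x / 2 ^ y.toNat
  | .lt, x, y => if x < y then 1 else 0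
  | .eq, x, y => if x = y then 1 else 0

/-- Programs. Registers and arrays are named by natural numbers. -/
inductive Prog where
  /-- do nothing -/
  | skip
  /-- `reg d := v` -/
  | const (d : ℕ) (v : ℤ)
  /-- `reg d := f (reg a) (reg b)` -/
  | op (f : BinOp) (d a b : ℕ)
  /-- `reg d := mem arr [reg a]` -/
  | load (d arr a : ℕ)
  /-- `mem arr [reg a] := reg b` -/
  | store (arr a b : ℕ)
  /-- sequential composition -/
  | seq (p q : Prog)
  /-- `if reg r ≠ 0 then p else q` -/
  | ite (r : ℕ) (p q : Prog)
  /-- `while reg r ≠ 0 do p` -/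
  | loop (r : ℕ) (p : Prog)

/-- A machine state: the registers and the arrays. -/
structure State where
  reg : ℕ → ℤ
  mem : ℕ → ℤ → ℤ

/-- Write `v` to register `d`. -/
def State.setReg (s : State) (d : ℕ) (v : ℤ) : State :=
  { s with reg := Function.update s.reg d v }

/-- Write `v` to cell `z` of array `a`. -/
def State.setMem (s : State) (a : ℕ) (z v : ℤ) : State :=
  { s with mem := Function.update s.mem a (Function.update (s.mem a) z v) }

/-- The state with the given registers and arrays, everything else being `0`. -/
def State.init (regs : List ℤ) (arrs : List (ℤ → ℤ)) : State where
  reg r := regs.getD r 0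
  mem a := arrs.getD a (fun _ => 0)

/-- The array holding `f 0, …, f (m - 1)` in its cells `0, …, m - 1`, and `0` elsewhere. -/
def array {m : ℕ} (f : Fin m → ℤ) : ℤ → ℤ := fun z =>
  if h : 0 ≤ z ∧ z.toNat < m then f ⟨z.toNat, h.2⟩ else 0

/-- The array holding an `n × n` matrix in row-major order: entry `(i, j)` is in cell
`i * n + j`. -/
def matrixArray {n : ℕ} (f : Fin n → Fin n → ℤ) : ℤ → ℤ :=
  array (fun z : Fin (n * n) => f z.divNat z.modNat)

/-- `x` fits in a word with `w` bits and a sign bit. -/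
def InRange (w : ℕ) (x : ℤ) : Prop := -2 ^ w ≤ x ∧ x < 2 ^ w

/-- `Exec w p s s' t`: with word length `w`, program `p` started in state `s` halts in state `s'`
after exactly `t` units of time. -/
inductive Exec (w : ℕ) : Prog → State → State → ℕ → Prop where
  | skip (s : State) : Exec w .skip s s 1
  | const (s : State) (d : ℕ) (v : ℤ) (h : InRange w v) :
      Exec w (.const d v) s (s.setReg d v) 1
  | op (s : State) (f : BinOp) (d a b : ℕ) (h : InRange w (f.eval (s.reg a) (s.reg b))) :
      Exec w (.op f d a b) s (s.setReg d (f.eval (s.reg a) (s.reg b))) 1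
  | load (s : State) (d arr a : ℕ) :
      Exec w (.load d arr a) s (s.setReg d (s.mem arr (s.reg a))) 1
  | store (s : State) (arr a b : ℕ) :
      Exec w (.store arr a b) s (s.setMem arr (s.reg a) (s.reg b)) 1
  | seq {p q : Prog} {s₁ s₂ s₃ : State} {t₁ t₂ : ℕ}
      (h₁ : Exec w p s₁ s₂ t₁) (h₂ : Exec w q s₂ s₃ t₂) : Exec w (.seq p q) s₁ s₃ (t₁ + t₂)
  | ite_true {r : ℕ} {p q : Prog} {s s' : State} {t : ℕ} (hr : s.reg r ≠ 0)
      (h : Exec w p s s' t) : Exec w (.ite r p q) s s' (t + 1)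
  | ite_false {r : ℕ} {p q : Prog} {s s' : State} {t : ℕ} (hr : s.reg r = 0)
      (h : Exec w q s s' t) : Exec w (.ite r p q) s s' (t + 1)
  | loop_stop {r : ℕ} {p : Prog} {s : State} (hr : s.reg r = 0) : Exec w (.loop r p) s s 1
  | loop_step {r : ℕ} {p : Prog} {s₁ s₂ s₃ : State} {t₁ t₂ : ℕ} (hr : s₁.reg r ≠ 0)
      (h₁ : Exec w p s₁ s₂ t₁) (h₂ : Exec w (.loop r p) s₂ s₃ t₂) :
      Exec w (.loop r p) s₁ s₃ (t₁ + t₂ + 1)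

/-- A computational problem: instances, their size parameter `n`, the initial machine state that
presents an instance, and the final states that answer it correctly. -/
structure Problem where
  Inst : Type
  size : Inst → ℕ
  input : Inst → State
  correct : Inst → State → Prop

/-- The problem has an `O(T(n))`-time algorithm on the word RAM with `O(log n)`-bit words: one
program which, for some constants `k` and `C`, answers every instance of size `n` correctly within
`C * T n` time units, with words of length `k * (⌊log₂ n⌋ + 1)`. -/
def Problem.SolvableInTime (Q : Problem) (T : ℕ → ℝ) : Prop :=
  ∃ (p : Prog) (k C : ℕ), ∀ x : Q.Inst, ∃ (s : State) (t : ℕ),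
    Exec (k * (Nat.log 2 (Q.size x) + 1)) p (Q.input x) s t ∧
      (t : ℝ) ≤ C * T (Q.size x) ∧ Q.correct x s

end WordRAM

open WordRAM

/-! ## All-pairs shortest paths -/

/-- `HasWalk W u v a`: the weighted directed graph `W` (where `W u v = some a` means that there is
an edge from `u` to `v` of weight `a`) has a walk from `u` to `v` of total weight `a`. -/
inductive HasWalk {n : ℕ} (W : Fin n → Fin n → Option ℤ) : Fin n → Fin n → ℤ → Prop where
  | nil (u : Fin n) : HasWalk W u u 0
  | cons {u v x : Fin n} {a b : ℤ} (h : W u v = some a) (hw : HasWalk W v x b) :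
      HasWalk W u x (a + b)

/-- A weighted directed graph on `n ≥ 1` vertices with integer edge weights in `[-n^c, n^c]` and
no negative cycle. -/
structure APSPInstance (c : ℕ) where
  n : ℕ
  n_pos : 0 < n
  W : Fin n → Fin n → Option ℤ
  weight_le : ∀ u v a, W u v = some a → |a| ≤ (n : ℤ) ^ c
  no_neg_cycle : ∀ u a, HasWalk W u u a → 0 ≤ a

/-- All-pairs shortest paths. Input: `n` in register 0, the adjacency matrix in array 0, the edge
weights in array 1. Output: for all `u, v`, in array 2 whether `v` is reachable from `u`, and if
so, in array 3 the distance from `u` to `v`. -/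
def APSP (c : ℕ) : Problem where
  Inst := APSPInstance c
  size x := x.n
  input x := State.init [(x.n : ℤ)]
    [matrixArray (fun u v => if (x.W u v).isSome then 1 else 0),
      matrixArray (fun u v => (x.W u v).getD 0)]
  correct x s := ∀ u v : Fin x.n,
    let z : ℤ := (u : ℤ) * x.n + v
    (s.mem 2 z = 1 ∧ IsLeast {a | HasWalk x.W u v a} (s.mem 3 z)) ∨
      (s.mem 2 z = 0 ∧ ∀ a, ¬ HasWalk x.W u v a)

/-- The APSP Hypothesis: for no `δ > 0` can all-pairs shortest paths in `n`-vertex graphs with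
`O(log n)`-bit integer weights be computed in `O(n^(3-δ))` time. -/
def APSPHypothesis : Prop :=
  ∀ δ : ℝ, 0 < δ → ∃ c : ℕ, ¬ (APSP c).SolvableInTime (fun n => (n : ℝ) ^ (3 - δ))

/-! ## Weighted size-3 geometric set cover in the plane -/

/-- The objects `R j` with `j ∈ S` cover all the points `P i`. -/
def Covers {n : ℕ} (P : Fin n → Fin 2 → ℝ) (R : Fin n → Set (Fin 2 → ℝ)) (S : Finset (Fin n)) :
    Prop :=
  ∀ i, ∃ j ∈ S, P i ∈ R j

/-- `S` is a set of three objects of minimum total weight among those that cover all points. -/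
def IsMinCover3 {n : ℕ} (P : Fin n → Fin 2 → ℝ) (R : Fin n → Set (Fin 2 → ℝ)) (wt : Fin n → ℕ)
    (S : Finset (Fin n)) : Prop :=
  S.card = 3 ∧ Covers P R S ∧
    ∀ S' : Finset (Fin n), S'.card = 3 → Covers P R S' → ∑ j ∈ S, wt j ≤ ∑ j ∈ S', wt j

/-- The array `out` answers the minimum-weight size-3 set cover problem: either cell 0 is `1` and
cells 1, 2, 3 are the indices of an optimal solution, or cell 0 is `0` and there is no solution. -/
def AnswersCover3 {n : ℕ} (P : Fin n → Fin 2 → ℝ) (R : Fin n → Set (Fin 2 → ℝ)) (wt : Fin n → ℕ)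
    (out : ℤ → ℤ) : Prop :=
  (out 0 = 1 ∧ ∃ i j k : Fin n, out 1 = i ∧ out 2 = j ∧ out 3 = k ∧ IsMinCover3 P R wt {i, j, k}) ∨
    (out 0 = 0 ∧ ∀ S : Finset (Fin n), S.card = 3 → ¬ Covers P R S)

/-- A (closed) orthant in the plane, in any of the four orientations, with an integer apex. In
coordinate `i` it extends from `apex i` to `+∞` if `up i` holds, and to `-∞` otherwise. -/
structure Orthant where
  apex : Fin 2 → ℤ
  up : Fin 2 → Bool

/-- The region of the plane occupied by an orthant. -/
def Orthant.region (o : Orthant) : Set (Fin 2 → ℝ) :=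
  {p | ∀ i, if o.up i then (o.apex i : ℝ) ≤ p i else p i ≤ (o.apex i : ℝ)}

/-- A set of `n ≥ 1` points and a set of `n` weighted orthants in the plane, with coordinates and
weights that are integers of absolute value at most `n^c`. -/
structure OrthantInstance (c : ℕ) where
  n : ℕ
  n_pos : 0 < n
  point : Fin n → Fin 2 → ℤ
  point_inj : Function.Injective point
  orthant : Fin n → Orthant
  orthant_inj : Function.Injective orthant
  weight : Fin n → ℕ
  point_le : ∀ i d, |point i d| ≤ (n : ℤ) ^ c
  apex_le : ∀ j d, |(orthant j).apex d| ≤ (n : ℤ) ^ c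
  weight_le : ∀ j, weight j ≤ n ^ c

/-- Minimum-weight size-3 set cover for orthants in the plane. Input: `n` in register 0, the
coordinates of the points in arrays 0 and 1, the coordinates of the apices in arrays 2 and 3, the
orientations in arrays 4 and 5, the weights in array 6. Output: in array 7. -/
def weightedOrthantCover3 (c : ℕ) : Problem where
  Inst := OrthantInstance c
  size x := x.n
  input x := State.init [(x.n : ℤ)]
    [array (fun i => x.point i 0), array (fun i => x.point i 1),
      array (fun j => (x.orthant j).apex 0), array (fun j => (x.orthant j).apex 1),
      array (fun j => if (x.orthant j).up 0 then 1 else 0),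
      array (fun j => if (x.orthant j).up 1 then 1 else 0),
      array (fun j => (x.weight j : ℤ))]
  correct x s :=
    AnswersCover3 (fun i d => (x.point i d : ℝ)) (fun j => (x.orthant j).region) x.weight (s.mem 7)

/-- The closed axis-parallel unit square with lower left corner `q`. -/
def unitSquare (q : Fin 2 → ℝ) : Set (Fin 2 → ℝ) :=
  {p | ∀ i, q i ≤ p i ∧ p i ≤ q i + 1}

/-- A set of `n ≥ 1` points and a set of `n` weighted unit squares in the plane. The coordinates
of the points and of the lower left corners are fractions with the common denominator `denom`; all
numerators, the denominator and the weights are integers of absolute value at most `n^c`. -/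
structure UnitSquareInstance (c : ℕ) where
  n : ℕ
  n_pos : 0 < n
  denom : ℕ
  denom_pos : 0 < denom
  point : Fin n → Fin 2 → ℤ
  point_inj : Function.Injective point
  corner : Fin n → Fin 2 → ℤ
  corner_inj : Function.Injective corner
  weight : Fin n → ℕ
  denom_le : denom ≤ n ^ c
  point_le : ∀ i d, |point i d| ≤ (n : ℤ) ^ c
  corner_le : ∀ j d, |corner j d| ≤ (n : ℤ) ^ c
  weight_le : ∀ j, weight j ≤ n ^ c

/-- Minimum-weight size-3 set cover for unit squares in the plane. Input: `n` in register 0, the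
common denominator in register 1, the numerators of the coordinates of the points in arrays 0 and
1, those of the lower left corners of the squares in arrays 2 and 3, the weights in array 4.
Output: in array 5. -/
def weightedUnitSquareCover3 (c : ℕ) : Problem where
  Inst := UnitSquareInstance c
  size x := x.n
  input x := State.init [(x.n : ℤ), (x.denom : ℤ)]
    [array (fun i => x.point i 0), array (fun i => x.point i 1),
      array (fun j => x.corner j 0), array (fun j => x.corner j 1),
      array (fun j => (x.weight j : ℤ))]
  correct x s :=
    AnswersCover3 (fun i d => (x.point i d : ℝ) / x.denom)
      (fun j => unitSquare (fun d => (x.corner j d : ℝ) / x.denom)) x.weight (s.mem 5)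

/-! ## Expressions and structured programs -/

namespace WordRAM

/-! The reductions go from all-pairs shortest paths to minimum-weight triangle in a complete
tripartite graph with parts of size `s`, and from there to size-3 cover with `n = 3 * s ^ 2`
objects. A cover algorithm running in time `n ^ (3/2 - δ)` finds such triangles in time `s ^ (3 -
2δ)`, and this yields shortest paths in time `n ^ (3 - δ/3)`, against the hypothesis.

Triangles to covers (`TriCover.covers_iff`, `TriCover.isMinTri_of_answers`). Every edge becomes an
orthant, the three edge classes having three different orientations, and each vertex part gets a
family of points. An orthant for `(a₁, b₁)` and one for `(a₂, c₂)` cover the first family exactly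
when `a₂ ≤ a₁`, while orthants of the third class miss it altogether; in the same way the other
families ask for `b₃ ≤ b₁` and `c₂ ≤ c₃`. Geometry thus forces only inequalities, and the weights
force equality: a cover pays, above a constant, `6U + 1` times the total slack, whereas two triangle
weights differ by at most `6U`. An optimal cover has no slack and is a minimum triangle. All points
and apices lie in a box of side at most `4 * s ^ 2`, so squares of that side, which are unit squares
after scaling, do the work of the orthants (`TriCover.cov_iff_square`).

Shortest paths to triangles. Distances can be read off from the `N`-th min-plus power of the weight
matrix with zero diagonal and a large weight for missing edges (`distance_of_isWalkMin`), so `log N`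
min-plus squarings suffice. To square `D`, one compares it with a matrix `T` of thresholds. With `N
= s ^ 3`, the indices split into `s ^ 2` intervals of length `s`; for each of the `s ^ 6 = N ^ 2`
triples of intervals, a minimum triangle for the weights `D i k`, `D k j`, `-T i j` exhibits some `D
i k + D k j < T i j` if there is one. Then `T i j` is marked and the triple is tried again;
otherwise the next triple is taken. Every call either marks one of `N ^ 2` entries or finishes one
of `N ^ 2` triples, so `2 * N ^ 2` calls are enough (`MinPlus.detect_runs`). A binary search on all
entries simultaneously (`MinPlus.bit_runs`, `MinPlus.square_runs`) computes the square. The cost `N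
^ 2 * s ^ (3 - 2δ) = N ^ (3 - 2δ/3)` leaves room for two logarithmic factors
(`MinPlus.real_time_le`).

The remaining work concerns the machine. Expressions are compiled to code, and `Runs` is a
Hoare-style total correctness statement with a time bound. A program known only by its behaviour is
executed inside another one by `reloc` (`reloc_exec`). Since it expects all memory outside its input
to be zero, call number `i` out of `M` works only on addresses congruent to `i` modulo `M`; nothing
ever has to be erased, and words become longer only by a constant factor. -/

/-- Registers used for intermediate values: the even ones from `100` on. -/
def IsTemp (r : ℕ) : Prop := 100 ≤ r ∧ r % 2 = 0

instance (r : ℕ) : Decidable (IsTemp r) := inferInstanceAs (Decidable (_ ∧ _))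

def tmp (j : ℕ) : ℕ := 100 + 2 * j

lemma isTemp_tmp (j : ℕ) : IsTemp (tmp j) := by unfold IsTemp tmp; omega

/-- Two states agree up to the contents of the temporary registers. -/
def State.Equiv (S s : State) : Prop := S.mem = s.mem ∧ ∀ r, ¬ IsTemp r → S.reg r = s.reg r

lemma State.Equiv.rfl {s : State} : s.Equiv s := ⟨_root_.rfl, fun _ _ => _root_.rfl⟩

lemma State.Equiv.symm {s s' : State} (h : s.Equiv s') : s'.Equiv s :=
  ⟨h.1.symm, fun r hr => (h.2 r hr).symm⟩

lemma State.Equiv.trans {a b c : State} (h : a.Equiv b) (h' : b.Equiv c) : a.Equiv c :=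
  ⟨h.1.trans h'.1, fun r hr => (h.2 r hr).trans (h'.2 r hr)⟩

@[simp] lemma State.setReg_mem (s : State) (d : ℕ) (v : ℤ) : (s.setReg d v).mem = s.mem := rfl

@[simp] lemma State.setMem_reg (s : State) (a : ℕ) (z v : ℤ) : (s.setMem a z v).reg = s.reg := rfl

lemma State.setReg_reg (s : State) (d : ℕ) (v : ℤ) (r : ℕ) :
    (s.setReg d v).reg r = if r = d then v else s.reg r := by
  simp [State.setReg, Function.update_apply]

@[simp] lemma State.setReg_reg_same (s : State) (d : ℕ) (v : ℤ) : (s.setReg d v).reg d = v := by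
  simp [State.setReg]

lemma State.setReg_reg_ne (s : State) {d r : ℕ} (v : ℤ) (h : r ≠ d) :
    (s.setReg d v).reg r = s.reg r := by
  simp [State.setReg, h]

lemma State.setMem_mem (s : State) (a : ℕ) (z v : ℤ) (b : ℕ) (y : ℤ) :
    (s.setMem a z v).mem b y = if b = a ∧ y = z then v else s.mem b y := by
  by_cases hb : b = a
  · subst hb; simp [State.setMem, Function.update_apply]
  · simp [State.setMem, hb]

lemma State.setMem_mem_ne (s : State) {a b : ℕ} (z v : ℤ) (h : b ≠ a) :
    (s.setMem a z v).mem b = s.mem b := by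
  simp [State.setMem, h]

lemma State.Equiv.setTemp {S s : State} (h : S.Equiv s) {d : ℕ} (hd : IsTemp d) (v : ℤ) :
    (S.setReg d v).Equiv s :=
  ⟨h.1, fun r hr => by
    have hne : r ≠ d := by rintro rfl; exact hr hd
    rw [State.setReg_reg_ne _ _ hne]; exact h.2 r hr⟩

lemma State.Equiv.setReg {S s : State} (h : S.Equiv s) (d : ℕ) (v : ℤ) :
    (S.setReg d v).Equiv (s.setReg d v) :=
  ⟨h.1, fun r hr => by
    rw [State.setReg_reg, State.setReg_reg]; split_ifs; exacts [Eq.refl v, h.2 r hr]⟩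

lemma State.Equiv.setMem {S s : State} (h : S.Equiv s) (a : ℕ) (z v : ℤ) :
    (S.setMem a z v).Equiv (s.setMem a z v) :=
  ⟨by simp [State.setMem, h.1], h.2⟩

/-- Replace array `a` by `f`. -/
def State.setArr (s : State) (a : ℕ) (f : ℤ → ℤ) : State :=
  { s with mem := Function.update s.mem a f }

@[simp] lemma State.setArr_reg (s : State) (a : ℕ) (f : ℤ → ℤ) : (s.setArr a f).reg = s.reg := rfl

@[simp] lemma State.setArr_mem_same (s : State) (a : ℕ) (f : ℤ → ℤ) :
    (s.setArr a f).mem a = f := by simp [State.setArr]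

lemma State.setArr_mem (s : State) (a : ℕ) (f : ℤ → ℤ) (b : ℕ) :
    (s.setArr a f).mem b = if b = a then f else s.mem b := by
  simp [State.setArr, Function.update_apply]

lemma State.setArr_mem_ne (s : State) {a b : ℕ} (f : ℤ → ℤ) (h : b ≠ a) :
    (s.setArr a f).mem b = s.mem b := by simp [State.setArr, h]

/-- Expressions over registers and arrays. -/
inductive Ex where
  | lit (v : ℤ)
  | var (r : ℕ)
  | bin (f : BinOp) (a b : Ex)
  | get (arr : ℕ) (a : Ex)
  | cond (c a b : Ex)

namespace Ex

instance : Add Ex := ⟨bin .add⟩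
instance : Sub Ex := ⟨bin .sub⟩
instance : Mul Ex := ⟨bin .mul⟩
instance : Div Ex := ⟨bin .div⟩
instance : Mod Ex := ⟨bin .mod⟩

def lt (a b : Ex) : Ex := bin .lt a b
def eq (a b : Ex) : Ex := bin .eq a b

def eval (s : State) : Ex → ℤ
  | lit v => v
  | var r => s.reg r
  | bin f a b => f.eval (a.eval s) (b.eval s)
  | get arr a => s.mem arr (a.eval s)
  | cond c a b => if c.eval s = 0 then b.eval s else a.eval s

/-- Every intermediate value fits in a word. -/
def Ok (w : ℕ) (s : State) : Ex → Prop
  | lit v => |v| < 2 ^ w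
  | var r => ¬ IsTemp r
  | bin f a b => a.Ok w s ∧ b.Ok w s ∧ |f.eval (a.eval s) (b.eval s)| < 2 ^ w
  | get _ a => a.Ok w s
  | cond c a b => c.Ok w s ∧ (¬ c.eval s = 0 → a.Ok w s ∧ |a.eval s| < 2 ^ w) ∧
      (c.eval s = 0 → b.Ok w s ∧ |b.eval s| < 2 ^ w)

/-- An upper bound on the evaluation time. -/
def cost : Ex → ℕ
  | lit _ => 1
  | var _ => 1
  | bin _ a b => a.cost + b.cost + 1
  | get _ a => a.cost + 1
  | cond c a b => c.cost + a.cost + b.cost + 3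

section simps
variable (w : ℕ) (s : State) (a b c : Ex)

@[simp] lemma eval_lit (v : ℤ) : (lit v).eval s = v := rfl
@[simp] lemma eval_var (r : ℕ) : (var r).eval s = s.reg r := rfl
@[simp] lemma eval_get (r : ℕ) : (get r a).eval s = s.mem r (a.eval s) := rfl
@[simp] lemma eval_add : (a + b).eval s = a.eval s + b.eval s := rfl
@[simp] lemma eval_sub : (a - b).eval s = a.eval s - b.eval s := rfl
@[simp] lemma eval_mul : (a * b).eval s = a.eval s * b.eval s := rfl
@[simp] lemma eval_div : (a / b).eval s = a.eval s / b.eval s := rfl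
@[simp] lemma eval_mod : (a % b).eval s = a.eval s % b.eval s := rfl
@[simp] lemma eval_lt : (lt a b).eval s = if a.eval s < b.eval s then 1 else 0 := rfl
@[simp] lemma eval_eq : (eq a b).eval s = if a.eval s = b.eval s then 1 else 0 := rfl
@[simp] lemma eval_cond : (cond c a b).eval s = if c.eval s = 0 then b.eval s else a.eval s := rfl

@[simp] lemma ok_lit (v : ℤ) : (lit v).Ok w s ↔ |v| < 2 ^ w := Iff.rfl
@[simp] lemma ok_var (r : ℕ) : (var r).Ok w s ↔ ¬ IsTemp r := Iff.rfl
@[simp] lemma ok_get (r : ℕ) : (get r a).Ok w s ↔ a.Ok w s := Iff.rfl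
@[simp] lemma ok_add :
    (a + b).Ok w s ↔ a.Ok w s ∧ b.Ok w s ∧ |a.eval s + b.eval s| < 2 ^ w := Iff.rfl
@[simp] lemma ok_sub :
    (a - b).Ok w s ↔ a.Ok w s ∧ b.Ok w s ∧ |a.eval s - b.eval s| < 2 ^ w := Iff.rfl
@[simp] lemma ok_mul :
    (a * b).Ok w s ↔ a.Ok w s ∧ b.Ok w s ∧ |a.eval s * b.eval s| < 2 ^ w := Iff.rfl
@[simp] lemma ok_div :
    (a / b).Ok w s ↔ a.Ok w s ∧ b.Ok w s ∧ |a.eval s / b.eval s| < 2 ^ w := Iff.rfl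
@[simp] lemma ok_mod :
    (a % b).Ok w s ↔ a.Ok w s ∧ b.Ok w s ∧ |a.eval s % b.eval s| < 2 ^ w := Iff.rfl
@[simp] lemma ok_cond : (cond c a b).Ok w s ↔ c.Ok w s ∧
    (¬ c.eval s = 0 → a.Ok w s ∧ |a.eval s| < 2 ^ w) ∧
      (c.eval s = 0 → b.Ok w s ∧ |b.eval s| < 2 ^ w) := Iff.rfl

lemma abs_bool_lt {w : ℕ} (hw : 0 < w) (p : Prop) [Decidable p] :
    |(if p then (1 : ℤ) else 0)| < 2 ^ w := by
  have : (1 : ℤ) < 2 ^ w := one_lt_pow₀ (by norm_num) (by omega)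
  split_ifs <;> simp [this]

lemma ok_lt (hw : 0 < w) : (lt a b).Ok w s ↔ a.Ok w s ∧ b.Ok w s :=
  ⟨fun h => ⟨h.1, h.2.1⟩, fun h => ⟨h.1, h.2, abs_bool_lt hw _⟩⟩

lemma ok_eq (hw : 0 < w) : (eq a b).Ok w s ↔ a.Ok w s ∧ b.Ok w s :=
  ⟨fun h => ⟨h.1, h.2.1⟩, fun h => ⟨h.1, h.2, abs_bool_lt hw _⟩⟩

@[simp] lemma cost_lit (v : ℤ) : (lit v).cost = 1 := rfl
@[simp] lemma cost_var (r : ℕ) : (var r).cost = 1 := rfl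
@[simp] lemma cost_get (r : ℕ) : (get r a).cost = a.cost + 1 := rfl
@[simp] lemma cost_add : (a + b).cost = a.cost + b.cost + 1 := rfl
@[simp] lemma cost_sub : (a - b).cost = a.cost + b.cost + 1 := rfl
@[simp] lemma cost_mul : (a * b).cost = a.cost + b.cost + 1 := rfl
@[simp] lemma cost_div : (a / b).cost = a.cost + b.cost + 1 := rfl
@[simp] lemma cost_mod : (a % b).cost = a.cost + b.cost + 1 := rfl
@[simp] lemma cost_lt : (lt a b).cost = a.cost + b.cost + 1 := rfl
@[simp] lemma cost_eq : (eq a b).cost = a.cost + b.cost + 1 := rfl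
@[simp] lemma cost_cond : (cond c a b).cost = c.cost + a.cost + b.cost + 3 := rfl

end simps

/-- The register holding the value of the expression after running its code. -/
def dest : Ex → ℕ → ℕ
  | var r, _ => r
  | _, j => tmp j

/-- Copy register `r` to `d`, with temporary `tmp j` set to `0`. -/
def move (d r j : ℕ) : Prog := .seq (.const (tmp j) 0) (.op .add d r (tmp j))

/-- Code that evaluates the expression with the temporaries `tmp j`, `tmp (j + 1)`, …. -/
def code : Ex → ℕ → Prog
  | lit v, j => .const (tmp j) v
  | var _, _ => .skip
  | bin f a b, j => .seq (a.code j) (.seq (b.code (j + 1))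
      (.op f (tmp j) (a.dest j) (b.dest (j + 1))))
  | get arr a, j => .seq (a.code j) (.load (tmp j) arr (a.dest j))
  | cond c a b, j => .seq (c.code j) (.ite (c.dest j)
      (.seq (a.code j) (move (tmp j) (a.dest j) (j + 1)))
      (.seq (b.code j) (move (tmp j) (b.dest j) (j + 1))))

end Ex

lemma inRange_of_abs {w : ℕ} {x : ℤ} (h : |x| < 2 ^ w) : InRange w x :=
  ⟨(abs_lt.1 h).1.le, (abs_lt.1 h).2⟩

lemma tmp_ne {i j : ℕ} (h : i ≠ j) : tmp i ≠ tmp j := by unfold tmp; omega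

/-- A register is copied by adding zero, and additions are range-checked; hence the hypothesis `h`,
and hence the demand in `Ex.Ok` that the selected branch of a `cond` fits in a word. Loads are not
checked. -/
lemma Ex.move_exec {w : ℕ} {S : State} {d r j : ℕ} (hr : r ≠ tmp j) (h : |S.reg r| < 2 ^ w) :
    Exec w (move d r j) S ((S.setReg (tmp j) 0).setReg d (S.reg r)) 2 := by
  have e : BinOp.add.eval ((S.setReg (tmp j) 0).reg r) ((S.setReg (tmp j) 0).reg (tmp j)) =
      S.reg r := by simp [BinOp.eval, State.setReg_reg_ne _ _ hr]
  have h1 : Exec w (.const (tmp j) 0) S (S.setReg (tmp j) 0) 1 :=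
    Exec.const _ _ _ (inRange_of_abs (by simp))
  have h2 := Exec.op (w := w) (S.setReg (tmp j) 0) .add d r (tmp j)
    (by rw [e]; exact inRange_of_abs h)
  rw [e] at h2
  exact Exec.seq h1 h2

lemma Ex.dest_ne (e : Ex) {w : ℕ} {s : State} (h : e.Ok w s) {i j : ℕ} (hij : i ≠ j) :
    e.dest i ≠ tmp j := by
  cases e with
  | var r => intro h'; exact h (by rw [show r = tmp j from h']; exact isTemp_tmp j)
  | _ => exact tmp_ne hij

lemma Ex.reg_dest_of_eq (e : Ex) {w : ℕ} {s : State} (h : e.Ok w s) {S S' : State} {i : ℕ}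
    (hS : S.Equiv s) (hS' : S'.Equiv s) (ht : S'.reg (tmp i) = S.reg (tmp i)) :
    S'.reg (e.dest i) = S.reg (e.dest i) := by
  cases e with
  | var r => exact (hS'.2 r h).trans (hS.2 r h).symm
  | _ => exact ht

/-- Code at level `j` disturbs only the temporaries from `tmp j` on. The last clause records this,
so that a left operand stored in `tmp j` survives the evaluation of the right operand at level `j +
1`. -/
lemma Ex.code_exec {w : ℕ} {s : State} (e : Ex) : ∀ (j : ℕ) (S : State), e.Ok w s → S.Equiv s →
    ∃ S' t, Exec w (e.code j) S S' t ∧ t ≤ e.cost ∧ S'.Equiv s ∧ S'.reg (e.dest j) = e.eval s ∧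
      ∀ i < j, S'.reg (tmp i) = S.reg (tmp i) := by
  induction e with
  | lit v =>
    intro j S h hS
    exact ⟨_, _, Exec.const _ _ _ (inRange_of_abs h), le_rfl, hS.setTemp (isTemp_tmp j) v,
      by simp [dest], fun i hi => State.setReg_reg_ne _ _ (tmp_ne hi.ne)⟩
  | var r =>
    intro j S h hS
    exact ⟨_, _, Exec.skip _, le_rfl, hS, hS.2 r h, fun _ _ => rfl⟩
  | bin f a b iha ihb =>
    intro j S h hS
    obtain ⟨h1, h2, h3⟩ := h
    obtain ⟨S1, t1, e1, ht1, q1, v1, f1⟩ := iha j S h1 hS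
    obtain ⟨S2, t2, e2, ht2, q2, v2, f2⟩ := ihb (j + 1) S1 h2 q1
    have v1' : S2.reg (a.dest j) = a.eval s :=
      (a.reg_dest_of_eq h1 q1 q2 (f2 j (by omega))).trans v1
    have e3 := Exec.op (w := w) S2 f (tmp j) (a.dest j) (b.dest (j + 1))
      (by rw [v1', v2]; exact inRange_of_abs h3)
    refine ⟨_, _, Exec.seq e1 (Exec.seq e2 e3), by simp only [cost]; omega,
      q2.setTemp (isTemp_tmp j) _, ?_, ?_⟩
    · change (S2.setReg (tmp j) _).reg (tmp j) = _
      rw [State.setReg_reg_same, v1', v2]; rfl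
    · intro i hi
      rw [State.setReg_reg_ne _ _ (tmp_ne hi.ne), f2 i (by omega), f1 i hi]
  | get arr a iha =>
    intro j S h hS
    obtain ⟨S1, t1, e1, ht1, q1, v1, f1⟩ := iha j S h hS
    refine ⟨_, _, Exec.seq e1 (Exec.load _ _ _ _), by simp only [cost]; omega,
      q1.setTemp (isTemp_tmp j) _, ?_, ?_⟩
    · change (S1.setReg (tmp j) _).reg (tmp j) = _
      rw [State.setReg_reg_same, v1, q1.1]; rfl
    · intro i hi
      rw [State.setReg_reg_ne _ _ (tmp_ne hi.ne), f1 i hi]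
  | cond c a b ihc iha ihb =>
    intro j S h hS
    obtain ⟨h1, h2, h3⟩ := h
    obtain ⟨S1, t1, e1, ht1, q1, v1, f1⟩ := ihc j S h1 hS
    by_cases hc : c.eval s = 0
    · obtain ⟨ho, hr⟩ := h3 hc
      obtain ⟨S2, t2, e2, ht2, q2, v2, f2⟩ := ihb j S1 ho q1
      have e3 := move_exec (w := w) (S := S2) (d := tmp j) (b.dest_ne ho (j.lt_succ_self.ne))
        (by rw [v2]; exact hr)
      refine ⟨_, _, Exec.seq e1 (Exec.ite_false (by rw [v1, hc]) (Exec.seq e2 e3)),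
        by simp only [cost]; omega, (q2.setTemp (isTemp_tmp _) _).setTemp (isTemp_tmp j) _, ?_, ?_⟩
      · change State.reg (State.setReg _ (tmp j) _) (tmp j) = _
        rw [State.setReg_reg_same, v2]; simp [eval, hc]
      · intro i hi
        rw [State.setReg_reg_ne _ _ (tmp_ne hi.ne),
          State.setReg_reg_ne _ _ (tmp_ne (by omega)), f2 i hi, f1 i hi]
    · obtain ⟨ho, hr⟩ := h2 hc
      obtain ⟨S2, t2, e2, ht2, q2, v2, f2⟩ := iha j S1 ho q1
      have e3 := move_exec (w := w) (S := S2) (d := tmp j) (a.dest_ne ho (j.lt_succ_self.ne))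
        (by rw [v2]; exact hr)
      refine ⟨_, _, Exec.seq e1 (Exec.ite_true (by rw [v1]; exact hc) (Exec.seq e2 e3)),
        by simp only [cost]; omega, (q2.setTemp (isTemp_tmp _) _).setTemp (isTemp_tmp j) _, ?_, ?_⟩
      · change State.reg (State.setReg _ (tmp j) _) (tmp j) = _
        rw [State.setReg_reg_same, v2]; simp [eval, hc]
      · intro i hi
        rw [State.setReg_reg_ne _ _ (tmp_ne hi.ne),
          State.setReg_reg_ne _ _ (tmp_ne (by omega)), f2 i hi, f1 i hi]

/-! ### Correctness and running time of programs -/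

/-- With word length `w`, program `p` started in `s` halts in a state `s'` within `T` units of time
such that `Q s' T`. Temporary registers are ignored. -/
def Runs (w : ℕ) (p : Prog) (s : State) (Q : State → ℕ → Prop) : Prop :=
  ∀ S : State, S.Equiv s → ∃ S' s' t T, Exec w p S S' t ∧ t ≤ T ∧ S'.Equiv s' ∧ Q s' T

lemma Runs.mono {w : ℕ} {p : Prog} {s : State} {Q Q' : State → ℕ → Prop} (h : Runs w p s Q)
    (hQ : ∀ s' T, Q s' T → Q' s' T) : Runs w p s Q' := by
  intro S hS
  obtain ⟨S', s', t, T, h1, h2, h3, h4⟩ := h S hS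
  exact ⟨S', s', t, T, h1, h2, h3, hQ _ _ h4⟩

lemma Runs.seq {w : ℕ} {p q : Prog} {s : State} {Q : State → ℕ → Prop}
    (h : Runs w p s (fun s₁ T₁ => Runs w q s₁ (fun s₂ T₂ => Q s₂ (T₁ + T₂)))) :
    Runs w (.seq p q) s Q := by
  intro S hS
  obtain ⟨S', s', t, T, h1, h2, h3, h4⟩ := h S hS
  obtain ⟨S'', s'', t', T', h1', h2', h3', h4'⟩ := h4 S' h3
  exact ⟨S'', s'', _, _, Exec.seq h1 h1', by omega, h3', h4'⟩

lemma Runs.skip {w : ℕ} {s : State} {Q : State → ℕ → Prop} (h : Q s 1) : Runs w .skip s Q :=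
  fun S hS => ⟨S, s, 1, 1, Exec.skip S, le_rfl, hS, h⟩

/-- `reg d := e` -/
def assign (d : ℕ) (e : Ex) : Prog := .seq (e.code 0) (Ex.move d (e.dest 0) 1)

lemma Runs.assign {w : ℕ} {s : State} {d : ℕ} {e : Ex} {Q : State → ℕ → Prop} (h : e.Ok w s)
    (hr : |e.eval s| < 2 ^ w) (hQ : Q (s.setReg d (e.eval s)) (e.cost + 2)) :
    Runs w (assign d e) s Q := by
  intro S hS
  obtain ⟨S1, t1, e1, ht1, q1, v1, -⟩ := e.code_exec 0 S h hS
  have e3 := Ex.move_exec (w := w) (S := S1) (d := d) (e.dest_ne h Nat.zero_ne_one)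
    (by rw [v1]; exact hr)
  refine ⟨_, _, _, _, Exec.seq e1 e3, by omega, ?_, hQ⟩
  rw [v1]
  exact (q1.setTemp (isTemp_tmp _) _).setReg _ _

/-- `mem arr [a] := b` -/
def write (arr : ℕ) (a b : Ex) : Prog :=
  .seq (a.code 0) (.seq (b.code 1) (.store arr (a.dest 0) (b.dest 1)))

lemma Runs.write {w : ℕ} {s : State} {arr : ℕ} {a b : Ex} {Q : State → ℕ → Prop}
    (ha : a.Ok w s) (hb : b.Ok w s)
    (hQ : Q (s.setMem arr (a.eval s) (b.eval s)) (a.cost + b.cost + 1)) :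
    Runs w (write arr a b) s Q := by
  intro S hS
  obtain ⟨S1, t1, e1, ht1, q1, v1, -⟩ := a.code_exec 0 S ha hS
  obtain ⟨S2, t2, e2, ht2, q2, v2, f2⟩ := b.code_exec 1 S1 hb q1
  have v1' : S2.reg (a.dest 0) = a.eval s :=
    (a.reg_dest_of_eq ha q1 q2 (f2 0 (by omega))).trans v1
  refine ⟨_, _, _, _, Exec.seq e1 (Exec.seq e2 (Exec.store _ _ _ _)), by omega, ?_, hQ⟩
  rw [v1', v2]
  exact q2.setMem _ _ _

/-- `if c ≠ 0 then p else q` -/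
def branch (c : Ex) (p q : Prog) : Prog := .seq (c.code 0) (.ite (c.dest 0) p q)

lemma Runs.branch {w : ℕ} {s : State} {c : Ex} {p q : Prog} {Q : State → ℕ → Prop}
    (hc : c.Ok w s)
    (hp : ¬ c.eval s = 0 → Runs w p s (fun s' T => Q s' (T + (c.cost + 1))))
    (hq : c.eval s = 0 → Runs w q s (fun s' T => Q s' (T + (c.cost + 1)))) :
    Runs w (branch c p q) s Q := by
  intro S hS
  obtain ⟨S1, t1, e1, ht1, q1, v1, -⟩ := c.code_exec 0 S hc hS
  by_cases h0 : c.eval s = 0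
  · obtain ⟨S', s', t, T, h1, h2, h3, h4⟩ := hq h0 S1 q1
    exact ⟨_, _, _, _, Exec.seq e1 (Exec.ite_false (by rw [v1, h0]) h1), by omega, h3, h4⟩
  · obtain ⟨S', s', t, T, h1, h2, h3, h4⟩ := hp h0 S1 q1
    exact ⟨_, _, _, _, Exec.seq e1 (Exec.ite_true (by rw [v1]; exact h0) h1), by omega, h3, h4⟩

/-- `while c ≠ 0 do p` -/
def while_ (c : Ex) (p : Prog) : Prog :=
  .seq (assign 100 c) (.loop 100 (.seq p (assign 100 c)))

/-- Register `100` is temporary: storing the loop test there is invisible to the abstract state `s`,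
so its value has to be tracked in the concrete state. -/
lemma Ex.assign_temp_exec {w : ℕ} {s S : State} {c : Ex} (hc : c.Ok w s)
    (hr : |c.eval s| < 2 ^ w) (hS : S.Equiv s) :
    ∃ S' t, Exec w (assign 100 c) S S' t ∧ t ≤ c.cost + 2 ∧ S'.Equiv s ∧
      S'.reg 100 = c.eval s := by
  obtain ⟨S1, t1, e1, ht1, q1, v1, -⟩ := c.code_exec 0 S hc hS
  have e3 := Ex.move_exec (w := w) (S := S1) (d := 100) (c.dest_ne hc Nat.zero_ne_one)
    (by rw [v1]; exact hr)
  exact ⟨_, _, Exec.seq e1 e3, by omega,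
    (q1.setTemp (isTemp_tmp _) _).setTemp (by decide) _, by simp [v1]⟩

/-- Total correctness of `while` with an invariant indexed by the remaining fuel `k`. -/
lemma Runs.while {w k₀ : ℕ} {s : State} {c : Ex} {p : Prog} {Q : State → ℕ → Prop}
    (I : ℕ → State → Prop) (k : ℕ) (B : ℕ) (h0 : I k s)
    (hc : ∀ k s, I k s → c.Ok w s ∧ |c.eval s| < 2 ^ w)
    (hp : ∀ k s, I k s → ¬ c.eval s = 0 →
      Runs w p s (fun s' T => T ≤ B ∧ ∃ k' < k, I k' s'))
    (hQ : ∀ k s', I k s' → c.eval s' = 0 → ∀ T,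
      T = (B + c.cost + 3) * k₀ + c.cost + 3 → Q s' T) (hk : k ≤ k₀) :
    Runs w (while_ c p) s Q := by
  -- The induction concerns the bare loop, entered with the value of the test already in register
  -- `100`. The final state satisfies the invariant for some smaller fuel, and the time is bounded
  -- by the initial fuel.
  suffices H : ∀ k s, I k s → ∀ S : State, S.Equiv s → S.reg 100 = c.eval s →
      ∃ S' k' s' t, Exec w (.loop 100 (.seq p (WordRAM.assign 100 c))) S S' t ∧
        t ≤ (B + c.cost + 3) * k + 1 ∧ S'.Equiv s' ∧ I k' s' ∧ c.eval s' = 0 by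
    intro S hS
    obtain ⟨S1, t1, e1, ht1, q1, v1⟩ := Ex.assign_temp_exec (hc k s h0).1 (hc k s h0).2 hS
    obtain ⟨S', k', s', t, h1, h2, h3, h4, h5⟩ := H k s h0 S1 q1 v1
    refine ⟨S', s', _, _, Exec.seq e1 h1, ?_, h3, hQ k' s' h4 h5 _ rfl⟩
    have := Nat.mul_le_mul_left (B + c.cost + 3) hk
    omega
  clear hk hQ h0 s k
  intro k
  induction k using Nat.strong_induction_on with
  | _ k ih =>
    intro s hI S hS hv
    by_cases hz : c.eval s = 0
    · exact ⟨S, k, s, 1, Exec.loop_stop (by rw [hv, hz]), by omega, hS, hI, hz⟩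
    · obtain ⟨S1, s1, t1, T1, e1, ht1, q1, hB, k', hk', hI'⟩ := hp k s hI hz S hS
      obtain ⟨S2, t2, e2, ht2, q2, v2⟩ :=
        Ex.assign_temp_exec (hc k' s1 hI').1 (hc k' s1 hI').2 q1
      obtain ⟨S3, k3, s3, t3, e3, ht3, q3, h3⟩ := ih k' hk' s1 hI' S2 q2 v2
      refine ⟨S3, k3, s3, _, Exec.loop_step (by rw [hv]; exact hz) (Exec.seq e1 e2) e3, ?_, q3, h3⟩
      have : (B + c.cost + 3) * (k' + 1) ≤ (B + c.cost + 3) * k := Nat.mul_le_mul_left _ hk'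
      rw [Nat.mul_add, Nat.mul_one] at this
      omega

/-- `for z := 0, …, (reg lim) - 1 do p` -/
def for_ (z lim : ℕ) (p : Prog) : Prog :=
  .seq (assign z (.lit 0)) (while_ (.lt (.var z) (.var lim))
    (.seq p (assign z (.var z + .lit 1))))

/-- Per iteration: `B` for the body, `5` for the increment, `6` for evaluating the test and looping.
The `9` consists of `3` for the initialization and `6` for the first test and the exit. -/
lemma Runs.for {w : ℕ} {s : State} {z lim : ℕ} {p : Prog} {Q : State → ℕ → Prop}
    (I : ℕ → State → Prop) (m B : ℕ) (hw : 0 < w) (hm : (m : ℤ) < 2 ^ w)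
    (hz : ¬ IsTemp z) (hl : ¬ IsTemp lim) (hzl : lim ≠ z) (hs : s.reg lim = m)
    (h0 : I 0 (s.setReg z 0))
    (hp : ∀ i < m, ∀ s, I i s → s.reg z = i → s.reg lim = m →
      Runs w p s (fun s' T => T ≤ B ∧ s'.reg z = i ∧ s'.reg lim = m ∧
        I (i + 1) (s'.setReg z (i + 1))))
    (hQ : ∀ s', I m s' → s'.reg z = m → s'.reg lim = m →
      Q s' ((B + 11) * m + 9)) :
    Runs w (for_ z lim p) s Q := by
  have hone : (1 : ℤ) < 2 ^ w := one_lt_pow₀ (by norm_num) (by omega)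
  refine Runs.seq (Runs.assign (by simp) (by simp) ?_)
  refine Runs.while (k₀ := m) (fun k s => ∃ i : ℕ, i + k = m ∧ I i s ∧ s.reg z = i ∧
    s.reg lim = m) m (B + 5) ⟨0, by omega, by simpa using h0, by simp, ?_⟩ ?_ ?_ ?_ le_rfl
  · simpa [State.setReg_reg_ne _ _ hzl] using hs
  · rintro k s ⟨i, hi, h1, h2, h3⟩
    exact ⟨by simp [Ex.ok_lt, hw, hz, hl], Ex.abs_bool_lt hw _⟩
  · rintro k s ⟨i, hi, h1, h2, h3⟩ hc
    have him : i < m := by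
      by_contra hcon
      apply hc
      have : ¬ (i : ℤ) < m := by exact_mod_cast hcon
      simp [h2, h3, this]
    refine Runs.seq ((hp i him s h1 h2 h3).mono ?_)
    rintro s' T ⟨hT, hz', hl', hI⟩
    have hb : |((i : ℤ) + 1)| < 2 ^ w := by
      rw [abs_of_nonneg (by positivity)]
      have : (i : ℤ) + 1 ≤ m := by exact_mod_cast him
      omega
    refine Runs.assign ?_ ?_ ⟨?_, k - 1, by omega, i + 1, by omega, ?_, ?_, ?_⟩
    · simp [hz, hz', hb, hone]
    · simpa [hz'] using hb
    · simp; omega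
    · simpa [hz'] using hI
    · simp [hz']
    · rw [State.setReg_reg_ne _ _ hzl, hl']
  · rintro k s' ⟨i, hi, h1, h2, h3⟩ hc T rfl
    have him : i = m := by
      by_contra hcon
      have : (i : ℤ) < m := by exact_mod_cast (by omega : i < m)
      simp [h2, h3, this] at hc
    subst him
    convert hQ s' h1 h2 h3 using 1
    simp [Nat.add_assoc]
    ring

/-- The function `f` on `0, …, m - 1`, and `g` elsewhere. -/
def tab (m : ℕ) (f : ℤ → ℤ) (g : ℤ → ℤ) : ℤ → ℤ := fun z => if 0 ≤ z ∧ z < m then f z else g z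

lemma tab_zero (f g : ℤ → ℤ) : tab 0 f g = g := by
  funext z; rw [tab, if_neg]; push_cast; omega

lemma tab_succ (m : ℕ) (f g : ℤ → ℤ) :
    tab (m + 1) f g = Function.update (tab m f g) m (f m) := by
  funext z
  by_cases h : z = m
  · subst h; simp [tab]
  · rw [Function.update_of_ne h]
    have : (0 ≤ z ∧ z < (m + 1 : ℕ)) ↔ (0 ≤ z ∧ z < m) := by push_cast; omega
    simp only [tab, this]

lemma tab_of_lt {m : ℕ} {f g : ℤ → ℤ} {z : ℤ} (h0 : 0 ≤ z) (h : z < m) : tab m f g z = f z :=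
  if_pos ⟨h0, h⟩

lemma tab_of_ge {m : ℕ} {f g : ℤ → ℤ} {z : ℤ} (h : m ≤ z) : tab m f g z = g z :=
  if_neg (by omega)

/-- `for z < reg lim do mem arr [z] := e` -/
def fill (arr z lim : ℕ) (e : Ex) : Prog := for_ z lim (write arr (.var z) e)

/-- The invariant determines the state completely, so `he` only has to deal with the partially
filled array. In particular `e` may read cells of the target array that have not been overwritten
yet. -/
lemma Runs.fill {w : ℕ} {s : State} {arr z lim : ℕ} {e : Ex} {Q : State → ℕ → Prop}
    (val : ℤ → ℤ) (m : ℕ) (hw : 0 < w) (hm : (m : ℤ) < 2 ^ w)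
    (hz : ¬ IsTemp z) (hl : ¬ IsTemp lim) (hzl : lim ≠ z) (hs : s.reg lim = m)
    (he : ∀ i : ℕ, i < m → ∀ s', s' = (s.setArr arr (tab i val (s.mem arr))).setReg z i →
      e.Ok w s' ∧ e.eval s' = val i)
    (hQ : Q ((s.setArr arr (tab m val (s.mem arr))).setReg z m) ((e.cost + 13) * m + 9)) :
    Runs w (fill arr z lim e) s Q := by
  refine Runs.for (fun i s' => s' = (s.setArr arr (tab i val (s.mem arr))).setReg z i) m
    (e.cost + 2) hw hm hz hl hzl hs ?_ ?_ ?_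
  · simp [tab_zero, State.setArr]
  · rintro i hi s' rfl h1 h2
    obtain ⟨ho, hv⟩ := he i hi _ rfl
    refine Runs.write hz ho ⟨by simp; omega, ?_, ?_, ?_⟩
    · simp
    · simpa using h2
    · rw [hv]
      simp [State.setArr, State.setReg, State.setMem, tab_succ]
  · rintro s' rfl h1 h2
    simpa [Nat.add_assoc] using hQ

end WordRAM
/-! ## Running a program inside another one -/

namespace WordRAM

/-- The register that holds register `r` of a relocated program. -/
def breg (r : ℕ) : ℕ := 101 + 2 * r

lemma breg_injective : Function.Injective breg := fun a b h => by unfold breg at h; omega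

lemma not_isTemp_breg (r : ℕ) : ¬ IsTemp (breg r) := by unfold IsTemp breg; omega

/-- The program `p`, with its registers moved to odd registers from `101` on, its arrays to arrays
from `20` on, and cell `z` of an array moved to cell `z * reg 40 + reg 41`. -/
def reloc : Prog → Prog
  | .skip => .skip
  | .const d v => .const (breg d) v
  | .op f d a b => .op f (breg d) (breg a) (breg b)
  -- Register `100` is free for the address, since relocated registers are odd. Computing the
  -- address makes an access cost three units instead of one.
  | .load d arr a => .seq (.op .mul 100 (breg a) 40) (.seq (.op .add 100 100 41)
      (.load (breg d) (20 + arr) 100))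
  | .store arr a b => .seq (.op .mul 100 (breg a) 40) (.seq (.op .add 100 100 41)
      (.store (20 + arr) 100 (breg b)))
  | .seq p q => .seq (reloc p) (reloc q)
  | .ite r p q => .ite (breg r) (reloc p) (reloc q)
  | .loop r p => .loop (breg r) (reloc p)

/-- `S` holds the state `s` of a program that is relocated with the parameters `N` and `i`. -/
structure Holds (N i : ℤ) (s S : State) : Prop where
  reg : ∀ r, S.reg (breg r) = s.reg r
  mem : ∀ a z, S.mem (20 + a) (z * N + i) = s.mem a z
  mul : S.reg 40 = N
  off : S.reg 41 = i

/-- What a program relocated with the parameters `N` and `i` leaves unchanged. -/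
structure Keeps (N i : ℤ) (S S' : State) : Prop where
  reg : ∀ r < 100, S'.reg r = S.reg r
  arr : ∀ a < 20, S'.mem a = S.mem a
  mem : ∀ a y, y % N ≠ i → S'.mem a y = S.mem a y

/-- All registers and cells hold values of absolute value at most `b`. -/
structure State.Bounded (b : ℤ) (s : State) : Prop where
  reg : ∀ r, |s.reg r| ≤ b
  mem : ∀ a z, |s.mem a z| ≤ b

lemma Keeps.refl (N i : ℤ) (S : State) : Keeps N i S S :=
  ⟨fun _ _ => rfl, fun _ _ => rfl, fun _ _ _ => rfl⟩

lemma Keeps.trans {N i : ℤ} {A B C : State} (h : Keeps N i A B) (h' : Keeps N i B C) :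
    Keeps N i A C :=
  ⟨fun r hr => (h'.reg r hr).trans (h.reg r hr), fun a ha => (h'.arr a ha).trans (h.arr a ha),
    fun a y hy => (h'.mem a y hy).trans (h.mem a y hy)⟩

lemma Keeps.setReg {N i : ℤ} (S : State) {d : ℕ} (hd : 100 ≤ d) (v : ℤ) :
    Keeps N i S (S.setReg d v) :=
  ⟨fun r hr => State.setReg_reg_ne _ _ (by omega), fun _ _ => rfl, fun _ _ _ => rfl⟩

lemma Keeps.setMem {N i : ℤ} (S : State) (a : ℕ) {z : ℤ} (v : ℤ) (hi : 0 ≤ i) (hiN : i < N) :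
    Keeps N i S (S.setMem (20 + a) (z * N + i) v) := by
  refine ⟨fun _ _ => rfl, fun b hb => State.setMem_mem_ne _ _ _ (by omega), fun b y hy => ?_⟩
  rw [State.setMem_mem, if_neg]
  rintro ⟨-, rfl⟩
  apply hy
  rw [add_comm, Int.add_mul_emod_self_right, Int.emod_eq_of_lt hi hiN]

lemma Holds.setTemp {N i : ℤ} {s S : State} (h : Holds N i s S) (v : ℤ) :
    Holds N i s (S.setReg 100 v) := by
  refine ⟨fun r => ?_, h.mem, ?_, ?_⟩
  · rw [State.setReg_reg_ne _ _ (by unfold breg; omega), h.reg]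
  · rw [State.setReg_reg_ne _ _ (by omega), h.mul]
  · rw [State.setReg_reg_ne _ _ (by omega), h.off]

lemma Holds.setReg {N i : ℤ} {s S : State} (h : Holds N i s S) (d : ℕ) (v : ℤ) :
    Holds N i (s.setReg d v) (S.setReg (breg d) v) := by
  refine ⟨fun r => ?_, h.mem, ?_, ?_⟩
  · rw [State.setReg_reg, State.setReg_reg]
    simp only [breg_injective.eq_iff, h.reg]
  · rw [State.setReg_reg_ne _ _ (by unfold breg; omega), h.mul]
  · rw [State.setReg_reg_ne _ _ (by unfold breg; omega), h.off]

lemma Holds.setMem {N i : ℤ} {s S : State} (h : Holds N i s S) (hN : 0 < N) (a : ℕ) (z v : ℤ) :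
    Holds N i (s.setMem a z v) (S.setMem (20 + a) (z * N + i) v) := by
  refine ⟨h.reg, fun b y => ?_, h.mul, h.off⟩
  rw [State.setMem_mem, State.setMem_mem]
  have : (20 + b = 20 + a ∧ y * N + i = z * N + i) ↔ (b = a ∧ y = z) := by
    simp [hN.ne']
  simp only [this, h.mem]

lemma State.Bounded.setReg {b : ℤ} {s : State} (h : s.Bounded b) (d : ℕ) {v : ℤ} (hv : |v| ≤ b) :
    (s.setReg d v).Bounded b :=
  ⟨fun r => by rw [State.setReg_reg]; split_ifs; exacts [hv, h.reg r], h.mem⟩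

lemma State.Bounded.setMem {b : ℤ} {s : State} (h : s.Bounded b) (a : ℕ) (z : ℤ) {v : ℤ}
    (hv : |v| ≤ b) : (s.setMem a z v).Bounded b :=
  ⟨h.reg, fun c y => by rw [State.setMem_mem]; split_ifs; exacts [hv, h.mem c y]⟩

lemma abs_le_of_inRange {w : ℕ} {x b : ℤ} (h : InRange w x) (hb : 2 ^ w ≤ b) : |x| ≤ b := by
  obtain ⟨h1, h2⟩ := h
  rw [abs_le]; constructor <;> linarith

/-- A register content is at most `b` in absolute value and `i < N`, so neither the product nor the
address leaves the range guaranteed by `hb`. -/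
lemma address_exec {w' : ℕ} {N i b : ℤ} {s S : State} (hi : 0 ≤ i) (hiN : i < N)
    (hb : b * N + N < 2 ^ w') (hs : s.Bounded b) (h : Holds N i s S) (a : ℕ)
    (p : Prog) :
    ∃ S₁ : State, S₁.reg 100 = s.reg a * N + i ∧ Holds N i s S₁ ∧ Keeps N i S S₁ ∧
      ∀ S', Exec w' p S₁ S' 1 →
        Exec w' (.seq (.op .mul 100 (breg a) 40) (.seq (.op .add 100 100 41) p)) S S' 3 := by
  have hN : 0 < N := by omega
  have ha := hs.reg a
  have hmul : |s.reg a * N| ≤ b * N := by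
    rw [abs_mul, abs_of_pos hN]; exact mul_le_mul_of_nonneg_right ha hN.le
  have h1 := Exec.op (w := w') S .mul 100 (breg a) 40
    (by rw [h.reg, h.mul]; exact inRange_of_abs (by simp only [BinOp.eval]; omega))
  rw [h.reg, h.mul] at h1
  have k1 : Keeps N i S (S.setReg 100 (BinOp.mul.eval (s.reg a) N)) := Keeps.setReg S le_rfl _
  have r1 := h.setTemp (BinOp.mul.eval (s.reg a) N)
  generalize hS1 : S.setReg 100 (BinOp.mul.eval (s.reg a) N) = S1 at *
  have v1 : S1.reg 100 = s.reg a * N := by rw [← hS1]; simp [BinOp.eval]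
  have h2 := Exec.op (w := w') S1 .add 100 100 41
    (by
      rw [v1, r1.off]
      refine inRange_of_abs ?_
      simp only [BinOp.eval]
      rw [abs_le] at hmul
      rw [abs_lt]; constructor <;> omega)
  rw [v1, r1.off] at h2
  exact ⟨_, by simp [BinOp.eval], r1.setTemp _, k1.trans (Keeps.setReg _ le_rfl _),
    fun S' h3 => Exec.seq h1 (Exec.seq h2 h3)⟩

/-- A relocated program simulates the original one. -/
lemma reloc_exec {w w' : ℕ} {N i b : ℤ} (hww : w ≤ w') (hi : 0 ≤ i) (hiN : i < N)
    (hbw : 2 ^ w ≤ b) (hb : b * N + N < 2 ^ w') {p : Prog} {s s' : State} {t : ℕ}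
    (h : Exec w p s s' t) : s.Bounded b → ∀ S, Holds N i s S →
      s'.Bounded b ∧ ∃ S' t', Exec w' (reloc p) S S' t' ∧ t' ≤ 3 * t ∧ Holds N i s' S' ∧
        Keeps N i S S' := by
  have hN : 0 < N := by omega
  have h2w : (0 : ℤ) < 2 ^ w := by positivity
  have hrange : ∀ x : ℤ, InRange w x → InRange w' x := by
    rintro x ⟨h1, h2⟩
    have : (2 : ℤ) ^ w ≤ 2 ^ w' := pow_le_pow_right₀ (by norm_num) hww
    exact ⟨by omega, by omega⟩
  -- New values come only from constants and operations, which pass the range check for `w` and are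
  -- therefore at most `b`. Loads and stores copy values; initial contents may exceed the inner word
  -- range as long as they are at most `b`.
  induction h with
  | skip s => exact fun hs S hS => ⟨hs, S, 1, Exec.skip S, by omega, hS, Keeps.refl _ _ _⟩
  | const s d v hv =>
    exact fun hs S hS => ⟨hs.setReg d (abs_le_of_inRange hv hbw), _, 1,
      Exec.const _ _ _ (hrange v hv), by omega, hS.setReg d v,
      Keeps.setReg S (by unfold breg; omega) v⟩
  | op s f d x y hv =>
    intro hs S hS
    have h1 := Exec.op (w := w') S f (breg d) (breg x) (breg y)
      (by rw [hS.reg, hS.reg]; exact hrange _ hv)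
    rw [hS.reg, hS.reg] at h1
    exact ⟨hs.setReg d (abs_le_of_inRange hv hbw), _, 1, h1, by omega, hS.setReg d _,
      Keeps.setReg S (by unfold breg; omega) _⟩
  | load s d arr x =>
    intro hs S hS
    obtain ⟨S1, v1, r1, k1, e1⟩ := address_exec hi hiN hb hs hS x (.load (breg d) (20 + arr) 100)
    refine ⟨hs.setReg d (hs.mem _ _), _, 3, e1 _ (Exec.load _ _ _ _), by omega, ?_,
      k1.trans (Keeps.setReg _ (by unfold breg; omega) _)⟩
    rw [v1, r1.mem]
    exact r1.setReg d _
  | store s arr x y =>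
    intro hs S hS
    obtain ⟨S1, v1, r1, k1, e1⟩ := address_exec hi hiN hb hs hS x (.store (20 + arr) 100 (breg y))
    have h3 := Exec.store (w := w') S1 (20 + arr) 100 (breg y)
    rw [v1, r1.reg] at h3
    exact ⟨hs.setMem arr _ (hs.reg y), _, 3, e1 _ h3, by omega, r1.setMem hN arr _ _,
      k1.trans (Keeps.setMem _ arr _ hi hiN)⟩
  | seq h1 h2 ih1 ih2 =>
    intro hs S hS
    obtain ⟨b1, S1, t1, e1, ht1, r1, k1⟩ := ih1 hs S hS
    obtain ⟨b2, S2, t2, e2, ht2, r2, k2⟩ := ih2 b1 S1 r1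
    exact ⟨b2, S2, _, Exec.seq e1 e2, by omega, r2, k1.trans k2⟩
  | ite_true hr h ih =>
    intro hs S hS
    obtain ⟨b1, S1, t1, e1, ht1, r1, k1⟩ := ih hs S hS
    exact ⟨b1, S1, _, Exec.ite_true (by rw [hS.reg]; exact hr) e1, by omega, r1, k1⟩
  | ite_false hr h ih =>
    intro hs S hS
    obtain ⟨b1, S1, t1, e1, ht1, r1, k1⟩ := ih hs S hS
    exact ⟨b1, S1, _, Exec.ite_false (by rw [hS.reg]; exact hr) e1, by omega, r1, k1⟩
  | loop_stop hr =>
    exact fun hs S hS => ⟨hs, S, 1, Exec.loop_stop (by rw [hS.reg]; exact hr), by omega, hS,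
      Keeps.refl _ _ _⟩
  | loop_step hr h1 h2 ih1 ih2 =>
    intro hs S hS
    obtain ⟨b1, S1, t1, e1, ht1, r1, k1⟩ := ih1 hs S hS
    obtain ⟨b2, S2, t2, e2, ht2, r2, k2⟩ := ih2 b1 S1 r1
    exact ⟨b2, S2, _, Exec.loop_step (by rw [hS.reg]; exact hr) e1 e2, by omega, r2, k1.trans k2⟩

lemma Holds.of_equiv {N i : ℤ} {s S S' : State} (h : Holds N i s S) (hS : S'.Equiv S) :
    Holds N i s S' :=
  ⟨fun r => (hS.2 _ (not_isTemp_breg r)).trans (h.reg r), fun a z => by rw [hS.1, h.mem],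
    (hS.2 40 (by decide)).trans h.mul, (hS.2 41 (by decide)).trans h.off⟩

/-- Registers that a program never writes keep their contents. -/
lemma Prog.exists_reg_bound (p : Prog) : ∃ m, ∀ w s s' t, Exec w p s s' t →
    ∀ r, m ≤ r → s'.reg r = s.reg r := by
  induction p with
  | skip => exact ⟨0, fun w s s' t h r _ => by cases h; rfl⟩
  | const d v => exact ⟨d + 1, fun w s s' t h r hr => by
      cases h; exact State.setReg_reg_ne _ _ (by omega)⟩
  | op f d a b => exact ⟨d + 1, fun w s s' t h r hr => by
      cases h; exact State.setReg_reg_ne _ _ (by omega)⟩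
  | load d arr a => exact ⟨d + 1, fun w s s' t h r hr => by
      cases h; exact State.setReg_reg_ne _ _ (by omega)⟩
  | store arr a b => exact ⟨0, fun w s s' t h r _ => by cases h; rfl⟩
  | seq p q ihp ihq =>
    obtain ⟨m, hm⟩ := ihp
    obtain ⟨k, hk⟩ := ihq
    refine ⟨m + k, fun w s s' t h r hr => ?_⟩
    cases h with
    | seq h1 h2 => rw [hk _ _ _ _ h2 r (by omega), hm _ _ _ _ h1 r (by omega)]
  | ite c p q ihp ihq =>
    obtain ⟨m, hm⟩ := ihp
    obtain ⟨k, hk⟩ := ihq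
    refine ⟨m + k, fun w s s' t h r hr => ?_⟩
    cases h with
    | ite_true _ h => rw [hm _ _ _ _ h r (by omega)]
    | ite_false _ h => rw [hk _ _ _ _ h r (by omega)]
  | loop c p ih =>
    obtain ⟨m, hm⟩ := ih
    refine ⟨m, fun w s s' t h r hr => ?_⟩
    generalize hq : Prog.loop c p = q at h
    induction h with
    | loop_stop _ => rfl
    | loop_step _ h1 _ _ ih2 =>
      cases hq
      rw [ih2 rfl, hm _ _ _ _ h1 r hr]
    | _ => cases hq

/-- A relocated program does what the original one does. -/
lemma Runs.reloc {w w' : ℕ} {N i b : ℤ} (hww : w ≤ w') (hi : 0 ≤ i) (hiN : i < N)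
    (hbw : 2 ^ w ≤ b) (hb : b * N + N < 2 ^ w') {p : Prog} {s s' S : State} {t : ℕ}
    (h : Exec w p s s' t) (hs : s.Bounded b) (hS : Holds N i s S) {Q : State → ℕ → Prop}
    (hQ : ∀ S', Holds N i s' S' → Keeps N i S S' → Q S' (3 * t)) : Runs w' (reloc p) S Q := by
  intro S₀ hS₀
  obtain ⟨-, S', t', e, ht, r, k⟩ := reloc_exec hww hi hiN hbw hb h hs S₀ (hS.of_equiv hS₀)
  refine ⟨S', ⟨fun r => if r < 100 then S.reg r else S'.reg r, S'.mem⟩, t', _, e, ht,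
    ⟨rfl, fun x hx => ?_⟩, hQ _ ⟨fun x => ?_, r.mem, ?_, ?_⟩ ⟨fun x hx => ?_, ?_, ?_⟩⟩
  · by_cases h100 : x < 100
    · simp only [h100, if_true]
      rw [k.reg x h100, hS₀.2 x hx]
    · simp only [h100, if_false]
  · simp only [show ¬ breg x < 100 by unfold breg; omega, if_false, r.reg]
  · simp [hS.mul]
  · simp [hS.off]
  · simp [hx]
  · exact fun a ha => by rw [k.arr a ha, hS₀.1]
  · exact fun a y hy => by rw [k.mem a y hy, hS₀.1]

/-- Set the first `m` registers of a relocated program to `0`. -/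
def clearRegs : ℕ → Prog
  | 0 => .skip
  | m + 1 => .seq (clearRegs m) (.const (breg m) 0)

lemma Runs.clearRegs {w : ℕ} (m : ℕ) {s : State} {Q : State → ℕ → Prop}
    (hQ : ∀ s', s'.mem = s.mem → (∀ r < 100, s'.reg r = s.reg r) →
      (∀ r < m, s'.reg (breg r) = 0) → (∀ r, m ≤ r → s'.reg (breg r) = s.reg (breg r)) →
      Q s' (m + 1)) : Runs w (clearRegs m) s Q := by
  induction m generalizing Q with
  | zero => exact Runs.skip (hQ s rfl (fun _ _ => rfl) (by simp) (fun _ _ => rfl))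
  | succ m ih =>
    refine Runs.seq (ih ?_)
    intro s' h1 h2 h3 h4 S hS
    refine ⟨_, s'.setReg (breg m) 0, 1, 1, Exec.const _ _ _ (inRange_of_abs (by simp)), le_rfl,
      hS.setReg _ _, hQ _ h1 (fun r hr => ?_) (fun r hr => ?_) (fun r hr => ?_)⟩
    · rw [State.setReg_reg_ne _ _ (by unfold breg; omega), h2 r hr]
    · rw [State.setReg_reg]
      split_ifs with h
      · rfl
      · exact h3 r (by
          have : r ≠ m := by rintro rfl; exact h rfl
          omega)
    · rw [State.setReg_reg_ne _ _ (by unfold breg; omega), h4 r (by omega)]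

/-- The function `f` on cells `0, …, m - 1` of an array relocated with the parameters `N` and
`i`, and `g` elsewhere. -/
def rtab (N i : ℤ) (m : ℕ) (f g : ℤ → ℤ) : ℤ → ℤ := fun y =>
  if y % N = i then tab m f (fun _ => g y) (y / N) else g y

lemma rtab_zero (N i : ℤ) (f g : ℤ → ℤ) : rtab N i 0 f g = g := by
  funext y; simp [rtab, tab_zero]

lemma rtab_apply {N i : ℤ} (hi : 0 ≤ i) (hiN : i < N) (m : ℕ) (f g : ℤ → ℤ) (z : ℤ) :
    rtab N i m f g (z * N + i) = tab m f (fun z => g (z * N + i)) z := by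
  have h1 : (z * N + i) % N = i := by
    rw [add_comm, Int.add_mul_emod_self_right, Int.emod_eq_of_lt hi hiN]
  have h2 : (z * N + i) / N = z := by
    rw [add_comm, Int.add_mul_ediv_right _ _ (by omega), Int.ediv_eq_zero_of_lt hi hiN, zero_add]
  rw [rtab, if_pos h1, h2]
  simp only [tab]

lemma rtab_ne {N i : ℤ} (m : ℕ) (f g : ℤ → ℤ) {y : ℤ} (h : y % N ≠ i) :
    rtab N i m f g y = g y := if_neg h

lemma rtab_succ {N i : ℤ} (hi : 0 ≤ i) (hiN : i < N) (m : ℕ) (f g : ℤ → ℤ) :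
    rtab N i (m + 1) f g = Function.update (rtab N i m f g) (m * N + i) (f m) := by
  funext y
  by_cases hy : y = m * N + i
  · subst hy
    rw [rtab_apply hi hiN, tab_succ]; simp
  · rw [Function.update_of_ne hy]
    simp only [rtab, tab_succ]
    split_ifs with h
    · rw [Function.update_of_ne]
      rintro h'
      apply hy
      rw [← h, ← h', mul_comm]
      exact (Int.mul_ediv_add_emod y N).symm
    · rfl

/-- `for z < reg lim do mem arr [z] := e`, for array `arr` of a relocated program -/
def rfill (arr z lim : ℕ) (e : Ex) : Prog :=
  for_ z lim (write (20 + arr) (.var z * .var 40 + .var 41) e)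

lemma Runs.rfill {w : ℕ} {N i : ℤ} {s : State} {arr z lim : ℕ} {e : Ex} {Q : State → ℕ → Prop}
    (val : ℤ → ℤ) (m : ℕ) (hw : 0 < w) (hm : (m : ℤ) < 2 ^ w) (hi : 0 ≤ i) (hiN : i < N)
    (hmN : m * N + N < 2 ^ w)
    (hz : ¬ IsTemp z) (hl : ¬ IsTemp lim) (hzl : lim ≠ z) (hz40 : z ≠ 40) (hz41 : z ≠ 41)
    (hs : s.reg lim = m) (h40 : s.reg 40 = N) (h41 : s.reg 41 = i)
    (he : ∀ k : ℕ, k < m → ∀ s',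
      s' = (s.setArr (20 + arr) (rtab N i k val (s.mem (20 + arr)))).setReg z k →
      e.Ok w s' ∧ e.eval s' = val k)
    (hQ : Q ((s.setArr (20 + arr) (rtab N i m val (s.mem (20 + arr)))).setReg z m)
      ((e.cost + 17) * m + 9)) :
    Runs w (rfill arr z lim e) s Q := by
  refine Runs.for (fun k s' =>
    s' = (s.setArr (20 + arr) (rtab N i k val (s.mem (20 + arr)))).setReg z k) m
    (e.cost + 6) hw hm hz hl hzl hs ?_ ?_ ?_
  · simp [rtab_zero, State.setArr]
  · rintro k hk s' rfl h1 h2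
    obtain ⟨ho, hv⟩ := he k hk _ rfl
    have r40 : ((s.setArr (20 + arr) (rtab N i k val (s.mem (20 + arr)))).setReg z k).reg 40 = N := by
      rw [State.setReg_reg_ne _ _ hz40.symm]; simpa using h40
    have r41 : ((s.setArr (20 + arr) (rtab N i k val (s.mem (20 + arr)))).setReg z k).reg 41 = i := by
      rw [State.setReg_reg_ne _ _ hz41.symm]; simpa using h41
    have hkm : (k : ℤ) + 1 ≤ m := by exact_mod_cast hk
    have hkN : (k : ℤ) * N + N ≤ m * N := by nlinarith
    have hk0 : 0 ≤ (k : ℤ) * N := mul_nonneg (by positivity) (by omega)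
    refine Runs.write ?_ ho ⟨by simp; omega, ?_, ?_, ?_⟩
    · simp only [Ex.ok_add, Ex.ok_mul, Ex.ok_var, Ex.eval_mul, Ex.eval_var, r40, r41,
        State.setReg_reg_same, abs_lt]
      exact ⟨⟨hz, by decide, by omega, by omega⟩, by decide, by omega, by omega⟩
    · simp
    · simpa using h2
    · rw [hv]
      simp [r40, r41]
      simp [State.setArr, State.setReg, State.setMem, rtab_succ hi hiN]
  · rintro s' rfl h1 h2
    simpa [Nat.add_assoc] using hQ

end WordRAM
/-! ## Minimum-weight triangles and size-3 covers -/

/-- Total weight of the triangle `(a, b, c)` in a tripartite graph with parts of size `s`, whose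
edge weights are listed in row-major order by `A`, `B`, `C`. -/
def triWeight (s : ℕ) (A B C : ℤ → ℤ) (a b c : ℕ) : ℤ :=
  A (a * s + b) + B (a * s + c) + C (b * s + c)

/-- `(a, b, c)` is a triangle of minimum weight. -/
def IsMinTri (s : ℕ) (A B C : ℤ → ℤ) (a b c : ℕ) : Prop :=
  a < s ∧ b < s ∧ c < s ∧ ∀ a' b' c' : ℕ, a' < s → b' < s → c' < s →
    triWeight s A B C a b c ≤ triWeight s A B C a' b' c'

/-- A complete tripartite graph with parts of size `s` and integer edge weights in `[-U, U]`. -/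
structure TriInstance (c : ℕ) where
  s : ℕ
  s_pos : 0 < s
  U : ℕ
  -- The base is `s + 1` because powers of `s` would not leave room for large weights when `s = 1`.
  U_le : U ≤ (s + 1) ^ c
  A : ℤ → ℤ
  B : ℤ → ℤ
  C : ℤ → ℤ
  A_le : ∀ z : ℤ, |A z| ≤ U
  B_le : ∀ z : ℤ, |B z| ≤ U
  C_le : ∀ z : ℤ, |C z| ≤ U

/-- Minimum-weight triangle. Input: `s` and `U` in registers 0 and 1, the edge weights in arrays
0, 1, 2. Output: in array 3. -/
def MinTri (c : ℕ) : Problem where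
  Inst := TriInstance c
  size x := x.s
  input x := State.init [(x.s : ℤ), (x.U : ℤ)]
    [tab (x.s * x.s) x.A (fun _ => 0), tab (x.s * x.s) x.B (fun _ => 0),
      tab (x.s * x.s) x.C (fun _ => 0)]
  correct x st := ∃ a b c : ℕ, st.mem 3 0 = a ∧ st.mem 3 1 = b ∧ st.mem 3 2 = c ∧
    IsMinTri x.s x.A x.B x.C a b c

/-! ### The geometry of the covering instance -/

namespace TriCover

/-- Piecewise function on three consecutive blocks of length `q`. -/
def sel (q : ℤ) (f₀ f₁ f₂ : ℤ → ℤ) (e : ℤ) : ℤ :=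
  if e < q then f₀ e else if e < 2 * q then f₁ (e - q) else f₂ (e - 2 * q)

section
variable (s : ℤ)

/-- With `z = i * s + j`, the families are `(i, -j)`, `(-1 - j, i)`, and a third one on the line `x
+ y = s * s + 2 * s` that consists of `s` consecutive runs, one for each `i`. Only `i` matters for
being covered; `j` supplies enough distinct points to match the number of objects. -/
def ptX : ℤ → ℤ := sel (s * s) (fun z => z / s) (fun z => -1 - z % s) (fun z => s + z)
def ptY : ℤ → ℤ := sel (s * s) (fun z => 0 - z % s) (fun z => z / s) (fun z => s * s + s - z)
-- The orthants are `x ≤ a - 1, y ≤ b` for an edge `(a, b)`; `x ≥ a, y ≤ s * s - c * s` for `(a,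
-- c)`; and `x ≤ (c + 2) * s - 1, y ≥ b + 1` for `(b, c)`. Each coordinate of an apex acts on one
-- family of points and is harmless for the others.
def apX : ℤ → ℤ :=
  sel (s * s) (fun z => z / s - 1) (fun z => z / s) (fun z => z % s * s + s + s - 1)
def apY : ℤ → ℤ :=
  sel (s * s) (fun z => z % s) (fun z => s * s - z % s * s) (fun z => z / s + 1)
def upX : ℤ → ℤ := sel (s * s) (fun _ => 0) (fun _ => 1) (fun _ => 0)
def upY : ℤ → ℤ := sel (s * s) (fun _ => 0) (fun _ => 0) (fun _ => 1)
-- The summand `U` makes the weights nonnegative. For one object from each block, the multiples of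
-- `6 * U + 1` add up to `3 * s` plus the total slack `(a₁ - a₂) + (b₁ - b₃) + (c₃ - c₂)`.
def weight (U : ℤ) (A B C : ℤ → ℤ) : ℤ → ℤ :=
  sel (s * s) (fun z => A z + U + (6 * U + 1) * (z / s + z % s))
    (fun z => B z + U + (6 * U + 1) * ((s - z / s) + (s - z % s)))
    (fun z => C z + U + (6 * U + 1) * ((s - z / s) + z % s))

/-- Point `i` is in the orthant `e`. -/
def Cov (e i : ℤ) : Prop :=
  (if upX s e = 1 then apX s e ≤ ptX s i else ptX s i ≤ apX s e) ∧
    (if upY s e = 1 then apY s e ≤ ptY s i else ptY s i ≤ apY s e)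

end

set_option linter.unusedSectionVars false

section
variable {s : ℤ} (hs : 0 < s) {a b : ℤ} (ha : 0 ≤ a) (ha' : a < s) (hb : 0 ≤ b) (hb' : b < s)
include hs ha ha' hb hb'

lemma cell_lt : a * s + b < s * s := by nlinarith

lemma cell_nonneg : 0 ≤ a * s + b := by nlinarith

lemma cell_div : (a * s + b) / s = a := by
  rw [add_comm, Int.add_mul_ediv_right _ _ hs.ne', Int.ediv_eq_zero_of_lt hb hb', zero_add]

lemma cell_mod : (a * s + b) % s = b := by
  rw [add_comm, Int.add_mul_emod_self_right, Int.emod_eq_of_lt hb hb']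

lemma sel_zero (f₀ f₁ f₂ : ℤ → ℤ) : sel (s * s) f₀ f₁ f₂ (a * s + b) = f₀ (a * s + b) :=
  if_pos (cell_lt hs ha ha' hb hb')

lemma sel_one (f₀ f₁ f₂ : ℤ → ℤ) :
    sel (s * s) f₀ f₁ f₂ (s * s + (a * s + b)) = f₁ (a * s + b) := by
  have h1 := cell_lt hs ha ha' hb hb'
  have h2 := cell_nonneg hs ha ha' hb hb'
  rw [sel, if_neg (by omega), if_pos (by omega), add_sub_cancel_left]

lemma sel_two (f₀ f₁ f₂ : ℤ → ℤ) :
    sel (s * s) f₀ f₁ f₂ (2 * (s * s) + (a * s + b)) = f₂ (a * s + b) := by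
  have h1 := cell_lt hs ha ha' hb hb'
  have h2 := cell_nonneg hs ha ha' hb hb'
  have h3 : 0 < s * s := by positivity
  rw [sel, if_neg (by omega), if_neg (by omega), add_sub_cancel_left]

end

lemma exists_cell {s : ℤ} (hs : 0 < s) {z : ℤ} (h0 : 0 ≤ z) (h : z < s * s) :
    ∃ a b, 0 ≤ a ∧ a < s ∧ 0 ≤ b ∧ b < s ∧ z = a * s + b :=
  ⟨z / s, z % s, Int.ediv_nonneg h0 hs.le, Int.ediv_lt_of_lt_mul hs h,
    Int.emod_nonneg _ hs.ne', Int.emod_lt_of_pos _ hs, by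
      rw [mul_comm]; exact (Int.mul_ediv_add_emod z s).symm⟩

/-- Every index is a cell of one of the three blocks. -/
lemma exists_block {s : ℤ} (hs : 0 < s) {e : ℤ} (h0 : 0 ≤ e) (h : e < 3 * (s * s)) :
    ∃ a b, 0 ≤ a ∧ a < s ∧ 0 ≤ b ∧ b < s ∧
      (e = a * s + b ∨ e = s * s + (a * s + b) ∨ e = 2 * (s * s) + (a * s + b)) := by
  rcases lt_or_ge e (s * s) with h1 | h1
  · obtain ⟨a, b, h1, h2, h3, h4, h5⟩ := exists_cell hs h0 h1
    exact ⟨a, b, h1, h2, h3, h4, Or.inl h5⟩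
  · rcases lt_or_ge e (2 * (s * s)) with h2 | h2
    · obtain ⟨a, b, h1, h2, h3, h4, h5⟩ := exists_cell hs (z := e - s * s) (by omega) (by omega)
      exact ⟨a, b, h1, h2, h3, h4, Or.inr (Or.inl (by omega))⟩
    · obtain ⟨a, b, h1, h2, h3, h4, h5⟩ := exists_cell hs (z := e - 2 * (s * s)) (by omega)
        (by omega)
      exact ⟨a, b, h1, h2, h3, h4, Or.inr (Or.inr (by omega))⟩

section
variable {s : ℤ} (hs : 0 < s) {a b i j : ℤ} (ha : 0 ≤ a) (ha' : a < s) (hb : 0 ≤ b) (hb' : b < s)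
  (hi : 0 ≤ i) (hi' : i < s) (hj : 0 ≤ j) (hj' : j < s)
include hs ha ha' hb hb' hi hi' hj hj'

/-- The names give the block of the object, then that of the point. Each family of points is missed
entirely by one kind of orthant; of the other two kinds, one covers an initial and one a final
segment of the indices `i`. -/
lemma cov_zero_zero : Cov s (a * s + b) (i * s + j) ↔ i < a := by
  simp only [Cov, upX, upY, apX, apY, ptX, ptY, sel_zero hs ha ha' hb hb',
    sel_zero hs hi hi' hj hj', cell_div hs ha ha' hb hb', cell_mod hs ha ha' hb hb',
    cell_div hs hi hi' hj hj', cell_mod hs hi hi' hj hj', zero_ne_one, if_false]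
  omega

lemma cov_one_zero : Cov s (s * s + (a * s + b)) (i * s + j) ↔ a ≤ i := by
  have : b * s ≤ s * s := by nlinarith
  simp only [Cov, upX, upY, apX, apY, ptX, ptY, sel_one hs ha ha' hb hb',
    sel_zero hs hi hi' hj hj', cell_div hs ha ha' hb hb', cell_mod hs ha ha' hb hb',
    cell_div hs hi hi' hj hj', cell_mod hs hi hi' hj hj', zero_ne_one, if_false, if_true]
  omega

lemma cov_two_zero : ¬ Cov s (2 * (s * s) + (a * s + b)) (i * s + j) := by
  simp only [Cov, upX, upY, apX, apY, ptX, ptY, sel_two hs ha ha' hb hb',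
    sel_zero hs hi hi' hj hj', cell_div hs ha ha' hb hb', cell_mod hs ha ha' hb hb',
    cell_div hs hi hi' hj hj', cell_mod hs hi hi' hj hj', zero_ne_one, if_false, if_true]
  omega

lemma cov_zero_one : Cov s (a * s + b) (s * s + (i * s + j)) ↔ i ≤ b := by
  simp only [Cov, upX, upY, apX, apY, ptX, ptY, sel_zero hs ha ha' hb hb',
    sel_one hs hi hi' hj hj', cell_div hs ha ha' hb hb', cell_mod hs ha ha' hb hb',
    cell_div hs hi hi' hj hj', cell_mod hs hi hi' hj hj', zero_ne_one, if_false]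
  omega

lemma cov_one_one : ¬ Cov s (s * s + (a * s + b)) (s * s + (i * s + j)) := by
  simp only [Cov, upX, upY, apX, apY, ptX, ptY, sel_one hs ha ha' hb hb',
    sel_one hs hi hi' hj hj', cell_div hs ha ha' hb hb', cell_mod hs ha ha' hb hb',
    cell_div hs hi hi' hj hj', cell_mod hs hi hi' hj hj', zero_ne_one, if_false, if_true]
  omega

lemma cov_two_one : Cov s (2 * (s * s) + (a * s + b)) (s * s + (i * s + j)) ↔ a < i := by
  have : 0 ≤ b * s := by positivity
  simp only [Cov, upX, upY, apX, apY, ptX, ptY, sel_two hs ha ha' hb hb',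
    sel_one hs hi hi' hj hj', cell_div hs ha ha' hb hb', cell_mod hs ha ha' hb hb',
    cell_div hs hi hi' hj hj', cell_mod hs hi hi' hj hj', zero_ne_one, if_false, if_true]
  omega

lemma cov_zero_two : ¬ Cov s (a * s + b) (2 * (s * s) + (i * s + j)) := by
  have := cell_nonneg hs hi hi' hj hj'
  simp only [Cov, upX, upY, apX, apY, ptX, ptY, sel_zero hs ha ha' hb hb',
    sel_two hs hi hi' hj hj', cell_div hs ha ha' hb hb', cell_mod hs ha ha' hb hb',
    zero_ne_one, if_false]
  omega

lemma cov_one_two : Cov s (s * s + (a * s + b)) (2 * (s * s) + (i * s + j)) ↔ b < i := by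
  have h0 := cell_nonneg hs hi hi' hj hj'
  simp only [Cov, upX, upY, apX, apY, ptX, ptY, sel_one hs ha ha' hb hb',
    sel_two hs hi hi' hj hj', cell_div hs ha ha' hb hb', cell_mod hs ha ha' hb hb',
    zero_ne_one, if_false, if_true]
  constructor
  · rintro ⟨h1, h2⟩
    by_contra hcon
    have : i * s ≤ b * s := mul_le_mul_of_nonneg_right (by omega) hs.le
    omega
  · intro h
    have : (b + 1) * s ≤ i * s := mul_le_mul_of_nonneg_right (by omega) hs.le
    constructor <;> linarith

lemma cov_two_two : Cov s (2 * (s * s) + (a * s + b)) (2 * (s * s) + (i * s + j)) ↔ i ≤ b := by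
  have h0 := cell_lt hs hi hi' hj hj'
  simp only [Cov, upX, upY, apX, apY, ptX, ptY, sel_two hs ha ha' hb hb',
    sel_two hs hi hi' hj hj', cell_div hs ha ha' hb hb', cell_mod hs ha ha' hb hb',
    zero_ne_one, if_false, if_true]
  constructor
  · rintro ⟨h1, h2⟩
    by_contra hcon
    have : (b + 1) * s ≤ i * s := mul_le_mul_of_nonneg_right (by omega) hs.le
    linarith
  · intro h
    have : i * s ≤ b * s := mul_le_mul_of_nonneg_right (by omega) hs.le
    constructor <;> linarith

end

section
variable {s : ℤ} (hs : 0 < s) {a b U : ℤ} {A B C : ℤ → ℤ} (ha : 0 ≤ a) (ha' : a < s) (hb : 0 ≤ b)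
  (hb' : b < s)
include hs ha ha' hb hb'

lemma weight_zero : weight s U A B C (a * s + b) = A (a * s + b) + U + (6 * U + 1) * (a + b) := by
  rw [weight, sel_zero hs ha ha' hb hb', cell_div hs ha ha' hb hb', cell_mod hs ha ha' hb hb']

lemma weight_one : weight s U A B C (s * s + (a * s + b)) =
    B (a * s + b) + U + (6 * U + 1) * ((s - a) + (s - b)) := by
  rw [weight, sel_one hs ha ha' hb hb', cell_div hs ha ha' hb hb', cell_mod hs ha ha' hb hb']

lemma weight_two : weight s U A B C (2 * (s * s) + (a * s + b)) =
    C (a * s + b) + U + (6 * U + 1) * ((s - a) + b) := by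
  rw [weight, sel_two hs ha ha' hb hb', cell_div hs ha ha' hb hb', cell_mod hs ha ha' hb hb']

end

/-- The three objects, one from each block, cover all points iff they are consistent. -/
lemma covers_iff {s : ℤ} (hs : 0 < s) {a₁ b₁ a₂ c₂ b₃ c₃ : ℤ} (h1 : 0 ≤ a₁) (h1' : a₁ < s)
    (h2 : 0 ≤ b₁) (h2' : b₁ < s) (h3 : 0 ≤ a₂) (h3' : a₂ < s) (h4 : 0 ≤ c₂) (h4' : c₂ < s)
    (h5 : 0 ≤ b₃) (h5' : b₃ < s) (h6 : 0 ≤ c₃) (h6' : c₃ < s) :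
    (∀ i, 0 ≤ i → i < 3 * (s * s) → Cov s (a₁ * s + b₁) i ∨ Cov s (s * s + (a₂ * s + c₂)) i ∨
      Cov s (2 * (s * s) + (b₃ * s + c₃)) i) ↔ a₂ ≤ a₁ ∧ b₃ ≤ b₁ ∧ c₂ ≤ c₃ := by
  constructor
  · intro H
    have hss : 0 < s * s := by positivity
    -- The critical points have first index `a₁`, `b₃` and `c₂` in their families: of the two
    -- orthants relevant for the family, one just misses the point, so the other has to cover it.
    refine ⟨?_, ?_, ?_⟩
    · have hn := cell_nonneg hs h1 h1' le_rfl hs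
      have hl := cell_lt hs h1 h1' le_rfl hs
      have := H (a₁ * s + 0) hn (by omega)
      rw [cov_zero_zero hs h1 h1' h2 h2' h1 h1' le_rfl hs,
        cov_one_zero hs h3 h3' h4 h4' h1 h1' le_rfl hs] at this
      have h := cov_two_zero hs h5 h5' h6 h6' h1 h1' le_rfl hs
      rcases this with h' | h' | h'
      exacts [absurd h' (lt_irrefl _), h', absurd h' h]
    · have hn := cell_nonneg hs h5 h5' le_rfl hs
      have hl := cell_lt hs h5 h5' le_rfl hs
      have := H (s * s + (b₃ * s + 0)) (by omega) (by omega)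
      rw [cov_zero_one hs h1 h1' h2 h2' h5 h5' le_rfl hs,
        cov_two_one hs h5 h5' h6 h6' h5 h5' le_rfl hs] at this
      have h := cov_one_one hs h3 h3' h4 h4' h5 h5' le_rfl hs
      rcases this with h' | h' | h'
      exacts [h', absurd h' h, absurd h' (lt_irrefl _)]
    · have hn := cell_nonneg hs h4 h4' le_rfl hs
      have hl := cell_lt hs h4 h4' le_rfl hs
      have := H (2 * (s * s) + (c₂ * s + 0)) (by omega) (by omega)
      rw [cov_one_two hs h3 h3' h4 h4' h4 h4' le_rfl hs,
        cov_two_two hs h5 h5' h6 h6' h4 h4' le_rfl hs] at this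
      have h := cov_zero_two hs h1 h1' h2 h2' h4 h4' le_rfl hs
      rcases this with h' | h' | h'
      exacts [absurd h' h, absurd h' (lt_irrefl _), h']
  · rintro ⟨g1, g2, g3⟩ e he he'
    obtain ⟨i, j, hi, hi', hj, hj', rfl | rfl | rfl⟩ := exists_block hs he he'
    · rw [cov_zero_zero hs h1 h1' h2 h2' hi hi' hj hj',
        cov_one_zero hs h3 h3' h4 h4' hi hi' hj hj']
      omega
    · rw [cov_zero_one hs h1 h1' h2 h2' hi hi' hj hj',
        cov_two_one hs h5 h5' h6 h6' hi hi' hj hj']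
      omega
    · rw [cov_one_two hs h3 h3' h4 h4' hi hi' hj hj',
        cov_two_two hs h5 h5' h6 h6' hi hi' hj hj']
      omega

/-- The vertices of the triangle given by three objects, one from each block, in any order. -/
def decA (s e₁ e₂ e₃ : ℤ) : ℤ :=
  if e₁ < s * s then e₁ / s else if e₂ < s * s then e₂ / s else e₃ / s
def decB (s e₁ e₂ e₃ : ℤ) : ℤ :=
  if e₁ < s * s then e₁ % s else if e₂ < s * s then e₂ % s else e₃ % s
-- Two indices suffice: one of them lies outside block 0, and in a cover without slack both objects
-- outside block 0 have residue `c` modulo `s`, as the block offsets are multiples of `s`.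
def decC (s e₁ e₂ : ℤ) : ℤ := if e₁ < s * s then e₂ % s else e₁ % s

lemma exists_natCast_eq {s : ℕ} {a : ℤ} (h : 0 ≤ a) (h' : a < s) : ∃ k : ℕ, a = k ∧ k < s :=
  ⟨a.toNat, by omega, by omega⟩

/-- An optimal cover yields a triangle of minimum weight. -/
lemma isMinTri_of_answers {s n U : ℕ} (hs : 0 < s) (hn : n = 3 * (s * s))
    {A B C : ℤ → ℤ} (hA : ∀ z, |A z| ≤ U) (hB : ∀ z, |B z| ≤ U) (hC : ∀ z, |C z| ≤ U)
    {P : Fin n → Fin 2 → ℝ} {R : Fin n → Set (Fin 2 → ℝ)} {wt : Fin n → ℕ}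
    (hcov : ∀ i j : Fin n, P i ∈ R j ↔ Cov s (j : ℕ) (i : ℕ))
    (hwt : ∀ j : Fin n, (wt j : ℤ) = weight s U A B C (j : ℕ)) {out : ℤ → ℤ}
    (h : AnswersCover3 P R wt out) :
    (0 ≤ out 1 ∧ out 1 < 3 * (s * s)) ∧ (0 ≤ out 2 ∧ out 2 < 3 * (s * s)) ∧
      (0 ≤ out 3 ∧ out 3 < 3 * (s * s)) ∧
    ∃ a b c : ℕ, decA s (out 1) (out 2) (out 3) = a ∧ decB s (out 1) (out 2) (out 3) = b ∧
      decC s (out 1) (out 2) = c ∧ IsMinTri s A B C a b c := by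
  have hsz : (0 : ℤ) < s := by exact_mod_cast hs
  have hss : (0 : ℤ) < s * s := by positivity
  have key : ∀ j : Fin n, (0 : ℤ) ≤ (j : ℕ) ∧ ((j : ℕ) : ℤ) < 3 * (s * s) := fun j =>
    ⟨by positivity, by have := j.2; exact_mod_cast (by omega : (j : ℕ) < 3 * (s * s))⟩
  have mk : ∀ e : ℤ, 0 ≤ e → e < 3 * (s * s) → ∃ j : Fin n, ((j : ℕ) : ℤ) = e := by
    intro e h0 h1
    obtain ⟨k, rfl, hk⟩ := exists_natCast_eq (s := 3 * (s * s)) h0 (by exact_mod_cast h1)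
    exact ⟨⟨k, by omega⟩, rfl⟩
  -- the cover given by a triangle
  have tri : ∀ a b c : ℤ, 0 ≤ a → a < s → 0 ≤ b → b < s → 0 ≤ c → c < s →
      ∃ S : Finset (Fin n), S.card = 3 ∧ Covers P R S ∧
        ((∑ j ∈ S, wt j : ℕ) : ℤ) = A (a * s + b) + B (a * s + c) + C (b * s + c) + 3 * U +
          (6 * U + 1) * (3 * s) := by
    intro a b c h1 h1' h2 h2' h3 h3'
    have q1 := cell_nonneg hsz h1 h1' h2 h2'
    have q1' := cell_lt hsz h1 h1' h2 h2'
    have q2 := cell_nonneg hsz h1 h1' h3 h3'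
    have q2' := cell_lt hsz h1 h1' h3 h3'
    have q3 := cell_nonneg hsz h2 h2' h3 h3'
    have q3' := cell_lt hsz h2 h2' h3 h3'
    obtain ⟨j0, e0⟩ := mk (a * s + b) q1 (by omega)
    obtain ⟨j1, e1⟩ := mk (s * s + (a * s + c)) (by omega) (by omega)
    obtain ⟨j2, e2⟩ := mk (2 * (s * s) + (b * s + c)) (by omega) (by omega)
    have n01 : j0 ≠ j1 := by rintro rfl; omega
    have n02 : j0 ≠ j2 := by rintro rfl; omega
    have n12 : j1 ≠ j2 := by rintro rfl; omega
    refine ⟨{j0, j1, j2}, Finset.card_eq_three.2 ⟨_, _, _, n01, n02, n12, rfl⟩, ?_, ?_⟩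
    · intro i
      have := (covers_iff hsz h1 h1' h2 h2' h1 h1' h3 h3' h2 h2' h3 h3').2
        ⟨le_rfl, le_rfl, le_rfl⟩ (i : ℕ) (key i).1 (key i).2
      rw [← e0, ← e1, ← e2, ← hcov, ← hcov, ← hcov] at this
      simpa using this
    · rw [Finset.sum_insert (by simp [n01, n02]), Finset.sum_insert (by simp [n12]),
        Finset.sum_singleton]
      push_cast
      rw [hwt, hwt, hwt, e0, e1, e2, weight_zero hsz h1 h1' h2 h2', weight_one hsz h1 h1' h3 h3',
        weight_two hsz h2 h2' h3 h3']
      ring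
  rcases h with ⟨-, i, j, k, o1, o2, o3, hcard, hC3, hmin⟩ | ⟨-, hno⟩
  swap
  · obtain ⟨S, hS, hS', -⟩ := tri 0 0 0 le_rfl hsz le_rfl hsz le_rfl hsz
    exact absurd hS' (hno S hS)
  rw [o1, o2, o3]
  refine ⟨key i, key j, key k, ?_⟩
  -- each block contributes an object
  have hcell := cell_lt hsz le_rfl hsz le_rfl hsz
  have hlast : (0 : ℤ) ≤ s - 1 := by omega
  have hcl := cell_lt hsz hlast (by omega) le_rfl hsz
  have hcn := cell_nonneg hsz hlast (by omega) le_rfl hsz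
  -- Each of these three extreme points can be covered by only one kind of object: `p0` by block 0,
  -- `p1` by block 1, `p2` by block 2.
  obtain ⟨p0, ep0⟩ := mk (s * s + (0 * s + 0)) (by omega) (by omega)
  obtain ⟨p1, ep1⟩ := mk ((s - 1) * s + 0) (by omega) (by omega)
  obtain ⟨p2, ep2⟩ := mk (2 * (s * s) + (0 * s + 0)) (by omega) (by omega)
  have b0 : ∃ j0 ∈ ({i, j, k} : Finset (Fin n)), ∃ a b : ℤ, 0 ≤ a ∧ a < s ∧ 0 ≤ b ∧ b < s ∧
      ((j0 : ℕ) : ℤ) = a * s + b := by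
    obtain ⟨j0, hj0, hc⟩ := hC3 p0
    rw [hcov, ep0] at hc
    obtain ⟨a, b, g1, g2, g3, g4, e | e | e⟩ := exists_block hsz (key j0).1 (key j0).2
    · exact ⟨j0, hj0, a, b, g1, g2, g3, g4, e⟩
    · rw [e] at hc; exact absurd hc (cov_one_one hsz g1 g2 g3 g4 le_rfl hsz le_rfl hsz)
    · rw [e, cov_two_one hsz g1 g2 g3 g4 le_rfl hsz le_rfl hsz] at hc; omega
  have b1 : ∃ j1 ∈ ({i, j, k} : Finset (Fin n)), ∃ a b : ℤ, 0 ≤ a ∧ a < s ∧ 0 ≤ b ∧ b < s ∧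
      ((j1 : ℕ) : ℤ) = s * s + (a * s + b) := by
    obtain ⟨j0, hj0, hc⟩ := hC3 p1
    rw [hcov, ep1] at hc
    obtain ⟨a, b, g1, g2, g3, g4, e | e | e⟩ := exists_block hsz (key j0).1 (key j0).2
    · rw [e, cov_zero_zero hsz g1 g2 g3 g4 hlast (by omega) le_rfl hsz] at hc; omega
    · exact ⟨j0, hj0, a, b, g1, g2, g3, g4, e⟩
    · rw [e] at hc; exact absurd hc (cov_two_zero hsz g1 g2 g3 g4 hlast (by omega) le_rfl hsz)
  have b2 : ∃ j2 ∈ ({i, j, k} : Finset (Fin n)), ∃ a b : ℤ, 0 ≤ a ∧ a < s ∧ 0 ≤ b ∧ b < s ∧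
      ((j2 : ℕ) : ℤ) = 2 * (s * s) + (a * s + b) := by
    obtain ⟨j0, hj0, hc⟩ := hC3 p2
    rw [hcov, ep2] at hc
    obtain ⟨a, b, g1, g2, g3, g4, e | e | e⟩ := exists_block hsz (key j0).1 (key j0).2
    · rw [e] at hc; exact absurd hc (cov_zero_two hsz g1 g2 g3 g4 le_rfl hsz le_rfl hsz)
    · rw [e, cov_one_two hsz g1 g2 g3 g4 le_rfl hsz le_rfl hsz] at hc; omega
    · exact ⟨j0, hj0, a, b, g1, g2, g3, g4, e⟩
  obtain ⟨j0, m0, a₁, b₁, h1, h1', h2, h2', e0⟩ := b0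
  obtain ⟨j1, m1, a₂, c₂, h3, h3', h4, h4', e1⟩ := b1
  obtain ⟨j2, m2, b₃, c₃, h5, h5', h6, h6', e2⟩ := b2
  have q1 := cell_nonneg hsz h1 h1' h2 h2'
  have q1' := cell_lt hsz h1 h1' h2 h2'
  have q2 := cell_nonneg hsz h3 h3' h4 h4'
  have q2' := cell_lt hsz h3 h3' h4 h4'
  have q3 := cell_nonneg hsz h5 h5' h6 h6'
  have q3' := cell_lt hsz h5 h5' h6 h6'
  have n01 : j0 ≠ j1 := by rintro rfl; omega
  have n02 : j0 ≠ j2 := by rintro rfl; omega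
  have n12 : j1 ≠ j2 := by rintro rfl; omega
  have hset : ({j0, j1, j2} : Finset (Fin n)) = {i, j, k} := by
    refine Finset.eq_of_subset_of_card_le ?_ ?_
    · intro x hx
      simp only [Finset.mem_insert, Finset.mem_singleton] at hx
      rcases hx with rfl | rfl | rfl <;> assumption
    · rw [hcard, Finset.card_eq_three.2 ⟨_, _, _, n01, n02, n12, rfl⟩]
  obtain ⟨g1, g2, g3⟩ := (covers_iff hsz h1 h1' h2 h2' h3 h3' h4 h4' h5 h5' h6 h6').1 (by
    intro e he he'
    obtain ⟨p, rfl⟩ := mk e he he'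
    obtain ⟨x, hx, hc⟩ := hC3 p
    rw [hcov] at hc
    rw [← hset] at hx
    rw [← e0, ← e1, ← e2]
    simp only [Finset.mem_insert, Finset.mem_singleton] at hx
    rcases hx with rfl | rfl | rfl <;> tauto)
  have hsum : ((∑ x ∈ ({i, j, k} : Finset (Fin n)), wt x : ℕ) : ℤ) =
      A (a₁ * s + b₁) + B (a₂ * s + c₂) + C (b₃ * s + c₃) + 3 * U +
        (6 * U + 1) * (3 * s + ((a₁ - a₂) + (b₁ - b₃) + (c₃ - c₂))) := by
    rw [← hset, Finset.sum_insert (by simp [n01, n02]), Finset.sum_insert (by simp [n12]),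
        Finset.sum_singleton]
    push_cast
    rw [hwt, hwt, hwt, e0, e1, e2, weight_zero hsz h1 h1' h2 h2', weight_one hsz h3 h3' h4 h4',
      weight_two hsz h5 h5' h6 h6']
    ring
  have hle : ∀ a b c : ℤ, 0 ≤ a → a < s → 0 ≤ b → b < s → 0 ≤ c → c < s →
      A (a₁ * s + b₁) + B (a₂ * s + c₂) + C (b₃ * s + c₃) +
        (6 * U + 1) * ((a₁ - a₂) + (b₁ - b₃) + (c₃ - c₂)) ≤
      A (a * s + b) + B (a * s + c) + C (b * s + c) := by
    intro a b c r1 r1' r2 r2' r3 r3'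
    obtain ⟨S, hS, hS', hw⟩ := tri a b c r1 r1' r2 r2' r3 r3'
    have : ((∑ x ∈ ({i, j, k} : Finset (Fin n)), wt x : ℕ) : ℤ) ≤ (∑ x ∈ S, wt x : ℕ) := by
      exact_mod_cast hmin S hS hS'
    rw [hsum, hw] at this
    linarith
  -- One unit of slack costs `6 * U + 1`, more than the difference between any two sums of three
  -- edge weights in `[-U, U]`. So a cover with slack loses to the triangle `(0, 0, 0)`.
  have hpen : (a₁ - a₂) + (b₁ - b₃) + (c₃ - c₂) ≤ 0 := by
    by_contra hcon
    have h000 := hle 0 0 0 le_rfl hsz le_rfl hsz le_rfl hsz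
    have hU : (0 : ℤ) ≤ 6 * U + 1 := by positivity
    have : (6 * (U : ℤ) + 1) * 1 ≤ (6 * U + 1) * ((a₁ - a₂) + (b₁ - b₃) + (c₃ - c₂)) :=
      mul_le_mul_of_nonneg_left (by omega) hU
    have := abs_le.1 (hA (a₁ * s + b₁))
    have := abs_le.1 (hB (a₂ * s + c₂))
    have := abs_le.1 (hC (b₃ * s + c₃))
    have := abs_le.1 (hA (0 * s + 0))
    have := abs_le.1 (hB (0 * s + 0))
    have := abs_le.1 (hC (0 * s + 0))
    linarith
  -- The three slacks are nonnegative by `g1`, `g2`, `g3`, and their sum is not positive.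
  obtain rfl : a₂ = a₁ := by omega
  obtain rfl : b₃ = b₁ := by omega
  obtain rfl : c₂ = c₃ := by omega
  obtain ⟨a, rfl, la⟩ := exists_natCast_eq h1 h1'
  obtain ⟨b, rfl, lb⟩ := exists_natCast_eq h2 h2'
  obtain ⟨c, rfl, lc⟩ := exists_natCast_eq h4 h4'
  have f0d := cell_div hsz h1 h1' h2 h2'
  have f0m := cell_mod hsz h1 h1' h2 h2'
  have f1m : (s * s + (a * s + c) : ℤ) % s = c := by
    rw [show (s * s + (a * s + c) : ℤ) = c + (s + a) * s by ring, Int.add_mul_emod_self_right,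
      Int.emod_eq_of_lt h4 h4']
  have f2m : (2 * (s * s) + (b * s + c) : ℤ) % s = c := by
    rw [show (2 * (s * s) + (b * s + c) : ℤ) = c + (2 * s + b) * s by ring,
      Int.add_mul_emod_self_right, Int.emod_eq_of_lt h4 h4']
  rw [← e0] at f0d f0m
  rw [← e1] at f1m
  rw [← e2] at f2m
  have l0 : ((j0 : ℕ) : ℤ) < s * s := by omega
  have l1 : ¬ ((j1 : ℕ) : ℤ) < s * s := by omega
  have l2 : ¬ ((j2 : ℕ) : ℤ) < s * s := by omega
  refine ⟨a, b, c, ?_⟩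
  have hmt : IsMinTri s A B C a b c := by
    refine ⟨la, lb, lc, fun a' b' c' ra rb rc => ?_⟩
    have := hle a' b' c' (by positivity) (by exact_mod_cast ra) (by positivity)
      (by exact_mod_cast rb) (by positivity) (by exact_mod_cast rc)
    simpa [triWeight] using this
  simp only [Finset.mem_insert, Finset.mem_singleton] at m0 m1 m2
  unfold decA decB decC
  rcases m0 with rfl | rfl | rfl <;> rcases m1 with rfl | rfl | rfl <;>
    first
    | exact absurd rfl n01
    | (rcases m2 with rfl | rfl | rfl <;>
        first
        | exact absurd rfl n02
        | exact absurd rfl n12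
        | exact ⟨by simp [l0, l1, l2, f0d], by simp [l0, l1, l2, f0m],
            by simp [l0, l1, l2, f1m, f2m], hmt⟩)

end TriCover
/-! ## From covers to triangles -/

namespace WordRAM

/-- Fill the arrays `j, j + 1, …` of a relocated program, using register 7 as the counter. -/
def rfills (lim : ℕ) : ℕ → List Ex → Prog
  | _, [] => .skip
  | j, e :: es => .seq (rfill j 7 lim e) (rfills lim (j + 1) es)

/-- The loops change only register `7` and arrays from `20` on, so the hypothesis on the expressions
is stated for all states agreeing with `s₀` elsewhere. A single call is made, hence the trivial
relocation with stride `1` and offset `0`. -/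
lemma Runs.rfills {w m lim : ℕ} (hw : 0 < w) (hm : (m : ℤ) + 1 < 2 ^ w) (hl : ¬ IsTemp lim)
    (hl7 : lim ≠ 7) {s₀ : State} (hs : s₀.reg lim = m) (h40 : s₀.reg 40 = 1) (h41 : s₀.reg 41 = 0)
    {es : List Ex} {vals : List (ℤ → ℤ)}
    (h : List.Forall₂ (fun (e : Ex) (val : ℤ → ℤ) => ∀ st : State,
      (∀ r, r ≠ 7 → st.reg r = s₀.reg r) → (∀ a < 20, st.mem a = s₀.mem a) →
      ∀ k : ℕ, k < m → st.reg 7 = k → e.Ok w st ∧ e.eval st = val k) es vals) :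
    ∀ (j : ℕ) (st : State) (Q : State → ℕ → Prop),
      (∀ r, r ≠ 7 → st.reg r = s₀.reg r) → (∀ a < 20, st.mem a = s₀.mem a) →
      (∀ a, j ≤ a → st.mem (20 + a) = fun _ => 0) →
      (∀ st', (∀ r, r ≠ 7 → st'.reg r = s₀.reg r) → (∀ a < 20 + j, st'.mem a = st.mem a) →
        (∀ a, st'.mem (20 + (j + a)) = (vals.map fun v => tab m v fun _ => 0).getD a fun _ => 0) →
        Q st' ((es.map fun e => (e.cost + 17) * m + 9).sum + 1)) →
      Runs w (rfills lim j es) st Q := by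
  induction h with
  | nil =>
    intro j st Q h1 h2 h3 hQ
    refine Runs.skip (hQ st h1 (fun _ _ => rfl) fun a => ?_)
    rw [h3 _ (by omega)]; simp
  | @cons e v es vals he _ ih =>
    intro j st Q h1 h2 h3 hQ
    refine Runs.seq (Runs.rfill (N := 1) (i := 0) v m hw (by omega) le_rfl one_pos (by omega)
      (by decide) hl hl7 (by omega) (by omega) (by rw [h1 _ hl7, hs]) (by rw [h1 _ (by omega), h40])
      (by rw [h1 _ (by omega), h41]) ?_ ?_)
    · rintro k hk st' rfl
      refine he _ (fun r hr => ?_) (fun a ha => ?_) k hk (by simp)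
      · rw [State.setReg_reg_ne _ _ hr]; exact h1 r hr
      · rw [State.setReg_mem, State.setArr_mem_ne _ _ (by omega), h2 a ha]
    · refine ih (j + 1) _ _ (fun r hr => ?_) (fun a ha => ?_) (fun a ha => ?_) ?_
      · rw [State.setReg_reg_ne _ _ hr]; exact h1 r hr
      · rw [State.setReg_mem, State.setArr_mem_ne _ _ (by omega), h2 a ha]
      · rw [State.setReg_mem, State.setArr_mem_ne _ _ (by omega), h3 a (by omega)]
      · intro st' g1 g2 g3
        have hQ' := hQ st' g1 (fun a ha => ?_) (fun a => ?_)
        · convert hQ' using 1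
          simp; ring
        · rw [g2 a (by omega), State.setReg_mem, State.setArr_mem_ne _ _ (by omega)]
        · rcases a with _ | a
          · rw [g2 _ (by omega), State.setReg_mem]
            simp only [Nat.add_zero, State.setArr_mem_same, List.map_cons, List.getD_cons_zero]
            rw [h3 j le_rfl]
            funext y
            have := rtab_apply (N := 1) (i := 0) le_rfl one_pos m v (fun _ => 0) y
            simpa using this
          · have := g3 a
            rw [show j + 1 + a = j + (a + 1) by omega] at this
            rw [this]; simp

end WordRAM

namespace TriCover

open Ex

/-- The piecewise expression on three blocks of length `reg 2`, with argument `reg 7`. -/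
def selEx (e₀ e₁ e₂ : Ex → Ex) : Ex :=
  cond (lt (var 7) (var 2)) (e₀ (var 7)) (cond (lt (var 7) (var 3)) (e₁ (var 7 - var 2))
    (e₂ (var 7 - var 3)))

/-- The bound on all numbers computed by the reduction. -/
def bnd (s U : ℤ) : ℤ := 40 * (U + 1) * (s * s)

/-- The registers and arrays used by the expressions of the reduction. -/
structure Env (s U : ℤ) (A B C : ℤ → ℤ) (st : State) : Prop where
  r0 : st.reg 0 = s
  r1 : st.reg 1 = U
  r2 : st.reg 2 = s * s
  r3 : st.reg 3 = 2 * (s * s)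
  r4 : st.reg 4 = 3 * (s * s)
  r5 : st.reg 5 = 6 * U + 1
  r6 : st.reg 6 = 4 * (s * s)
  mA : ∀ z, 0 ≤ z → z < s * s → st.mem 0 z = A z
  mB : ∀ z, 0 ≤ z → z < s * s → st.mem 1 z = B z
  mC : ∀ z, 0 ≤ z → z < s * s → st.mem 2 z = C z

/-- The expression `e` computes the function `f` on `0, …, s * s - 1`. -/
def Computes (w : ℕ) (st : State) (s : ℤ) (e : Ex → Ex) (f : ℤ → ℤ) : Prop :=
  ∀ x : Ex, x.Ok w st → 0 ≤ x.eval st → x.eval st < s * s →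
    (e x).Ok w st ∧ (e x).eval st = f (x.eval st)

lemma computes_sel {w : ℕ} (hw : 0 < w) {st : State} {s U Z : ℤ} {A B C : ℤ → ℤ}
    (hE : Env s U A B C st) {e₀ e₁ e₂ : Ex → Ex} {f₀ f₁ f₂ : ℤ → ℤ} (hss : 3 * (s * s) ≤ Z)
    (hZ : Z < 2 ^ w) (h₀ : Computes w st s e₀ f₀) (h₁ : Computes w st s e₁ f₁)
    (h₂ : Computes w st s e₂ f₂) (b₀ : ∀ z, 0 ≤ z → z < s * s → |f₀ z| ≤ Z)
    (b₁ : ∀ z, 0 ≤ z → z < s * s → |f₁ z| ≤ Z) (b₂ : ∀ z, 0 ≤ z → z < s * s → |f₂ z| ≤ Z)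
    {k : ℕ} (hk : (k : ℤ) < 3 * (s * s)) (h7 : st.reg 7 = k) :
    (selEx e₀ e₁ e₂).Ok w st ∧ (selEx e₀ e₁ e₂).eval st = sel (s * s) f₀ f₁ f₂ k := by
  have hk0 : (0 : ℤ) ≤ k := by positivity
  have hone : (1 : ℤ) < 2 ^ w := one_lt_pow₀ (by norm_num) (by omega)
  simp only [selEx, ok_cond, ok_lt _ _ _ _ hw, ok_var, eval_lt, eval_var, h7, hE.r2, hE.r3,
    eval_cond, sel]
  rcases lt_or_ge (k : ℤ) (s * s) with hc | hc
  · obtain ⟨h, h'⟩ := h₀ (var 7) (by simp; decide) (by simp [h7]) (by simp [h7, hc])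
    rw [eval_var, h7] at h'
    have := b₀ k hk0 hc
    simp [hc, h, h', this.trans_lt hZ]
    decide
  · have hc' := not_lt.2 hc
    rcases lt_or_ge (k : ℤ) (2 * (s * s)) with hd | hd
    · have hx : (var 7 - var 2).eval st = k - s * s := by simp [h7, hE.r2]
      obtain ⟨h, h'⟩ := h₁ (var 7 - var 2)
        (by simp [h7, hE.r2, abs_lt]; exact ⟨by decide, by decide, by omega, by omega⟩)
        (by rw [hx]; omega) (by rw [hx]; omega)
      rw [hx] at h'
      have := b₁ (k - s * s) (by omega) (by omega)
      simp [hc', hd, h, h', this.trans_lt hZ]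
      decide
    · have hd' := not_lt.2 hd
      have hx : (var 7 - var 3).eval st = k - 2 * (s * s) := by simp [h7, hE.r3]
      obtain ⟨h, h'⟩ := h₂ (var 7 - var 3)
        (by simp [h7, hE.r3, abs_lt]; exact ⟨by decide, by decide, by omega, by omega⟩)
        (by rw [hx]; omega) (by rw [hx]; omega)
      rw [hx] at h'
      have := b₂ (k - 2 * (s * s)) (by omega) (by omega)
      simp [hc', hd', h, h', this.trans_lt hZ]
      decide

section
variable {w : ℕ} {st : State} {s U : ℤ} {A B C : ℤ → ℤ}

/-- All nonlinear facts about quotients, remainders and products are collected here; once these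
terms are treated as atoms, the range checks below are linear. -/
lemma small_facts (hs : 0 < s) (hU : 0 ≤ U) {z : ℤ} (h0 : 0 ≤ z) (hz : z < s * s) :
    (0 ≤ z / s ∧ z / s < s) ∧ (0 ≤ z % s ∧ z % s < s) ∧ (0 ≤ z % s * s ∧ z % s * s < s * s) ∧
      s ≤ s * s ∧ 20 * (s * s) + 20 * U + 12 * (U * s) ≤ bnd s U ∧ 0 ≤ U * s ∧
      ∀ a b : ℤ, 0 ≤ a → a ≤ s → 0 ≤ b → b ≤ s → 0 ≤ (6 * U + 1) * (a + b) ∧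
        (6 * U + 1) * (a + b) ≤ 12 * (U * s) + 2 * s := by
  have hm := Int.emod_nonneg z hs.ne'
  have hm' := Int.emod_lt_of_pos z hs
  have h1 : s ≤ s * s := by nlinarith
  have h2 : U * s ≤ U * (s * s) := mul_le_mul_of_nonneg_left h1 hU
  have h3 : U * 1 ≤ U * (s * s) := mul_le_mul_of_nonneg_left (by omega) hU
  refine ⟨⟨Int.ediv_nonneg h0 hs.le, Int.ediv_lt_of_lt_mul hs hz⟩, ⟨hm, hm'⟩,
    ⟨by positivity, mul_lt_mul_of_pos_right hm' hs⟩, h1, ?_, by positivity, fun a b ha ha' hb hb' => ?_⟩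
  · have : bnd s U = 40 * (s * s) + 40 * (U * (s * s)) := by unfold bnd; ring
    nlinarith
  · refine ⟨by positivity, ?_⟩
    have : (6 * U + 1) * (a + b) ≤ (6 * U + 1) * (2 * s) :=
      mul_le_mul_of_nonneg_left (by omega) (by omega)
    linarith

/-- The first ten formulas are the coordinates of points and apices; the last four are apex
coordinates shifted by the side of the squares. `computes_coords` lists them in the same order. -/
lemma bound_coords (hs : 0 < s) (hU : 0 ≤ U) {z : ℤ} (h0 : 0 ≤ z) (hz : z < s * s) :
    |z / s| ≤ bnd s U ∧ |-1 - z % s| ≤ bnd s U ∧ |s + z| ≤ bnd s U ∧ |0 - z % s| ≤ bnd s U ∧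
    |s * s + s - z| ≤ bnd s U ∧ |z / s - 1| ≤ bnd s U ∧ |z % s * s + s + s - 1| ≤ bnd s U ∧
    |z % s| ≤ bnd s U ∧ |s * s - z % s * s| ≤ bnd s U ∧ |z / s + 1| ≤ bnd s U ∧
    |z / s - 1 - 4 * (s * s)| ≤ bnd s U ∧ |z % s * s + s + s - 1 - 4 * (s * s)| ≤ bnd s U ∧
    |z % s - 4 * (s * s)| ≤ bnd s U ∧ |s * s - z % s * s - 4 * (s * s)| ≤ bnd s U := by
  obtain ⟨⟨h1, h2⟩, ⟨h3, h4⟩, ⟨h5, h6⟩, h7, h8, h9, -⟩ := small_facts hs hU h0 hz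
  simp only [abs_le]
  generalize z / s = a at *
  generalize z % s * s = bs at *
  generalize z % s = b at *
  refine ⟨?_, ?_, ?_, ?_, ?_, ?_, ?_, ?_, ?_, ?_, ?_, ?_, ?_, ?_⟩ <;> constructor <;> linarith

lemma bound_weights (hs : 0 < s) (hU : 0 ≤ U) (hA : ∀ z, |A z| ≤ U) (hB : ∀ z, |B z| ≤ U)
    (hC : ∀ z, |C z| ≤ U) {z : ℤ} (h0 : 0 ≤ z) (hz : z < s * s) :
    (0 ≤ A z + U + (6 * U + 1) * (z / s + z % s) ∧
      A z + U + (6 * U + 1) * (z / s + z % s) ≤ bnd s U) ∧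
    (0 ≤ B z + U + (6 * U + 1) * ((s - z / s) + (s - z % s)) ∧
      B z + U + (6 * U + 1) * ((s - z / s) + (s - z % s)) ≤ bnd s U) ∧
    (0 ≤ C z + U + (6 * U + 1) * ((s - z / s) + z % s) ∧
      C z + U + (6 * U + 1) * ((s - z / s) + z % s) ≤ bnd s U) := by
  obtain ⟨⟨h1, h2⟩, ⟨h3, h4⟩, -, h7, h8, h9, h⟩ := small_facts hs hU h0 hz
  have a1 := abs_le.1 (hA z)
  have a2 := abs_le.1 (hB z)
  have a3 := abs_le.1 (hC z)
  have g1 := h _ _ h1 h2.le h3 h4.le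
  have g2 := h _ _ (show 0 ≤ s - z / s by omega) (by omega) (show 0 ≤ s - z % s by omega) (by omega)
  have g3 := h _ _ (show 0 ≤ s - z / s by omega) (by omega) h3 h4.le
  refine ⟨⟨?_, ?_⟩, ⟨?_, ?_⟩, ⟨?_, ?_⟩⟩ <;> linarith

lemma computes_coords (hE : Env s U A B C st) (hs : 0 < s) (hU : 0 ≤ U) (hZ : bnd s U < 2 ^ w) :
    Computes w st s (fun x => x / var 0) (fun z => z / s) ∧
    Computes w st s (fun x => lit (-1) - x % var 0) (fun z => -1 - z % s) ∧
    Computes w st s (fun x => var 0 + x) (fun z => s + z) ∧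
    Computes w st s (fun x => lit 0 - x % var 0) (fun z => 0 - z % s) ∧
    Computes w st s (fun x => var 2 + var 0 - x) (fun z => s * s + s - z) ∧
    Computes w st s (fun x => x / var 0 - lit 1) (fun z => z / s - 1) ∧
    Computes w st s (fun x => x % var 0 * var 0 + var 0 + var 0 - lit 1)
      (fun z => z % s * s + s + s - 1) ∧
    Computes w st s (fun x => x % var 0) (fun z => z % s) ∧
    Computes w st s (fun x => var 2 - x % var 0 * var 0) (fun z => s * s - z % s * s) ∧
    Computes w st s (fun x => x / var 0 + lit 1) (fun z => z / s + 1) ∧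
    Computes w st s (fun x => x / var 0 - lit 1 - var 6) (fun z => z / s - 1 - 4 * (s * s)) ∧
    Computes w st s (fun x => x % var 0 * var 0 + var 0 + var 0 - lit 1 - var 6)
      (fun z => z % s * s + s + s - 1 - 4 * (s * s)) ∧
    Computes w st s (fun x => x % var 0 - var 6) (fun z => z % s - 4 * (s * s)) ∧
    Computes w st s (fun x => var 2 - x % var 0 * var 0 - var 6)
      (fun z => s * s - z % s * s - 4 * (s * s)) := by
  refine ⟨?_, ?_, ?_, ?_, ?_, ?_, ?_, ?_, ?_, ?_, ?_, ?_, ?_, ?_⟩ <;>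
  · intro x hx h0 hz
    obtain ⟨⟨h1, h2⟩, ⟨h3, h4⟩, ⟨h5, h6⟩, h7, h8, h9, -⟩ := small_facts hs hU h0 hz
    have t0 : ¬ IsTemp 0 := by decide
    have t2 : ¬ IsTemp 2 := by decide
    have t6 : ¬ IsTemp 6 := by decide
    simp only [ok_add, ok_sub, ok_mul, ok_div, ok_mod, ok_var, ok_lit, eval_add, eval_sub,
      eval_mul, eval_div, eval_mod, eval_var, eval_lit, hE.r0, hE.r2, hE.r6, hx, abs_lt, t0, t2,
      t6, true_and, not_false_eq_true, and_true]
    try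
      generalize x.eval st / s = a at *
      generalize x.eval st % s * s = bs at *
      generalize x.eval st % s = b at *
      constructorm* _ ∧ _ <;> linarith

lemma computes_const (hw : 0 < w) :
    Computes w st s (fun _ => lit 0) (fun _ => 0) ∧ Computes w st s (fun _ => lit 1) (fun _ => 1) := by
  have hone : (1 : ℤ) < 2 ^ w := one_lt_pow₀ (by norm_num) (by omega)
  exact ⟨fun x _ _ _ => ⟨by simp, rfl⟩, fun x _ _ _ => ⟨by simpa using hone, rfl⟩⟩

lemma computes_weights (hE : Env s U A B C st) (hs : 0 < s) (hU : 0 ≤ U) (hA : ∀ z, |A z| ≤ U)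
    (hB : ∀ z, |B z| ≤ U) (hC : ∀ z, |C z| ≤ U) (hZ : bnd s U < 2 ^ w) :
    Computes w st s (fun x => get 0 x + var 1 + var 5 * (x / var 0 + x % var 0))
      (fun z => A z + U + (6 * U + 1) * (z / s + z % s)) ∧
    Computes w st s (fun x => get 1 x + var 1 + var 5 * ((var 0 - x / var 0) + (var 0 - x % var 0)))
      (fun z => B z + U + (6 * U + 1) * ((s - z / s) + (s - z % s))) ∧
    Computes w st s (fun x => get 2 x + var 1 + var 5 * ((var 0 - x / var 0) + x % var 0))
      (fun z => C z + U + (6 * U + 1) * ((s - z / s) + z % s)) := by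
  refine ⟨?_, ?_, ?_⟩ <;>
  · intro x hx h0 hz
    obtain ⟨b1, b2, b3⟩ := bound_weights hs hU hA hB hC h0 hz
    obtain ⟨⟨h1, h2⟩, ⟨h3, h4⟩, -, h7, h8, h9, h⟩ := small_facts hs hU h0 hz
    have a1 := abs_le.1 (hA (x.eval st))
    have a2 := abs_le.1 (hB (x.eval st))
    have a3 := abs_le.1 (hC (x.eval st))
    have g1 := h _ _ h1 h2.le h3 h4.le
    have g2 := h _ _ (show 0 ≤ s - x.eval st / s by omega) (by omega)
      (show 0 ≤ s - x.eval st % s by omega) (by omega)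
    have g3 := h _ _ (show 0 ≤ s - x.eval st / s by omega) (by omega) h3 h4.le
    have t0 : ¬ IsTemp 0 := by decide
    have t1 : ¬ IsTemp 1 := by decide
    have t5 : ¬ IsTemp 5 := by decide
    simp only [ok_add, ok_sub, ok_mul, ok_div, ok_mod, ok_var, ok_get, eval_add, eval_sub,
      eval_mul, eval_div, eval_mod, eval_var, eval_get, hE.r0, hE.r1, hE.r5,
      hE.mA _ h0 hz, hE.mB _ h0 hz, hE.mC _ h0 hz, hx, abs_lt, t0, t1, t5, true_and,
      not_false_eq_true, and_true]
    clear h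
    constructorm* _ ∧ _ <;> linarith

end
end TriCover

/-! ### Word lengths, and assignment and storage of known values -/

namespace WordRAM

/-- A word length that suffices for numbers polynomial in `n`. -/
lemma two_pow_wordLength (k n : ℕ) :
    (2 : ℤ) ^ (k * (Nat.log 2 n + 1)) = (2 ^ (Nat.log 2 n + 1)) ^ k := by
  rw [← pow_mul, mul_comm]

lemma lt_two_pow_log (n : ℕ) : (n : ℤ) < 2 ^ (Nat.log 2 n + 1) := by
  exact_mod_cast Nat.lt_pow_succ_log_self (by norm_num) n

lemma two_pow_log_le {n : ℕ} (hn : 0 < n) : (2 : ℤ) ^ (Nat.log 2 n + 1) ≤ 2 * n := by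
  have := Nat.pow_log_le_self 2 hn.ne'
  rw [pow_succ]
  have : (2 : ℤ) ^ Nat.log 2 n ≤ n := by exact_mod_cast this
  linarith

lemma wordLength_le_of_pow_le {w w' : ℕ} (h : (2 : ℤ) ^ w ≤ 2 ^ w') : w ≤ w' :=
  (pow_le_pow_iff_right₀ (by norm_num : (1 : ℤ) < 2)).1 h

lemma Runs.set {w : ℕ} {s : State} {d : ℕ} {e : Ex} {Q : State → ℕ → Prop} (v : ℤ)
    (h : e.Ok w s ∧ e.eval s = v) (hr : |v| < 2 ^ w) (hQ : Q (s.setReg d v) (e.cost + 2)) :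
    Runs w (WordRAM.assign d e) s Q := by
  obtain ⟨h, rfl⟩ := h
  exact Runs.assign h hr hQ

lemma Runs.put {w : ℕ} {s : State} {arr : ℕ} {a b : Ex} {Q : State → ℕ → Prop} (z v : ℤ)
    (ha : a.Ok w s ∧ a.eval s = z) (hb : b.Ok w s ∧ b.eval s = v)
    (hQ : Q (s.setMem arr z v) (a.cost + b.cost + 1)) :
    Runs w (WordRAM.write arr a b) s Q := by
  obtain ⟨ha, rfl⟩ := ha
  obtain ⟨hb, rfl⟩ := hb
  exact Runs.write ha hb hQ

end WordRAM

/-! ### Writing down, solving and decoding a covering instance -/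

namespace TriCover

open Ex

def setup : Prog :=
  .seq (assign 2 (var 0 * var 0)) <| .seq (assign 3 (lit 2 * var 2)) <|
  .seq (assign 4 (lit 3 * var 2)) <| .seq (assign 5 (lit 6 * var 1 + lit 1)) <|
  .seq (assign 6 (lit 4 * var 2)) (assign 40 (lit 1))

/-- Decode the triangle from the answer in array `o` of the relocated program. -/
def decode (o : ℕ) : Prog :=
  .seq (assign 8 (get (20 + o) (lit 1))) <| .seq (assign 9 (get (20 + o) (lit 2))) <|
  .seq (assign 10 (get (20 + o) (lit 3))) <|
  .seq (write 3 (lit 0) (cond (lt (var 8) (var 2)) (var 8 / var 0)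
    (cond (lt (var 9) (var 2)) (var 9 / var 0) (var 10 / var 0)))) <|
  .seq (write 3 (lit 1) (cond (lt (var 8) (var 2)) (var 8 % var 0)
    (cond (lt (var 9) (var 2)) (var 9 % var 0) (var 10 % var 0))))
  (write 3 (lit 2) (cond (lt (var 8) (var 2)) (var 9 % var 0) (var 8 % var 0)))

/-- Solve a triangle instance with a relocated program for a covering problem. -/
def solver (p : Prog) (o : ℕ) (d : Ex) (es : List Ex) : Prog :=
  .seq setup <| .seq (rfills 4 0 es) <| .seq (assign (breg 0) (var 4)) <|
    .seq (assign (breg 1) d) <| .seq (reloc p) (decode o)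

lemma setup_runs {w : ℕ} {s U : ℤ} {A B C : ℤ → ℤ} (hs : 0 < s) (hU : 0 ≤ U)
    (hZ : bnd s U < 2 ^ w) {st : State} (h0 : st.reg 0 = s) (h1 : st.reg 1 = U)
    (mA : ∀ z, 0 ≤ z → z < s * s → st.mem 0 z = A z)
    (mB : ∀ z, 0 ≤ z → z < s * s → st.mem 1 z = B z)
    (mC : ∀ z, 0 ≤ z → z < s * s → st.mem 2 z = C z) {Q : State → ℕ → Prop}
    (hQ : ∀ st' T, Env s U A B C st' → st'.reg 40 = 1 →
      (∀ r, 7 ≤ r → r ≠ 40 → st'.reg r = st.reg r) → st'.mem = st.mem → T ≤ 50 → Q st' T) :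
    Runs w setup st Q := by
  obtain ⟨-, -, -, h7, h8, h9, -⟩ := small_facts hs hU le_rfl (by positivity : 0 < s * s)
  have hss : 0 < s * s := by positivity
  have t0 : ¬ IsTemp 0 := by decide
  have t1 : ¬ IsTemp 1 := by decide
  have t2 : ¬ IsTemp 2 := by decide
  have k : ∀ x : ℤ, 0 ≤ x → x ≤ bnd s U → |x| < 2 ^ w := fun x hx hx' => by
    rw [abs_of_nonneg hx]; omega
  have k2 := k _ hss.le (by linarith)
  have k3 := k (2 * (s * s)) (by linarith) (by linarith)
  have k4 := k (3 * (s * s)) (by linarith) (by linarith)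
  have k5 := k (6 * U + 1) (by linarith) (by linarith)
  have k5' := k (6 * U) (by linarith) (by linarith)
  have k6 := k (4 * (s * s)) (by linarith) (by linarith)
  have l : ∀ x : ℤ, 0 ≤ x → x ≤ 6 → |x| < 2 ^ w := fun x hx hx' => k x hx (by linarith)
  unfold setup
  refine Runs.seq (Runs.set (s * s) ?_ k2 ?_)
  · simpa [h0, t0] using k2
  refine Runs.seq (Runs.set (2 * (s * s)) ?_ k3 ?_)
  · simpa [t2] using And.intro (l 2 (by norm_num) (by norm_num)) k3
  refine Runs.seq (Runs.set (3 * (s * s)) ?_ k4 ?_)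
  · simpa [State.setReg_reg, t2] using And.intro (l 3 (by norm_num) (by norm_num)) k4
  refine Runs.seq (Runs.set (6 * U + 1) ?_ k5 ?_)
  · have l6 := l 6 (by norm_num) (by norm_num)
    have l1 := l 1 (by norm_num) (by norm_num)
    simp only [ok_add, ok_mul, ok_lit, ok_var, eval_add, eval_mul, eval_lit, eval_var,
      State.setReg_reg, h1]
    exact ⟨⟨⟨l6, t1, k5'⟩, l1, k5⟩, rfl⟩
  refine Runs.seq (Runs.set (4 * (s * s)) ?_ k6 ?_)
  · simpa [State.setReg_reg, t2] using And.intro (l 4 (by norm_num) (by norm_num)) k6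
  refine Runs.set 1 ⟨by simpa using l 1, rfl⟩ (l 1 (by norm_num) (by norm_num)) ?_
  refine hQ _ _ ⟨?_, ?_, ?_, ?_, ?_, ?_, ?_, mA, mB, mC⟩ ?_ ?_ rfl (by simp)
  all_goals try simp [State.setReg_reg, h0, h1]
  intro r hr hr'
  simp [hr', show r ≠ 2 by omega, show r ≠ 3 by omega, show r ≠ 4 by omega,
    show r ≠ 5 by omega, show r ≠ 6 by omega]

lemma abs_div_mod_lt {s e Z : ℤ} (hs : 0 < s) (h0 : 0 ≤ e) (h : e < Z) :
    |e / s| < Z ∧ |e % s| < Z := by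
  have h1 := Int.ediv_nonneg h0 hs.le
  have h2 := Int.ediv_le_self s h0
  have h3 := Int.emod_nonneg e hs.ne'
  have h4 : e % s ≤ e := by
    have := Int.mul_ediv_add_emod e s
    nlinarith [mul_nonneg hs.le h1]
  rw [abs_of_nonneg h1, abs_of_nonneg h3]
  constructor <;> linarith

lemma decode_runs {w : ℕ} (hw : 0 < w) {s e₁ e₂ e₃ : ℤ} {o : ℕ} (hs : 0 < s)
    (hZ : 3 * (s * s) < 2 ^ w)
    {st : State} (h0 : st.reg 0 = s) (h2 : st.reg 2 = s * s) (he₁ : st.mem (20 + o) 1 = e₁)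
    (he₂ : st.mem (20 + o) 2 = e₂) (he₃ : st.mem (20 + o) 3 = e₃)
    (b₁ : 0 ≤ e₁ ∧ e₁ < 3 * (s * s)) (b₂ : 0 ≤ e₂ ∧ e₂ < 3 * (s * s))
    (b₃ : 0 ≤ e₃ ∧ e₃ < 3 * (s * s)) {Q : State → ℕ → Prop}
    (hQ : ∀ st' T, st'.mem 3 0 = decA s e₁ e₂ e₃ → st'.mem 3 1 = decB s e₁ e₂ e₃ →
      st'.mem 3 2 = decC s e₁ e₂ → T ≤ 100 → Q st' T) :
    Runs w (decode o) st Q := by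
  have hss : 0 < s * s := by positivity
  have f₁ := abs_div_mod_lt hs b₁.1 (b₁.2.trans hZ)
  have f₂ := abs_div_mod_lt hs b₂.1 (b₂.2.trans hZ)
  have f₃ := abs_div_mod_lt hs b₃.1 (b₃.2.trans hZ)
  have g₁ : |e₁| < 2 ^ w := by rw [abs_of_nonneg b₁.1]; omega
  have g₂ : |e₂| < 2 ^ w := by rw [abs_of_nonneg b₂.1]; omega
  have g₃ : |e₃| < 2 ^ w := by rw [abs_of_nonneg b₃.1]; omega
  have k1 : |(1 : ℤ)| < 2 ^ w := by rw [abs_lt]; constructor <;> omega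
  have k2 : |(2 : ℤ)| < 2 ^ w := by rw [abs_lt]; constructor <;> omega
  have k3 : |(3 : ℤ)| < 2 ^ w := by rw [abs_lt]; constructor <;> omega
  have t0 : ¬ IsTemp 0 := by decide
  have t2 : ¬ IsTemp 2 := by decide
  have t8 : ¬ IsTemp 8 := by decide
  have t9 : ¬ IsTemp 9 := by decide
  have t10 : ¬ IsTemp 10 := by decide
  unfold decode
  refine Runs.seq (Runs.set e₁ (by simpa [he₁] using k1) g₁ ?_)
  refine Runs.seq (Runs.set e₂ (by simpa [he₂] using k2) g₂ ?_)
  refine Runs.seq (Runs.set e₃ (by simpa [he₃] using k3) g₃ ?_)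
  refine Runs.seq (Runs.put 0 (decA s e₁ e₂ e₃) (by simp) ?_ ?_)
  · simp [ok_lt, hw, State.setReg_reg, h0, h2, f₁, f₂, f₃, t0, t2, t8, t9, t10, decA]
    split_ifs <;> simp_all <;> linarith
  refine Runs.seq (Runs.put 1 (decB s e₁ e₂ e₃) (by simpa using k1) ?_ ?_)
  · simp [ok_lt, hw, State.setReg_reg, h0, h2, f₁, f₂, f₃, t0, t2, t8, t9, t10, decB]
    split_ifs <;> simp_all <;> linarith
  refine Runs.put 2 (decC s e₁ e₂) (by simpa using k2) ?_ ?_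
  · simp [ok_lt, hw, State.setReg_reg, h0, h2, f₁, f₂, t0, t2, t8, t9, decC]
    split_ifs <;> simp_all
    linarith
  exact hQ _ _ (by simp [State.setMem_mem]) (by simp [State.setMem_mem])
    (by simp [State.setMem_mem]) (by simp)

lemma sum_cost_le (es : List Ex) {m : ℕ} (hm : 0 < m) :
    (es.map fun e => (e.cost + 17) * m + 9).sum ≤ (es.map fun e => e.cost + 26).sum * m := by
  induction es with
  | nil => simp
  | cons e es ih =>
    simp only [List.map_cons, List.sum_cons]
    nlinarith

/-- The solver is correct if the covering instance is. -/
lemma solver_runs {c w₀ w : ℕ} (x : TriInstance c) {p : Prog} {o : ℕ} {d : Ex} {es : List Ex}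
    {vals : List (ℤ → ℤ)} {dv b : ℤ} {s₀ s₁ : State} {t : ℕ} (h : Exec w₀ p s₀ s₁ t)
    (hww : w₀ ≤ w) (hb : s₀.Bounded b) (hbw : 2 ^ w₀ ≤ b) (hbw' : b + 1 < 2 ^ w)
    (hZ : bnd x.s x.U < 2 ^ w) (r0 : s₀.reg 0 = 3 * (x.s * x.s)) (r1 : s₀.reg 1 = dv)
    (hr : ∀ r, 2 ≤ r → s₀.reg r = 0)
    (hm : ∀ a, s₀.mem a = (vals.map fun v => tab (3 * (x.s * x.s)) v fun _ => 0).getD a fun _ => 0)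
    (hd : ∀ st, Env x.s x.U x.A x.B x.C st → d.Ok w st ∧ d.eval st = dv ∧ |dv| < 2 ^ w)
    (hes : ∀ st, Env x.s x.U x.A x.B x.C st →
      List.Forall₂ (fun (e : Ex) (val : ℤ → ℤ) => ∀ k : ℕ, (k : ℤ) < 3 * (x.s * x.s) →
        st.reg 7 = k → e.Ok w st ∧ e.eval st = val k) es vals)
    (hout : (0 ≤ s₁.mem o 1 ∧ s₁.mem o 1 < 3 * (x.s * x.s)) ∧
      (0 ≤ s₁.mem o 2 ∧ s₁.mem o 2 < 3 * (x.s * x.s)) ∧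
      (0 ≤ s₁.mem o 3 ∧ s₁.mem o 3 < 3 * (x.s * x.s)) ∧
      ∃ a b c : ℕ, decA x.s (s₁.mem o 1) (s₁.mem o 2) (s₁.mem o 3) = a ∧
        decB x.s (s₁.mem o 1) (s₁.mem o 2) (s₁.mem o 3) = b ∧
        decC x.s (s₁.mem o 1) (s₁.mem o 2) = c ∧ IsMinTri x.s x.A x.B x.C a b c) :
    Runs w (solver p o d es) ((MinTri c).input x) (fun st' T => (MinTri c).correct x st' ∧
      T ≤ 200 + d.cost + (es.map fun e => e.cost + 26).sum * (3 * (x.s * x.s)) + 3 * t) := by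
  have hs : (0 : ℤ) < x.s := by exact_mod_cast x.s_pos
  have hU : (0 : ℤ) ≤ x.U := by positivity
  obtain ⟨-, -, -, h7, h8, h9, -⟩ := small_facts hs hU le_rfl (by positivity : (0 : ℤ) < x.s * x.s)
  have hss : (0 : ℤ) < x.s * x.s := by positivity
  have hss' : 0 < x.s * x.s := by have := x.s_pos; positivity
  have hw : 0 < w := by
    rcases Nat.eq_zero_or_pos w with rfl | h
    · have : (0 : ℤ) < 2 ^ w₀ := by positivity
      omega
    · exact h
  have ht : ∀ f : ℤ → ℤ, ∀ z : ℤ, 0 ≤ z → z < x.s * x.s →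
      tab (x.s * x.s) f (fun _ => 0) z = f z := fun f z h h' =>
    tab_of_lt h (by exact_mod_cast h')
  unfold solver
  refine Runs.seq (setup_runs hs hU hZ (A := x.A) (B := x.B) (C := x.C) rfl rfl
    (ht x.A) (ht x.B) (ht x.C) ?_)
  intro st1 T1 hE h40 hreg hmem hT1
  have h41 : st1.reg 41 = 0 := by rw [hreg 41 (by omega) (by omega)]; rfl
  have hm0 : ∀ a, st1.mem (20 + a) = fun _ => 0 := fun a => by
    rw [hmem]; exact List.getD_eq_default _ _ (by simp; omega)
  have hbr : ∀ r, st1.reg (breg r) = 0 := fun r => by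
    rw [hreg _ (by unfold breg; omega) (by unfold breg; omega)]
    exact List.getD_eq_default _ _ (by simp [breg]; omega)
  have envOf : ∀ st : State, (∀ r, r ≠ 7 → st.reg r = st1.reg r) →
      (∀ a < 20, st.mem a = st1.mem a) → Env x.s x.U x.A x.B x.C st := fun st e1 e2 =>
    ⟨by rw [e1 _ (by omega), hE.r0], by rw [e1 _ (by omega), hE.r1], by rw [e1 _ (by omega), hE.r2],
      by rw [e1 _ (by omega), hE.r3], by rw [e1 _ (by omega), hE.r4], by rw [e1 _ (by omega), hE.r5],
      by rw [e1 _ (by omega), hE.r6], by rw [e2 0 (by omega)]; exact hE.mA,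
      by rw [e2 1 (by omega)]; exact hE.mB, by rw [e2 2 (by omega)]; exact hE.mC⟩
  refine Runs.seq (Runs.rfills (m := 3 * (x.s * x.s)) hw (by push_cast; linarith) (by decide)
    (by omega) (s₀ := st1) (by rw [hE.r4]; push_cast; ring) h40 h41 (vals := vals) ?_ 0 st1 _
    (fun _ _ => rfl) (fun _ _ => rfl) (fun a _ => hm0 a) ?_)
  · have : ∀ st : State, (∀ r, r ≠ 7 → st.reg r = st1.reg r) →
      (∀ a < 20, st.mem a = st1.mem a) → _ := fun st e1 e2 => hes st (envOf st e1 e2)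
    rw [List.forall₂_iff_get]
    have hl := (hes st1 (envOf st1 (fun _ _ => rfl) (fun _ _ => rfl))).length_eq
    refine ⟨hl, fun i h1 h2 st e1 e2 k hk hk7 => ?_⟩
    exact (List.forall₂_iff_get.1 (this st e1 e2)).2 i h1 h2 k (by exact_mod_cast hk) hk7
  intro st2 g1 g2 g3
  have hE2 := envOf st2 g1 (fun a ha => g2 a (by omega))
  obtain ⟨d1, d2, d3⟩ := hd st2 hE2
  refine Runs.seq (Runs.set (3 * (x.s * x.s)) ⟨by simp; decide, by simpa using hE2.r4⟩
    (by rw [abs_of_nonneg] <;> linarith) ?_)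
  have hE3 : Env x.s x.U x.A x.B x.C (st2.setReg (breg 0) (3 * (x.s * x.s))) :=
    ⟨hE2.r0, hE2.r1, hE2.r2, hE2.r3, hE2.r4, hE2.r5, hE2.r6, hE2.mA, hE2.mB, hE2.mC⟩
  obtain ⟨d1, d2, d3⟩ := hd _ hE3
  refine Runs.seq (Runs.set dv ⟨d1, d2⟩ d3 ?_)
  -- With stride `1` and offset `0`, cell `z` of a relocated array is cell `z`; no room for further
  -- calls is needed.
  refine Runs.seq (Runs.reloc (N := 1) (i := 0) (b := b) hww le_rfl one_pos hbw (by linarith) h hb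
    ⟨fun r => ?_, fun a z => ?_, ?_, ?_⟩ ?_)
  · rcases r with _ | _ | r
    · rw [State.setReg_reg_ne _ _ (by unfold breg; omega), State.setReg_reg_same, r0]
    · rw [State.setReg_reg_same, r1]
    · rw [State.setReg_reg_ne _ _ (by unfold breg; omega),
        State.setReg_reg_ne _ _ (by unfold breg; omega), g1 _ (by unfold breg; omega), hbr,
        hr _ (by omega)]
  · have := g3 a
    rw [Nat.zero_add] at this
    rw [State.setReg_mem, State.setReg_mem, this, hm, mul_one, add_zero]
  · rw [State.setReg_reg_ne _ _ (by unfold breg; omega),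
        State.setReg_reg_ne _ _ (by unfold breg; omega), g1 _ (by omega), h40]
  · rw [State.setReg_reg_ne _ _ (by unfold breg; omega),
        State.setReg_reg_ne _ _ (by unfold breg; omega), g1 _ (by omega), h41]
  intro st4 hH hK
  obtain ⟨o1, o2, o3, va, vb, vc, q1, q2, q3, hmin⟩ := hout
  have rd : ∀ z, st4.mem (20 + o) z = s₁.mem o z := fun z => by
    have := hH.mem o z
    rwa [mul_one, add_zero] at this
  refine decode_runs hw hs (by linarith) ?_ ?_ (rd 1) (rd 2) (rd 3) o1 o2 o3 ?_
  · rw [hK.reg 0 (by omega)]; exact hE3.r0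
  · rw [hK.reg 2 (by omega)]; exact hE3.r2
  intro st5 T5 m1 m2 m3 hT5
  refine ⟨⟨va, vb, vc, by rw [m1, q1], by rw [m2, q2], by rw [m3, q3], hmin⟩, ?_⟩
  have := sum_cost_le es (m := 3 * (x.s * x.s)) (by omega)
  simp only [cost_var]
  omega

/-- For `n = 3 * s * s` the power `n ^ (3/2 - δ)` is a constant, at most `9`, times `s ^ (3 - 2δ)`.
The factor `27` contains another `3` for the slowdown of relocated programs. Thanks to `δ ≤ 1/2`,
the quadratic cost of writing the instance is absorbed as well. -/
lemma time_bound {s t T C K D : ℕ} (hs : 0 < s) {δ : ℝ} (hδ : 0 < δ) (hδ' : δ ≤ 1 / 2)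
    (htime : (t : ℝ) ≤ C * ((3 * (s * s) : ℕ) : ℝ) ^ ((3 : ℝ) / 2 - δ))
    (hT : T ≤ 200 + D + K * (3 * (s * s)) + 3 * t) :
    (T : ℝ) ≤ (200 + D + 3 * K + 27 * C : ℕ) * (s : ℝ) ^ (3 - 2 * δ) := by
  have hsR : (1 : ℝ) ≤ s := by exact_mod_cast hs
  set Y : ℝ := (s : ℝ) ^ (3 - 2 * δ) with hY
  have hYs : (s : ℝ) * s ≤ Y := by
    have h1 : (s : ℝ) ^ (2 : ℝ) ≤ Y := Real.rpow_le_rpow_of_exponent_le hsR (by linarith)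
    rwa [Real.rpow_two, sq] at h1
  have hY1 : 1 ≤ Y := Real.one_le_rpow hsR (by linarith)
  have ht : (t : ℝ) ≤ C * (9 * Y) := by
    refine htime.trans (mul_le_mul_of_nonneg_left ?_ (by positivity))
    have h1 : ((3 * (s * s) : ℕ) : ℝ) ^ ((3 : ℝ) / 2 - δ) =
        (3 : ℝ) ^ ((3 : ℝ) / 2 - δ) * Y := by
      push_cast
      rw [Real.mul_rpow (by norm_num) (by positivity), hY,
        show (s : ℝ) * s = (s : ℝ) ^ (2 : ℝ) by rw [Real.rpow_two]; ring,
        ← Real.rpow_mul (by positivity)]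
      congr 2
      ring
    rw [h1]
    refine mul_le_mul_of_nonneg_right ?_ (by positivity)
    calc (3 : ℝ) ^ ((3 : ℝ) / 2 - δ) ≤ (3 : ℝ) ^ (2 : ℝ) :=
          Real.rpow_le_rpow_of_exponent_le (by norm_num) (by linarith)
      _ = 9 := by rw [Real.rpow_two]; norm_num
  have hTR : (T : ℝ) ≤ 200 + D + K * (3 * ((s : ℝ) * s)) + 3 * t := by
    exact_mod_cast hT
  push_cast
  have hK0 : (0 : ℝ) ≤ K := by positivity
  have hd0 : (0 : ℝ) ≤ D := by positivity
  have e1 : (K : ℝ) * (3 * ((s : ℝ) * s)) ≤ K * (3 * Y) :=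
    mul_le_mul_of_nonneg_left (by linarith) hK0
  have e2 : (200 + (D : ℝ)) * 1 ≤ (200 + D) * Y :=
    mul_le_mul_of_nonneg_left hY1 (by linarith)
  linarith

/-- Reduction from minimum-weight triangle to a covering problem. -/
theorem minTri_solvable {c κ : ℕ} {P : Problem} (inst : TriInstance c → P.Inst) (o : ℕ) (d : Ex)
    (es : List Ex) (vals : TriInstance c → List (ℤ → ℤ)) (dv : TriInstance c → ℤ)
    (hsize : ∀ x, P.size (inst x) = 3 * (x.s * x.s))
    (hr0 : ∀ x, (P.input (inst x)).reg 0 = 3 * (x.s * x.s))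
    (hr1 : ∀ x, (P.input (inst x)).reg 1 = dv x)
    (hr : ∀ x r, 2 ≤ r → (P.input (inst x)).reg r = 0)
    (hm : ∀ x a, (P.input (inst x)).mem a =
      ((vals x).map fun v => tab (3 * (x.s * x.s)) v fun _ => 0).getD a fun _ => 0)
    (hbd : ∀ x, (P.input (inst x)).Bounded ((3 * (x.s * x.s) : ℕ) ^ κ))
    (hd : ∀ x w st, 0 < w → bnd x.s x.U < 2 ^ w → Env x.s x.U x.A x.B x.C st →
      d.Ok w st ∧ d.eval st = dv x ∧ |dv x| < 2 ^ w)
    (hes : ∀ x w st, 0 < w → bnd x.s x.U < 2 ^ w → Env x.s x.U x.A x.B x.C st →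
      List.Forall₂ (fun (e : Ex) (val : ℤ → ℤ) => ∀ k : ℕ, (k : ℤ) < 3 * (x.s * x.s) →
        st.reg 7 = k → e.Ok w st ∧ e.eval st = val k) es (vals x))
    (hout : ∀ x s₁, P.correct (inst x) s₁ →
      (0 ≤ s₁.mem o 1 ∧ s₁.mem o 1 < 3 * (x.s * x.s)) ∧
      (0 ≤ s₁.mem o 2 ∧ s₁.mem o 2 < 3 * (x.s * x.s)) ∧
      (0 ≤ s₁.mem o 3 ∧ s₁.mem o 3 < 3 * (x.s * x.s)) ∧
      ∃ a b c : ℕ, decA x.s (s₁.mem o 1) (s₁.mem o 2) (s₁.mem o 3) = a ∧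
        decB x.s (s₁.mem o 1) (s₁.mem o 2) (s₁.mem o 3) = b ∧
        decC x.s (s₁.mem o 1) (s₁.mem o 2) = c ∧ IsMinTri x.s x.A x.B x.C a b c)
    {δ : ℝ} (hδ : 0 < δ) (hδ' : δ ≤ 1 / 2)
    (hP : P.SolvableInTime fun n => (n : ℝ) ^ ((3 : ℝ) / 2 - δ)) :
    (MinTri c).SolvableInTime fun n => (n : ℝ) ^ (3 - 2 * δ) := by
  obtain ⟨p, k, C, hp⟩ := hP
  set K := (es.map fun e => e.cost + 26).sum with hK
  -- Let `ν > s` be the power of two belonging to word-length factor one. The inner words need `ν ^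
  -- (5 * k)` because `2 * n ≤ ν ^ 5`, the input cells `ν ^ (4 * κ)` because `n ≤ ν ^ 4`, and the
  -- numbers of the reduction `ν ^ (c + 9)`; the sum of these exponents, with room to spare, serves
  -- for all.
  refine ⟨solver p o d es, 5 * k + 4 * κ + c + 20, 200 + d.cost + 3 * K + 27 * C, ?_⟩
  intro (x : TriInstance c)
  obtain ⟨s₁, t, hexec, htime, hcor⟩ := hp (inst x)
  rw [hsize] at hexec htime
  have hs1 : 0 < x.s := x.s_pos
  have hsz : (1 : ℤ) ≤ x.s := by exact_mod_cast hs1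
  change ∃ (s : State) (t : ℕ), Exec ((5 * k + 4 * κ + c + 20) * (Nat.log 2 x.s + 1)) _ _ _ _ ∧
    (t : ℝ) ≤ _ * (x.s : ℝ) ^ _ ∧ _
  set ν : ℤ := 2 ^ (Nat.log 2 x.s + 1) with hν
  have hsν : (x.s : ℤ) + 1 ≤ ν := lt_two_pow_log x.s
  have hν2 : 2 ≤ ν := by omega
  have hν1 : 1 ≤ ν := by omega
  have hpow : ∀ i j : ℕ, i ≤ j → ν ^ i ≤ ν ^ j := fun i j h => pow_le_pow_right₀ hν1 h
  have h2pow : ∀ i : ℕ, (2 : ℤ) ^ i ≤ ν ^ i := fun i => pow_le_pow_left₀ (by norm_num) hν2 i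
  have hss : (x.s : ℤ) * x.s ≤ ν ^ 2 := by nlinarith
  have h3ss : (3 * ((x.s : ℤ) * x.s)) ≤ ν ^ 4 := by
    have := h2pow 2
    have h : ν ^ 4 = ν ^ 2 * ν ^ 2 := by ring
    rw [h]
    nlinarith
  have hw : (2 : ℤ) ^ ((5 * k + 4 * κ + c + 20) * (Nat.log 2 x.s + 1)) =
      ν ^ (5 * k + 4 * κ + c + 20) := two_pow_wordLength _ _
  set w := (5 * k + 4 * κ + c + 20) * (Nat.log 2 x.s + 1) with hwdef
  have hwpos : 0 < w := by positivity
  have hw₀ : (2 : ℤ) ^ (k * (Nat.log 2 (3 * (x.s * x.s)) + 1)) ≤ ν ^ (5 * k) := by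
    rw [two_pow_wordLength, pow_mul]
    refine pow_le_pow_left₀ (by positivity) ?_ k
    have h1 := two_pow_log_le (n := 3 * (x.s * x.s)) (by positivity)
    push_cast at h1
    calc (2 : ℤ) ^ (Nat.log 2 (3 * (x.s * x.s)) + 1) ≤ 2 * (3 * ((x.s : ℤ) * x.s)) := h1
      _ ≤ ν * ν ^ 4 := mul_le_mul hν2 h3ss (by positivity) (by omega)
      _ = ν ^ 5 := by ring
  have hU : (x.U : ℤ) ≤ ν ^ c := by
    have : (x.U : ℤ) ≤ ((x.s : ℤ) + 1) ^ c := by exact_mod_cast x.U_le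
    exact this.trans (pow_le_pow_left₀ (by positivity) hsν c)
  have hZ : bnd x.s x.U < 2 ^ w := by
    rw [hw]
    have h1 : (1 : ℤ) ≤ ν ^ c := one_le_pow₀ hν1
    have h2 : ((x.U : ℤ) + 1) * ((x.s : ℤ) * x.s) ≤ (2 * ν ^ c) * ν ^ 2 :=
      mul_le_mul (by linarith) hss (by positivity) (by positivity)
    have h3 : bnd x.s x.U = 40 * (((x.U : ℤ) + 1) * ((x.s : ℤ) * x.s)) := by unfold bnd; ring
    have h4 := h2pow 7
    have h5 : 0 < ν ^ (c + 2) := by positivity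
    have h6 : ν ^ (c + 9) = ν ^ 7 * ν ^ (c + 2) := by ring
    have h7 : (2 * ν ^ c) * ν ^ 2 = 2 * ν ^ (c + 2) := by ring
    have h8 := hpow (c + 9) (5 * k + 4 * κ + c + 20) (by omega)
    have h9 := mul_le_mul_of_nonneg_right h4 h5.le
    linarith
  have hκ : (((3 * (x.s * x.s) : ℕ) : ℤ) ^ κ) ≤ ν ^ (5 * k + 4 * κ) := by
    push_cast
    calc (3 * ((x.s : ℤ) * x.s)) ^ κ ≤ (ν ^ 4) ^ κ := pow_le_pow_left₀ (by positivity) h3ss κ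
      _ = ν ^ (4 * κ) := (pow_mul _ _ _).symm
      _ ≤ _ := hpow _ _ (by omega)
  have hb := hbd x
  have hb' : (P.input (inst x)).Bounded (ν ^ (5 * k + 4 * κ)) :=
    ⟨fun r => (hb.reg r).trans hκ, fun a z => (hb.mem a z).trans hκ⟩
  have hbw : ν ^ (5 * k + 4 * κ) + 1 < 2 ^ w := by
    rw [hw]
    have h1 : (1 : ℤ) ≤ ν ^ (5 * k + 4 * κ) := one_le_pow₀ hν1
    have h2 : ν ^ (5 * k + 4 * κ + 2) ≤ ν ^ (5 * k + 4 * κ + c + 20) := hpow _ _ (by omega)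
    have h3 : ν ^ (5 * k + 4 * κ + 2) = ν ^ (5 * k + 4 * κ) * ν ^ 2 := by ring
    have h4 := mul_le_mul_of_nonneg_left (h2pow 2) (zero_le_one.trans h1)
    generalize ν ^ (5 * k + 4 * κ) = y at *
    linarith
  have hww : k * (Nat.log 2 (3 * (x.s * x.s)) + 1) ≤ w := by
    refine wordLength_le_of_pow_le (hw₀.trans ?_)
    rw [hw]
    exact hpow _ _ (by omega)
  obtain ⟨S, st', t', T, he, htT, hq, hc, hT⟩ := solver_runs x (o := o) (d := d) (es := es)
    (vals := vals x) (dv := dv x) hexec hww hb' (hw₀.trans (hpow _ _ (by omega))) hbw hZ (hr0 x)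
    (hr1 x) (hr x) (hm x) (fun st hE => hd x w st hwpos hZ hE) (fun st hE => hes x w st hwpos hZ hE)
    (hout x s₁ hcor) _ State.Equiv.rfl
  refine ⟨S, t', he, ?_, ?_⟩
  · exact time_bound hs1 hδ hδ' htime (htT.trans hT)
  · obtain ⟨a, b, c', m1, m2, m3, hmin⟩ := hc
    exact ⟨a, b, c', by rw [hq.1, m1], by rw [hq.1, m2], by rw [hq.1, m3], hmin⟩

end TriCover

/-! ### Tabulated inputs and their bounds -/

namespace WordRAM

lemma array_eq_tab {m : ℕ} (f : Fin m → ℤ) (g : ℤ → ℤ) (h : ∀ i : Fin m, f i = g (i : ℕ)) :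
    array f = tab m g fun _ => 0 := by
  funext z
  unfold array tab
  by_cases hz : 0 ≤ z ∧ z.toNat < m
  · rw [dif_pos hz, if_pos ⟨hz.1, by omega⟩, h]
    congr 1
    exact Int.toNat_of_nonneg hz.1
  · rw [dif_neg hz, if_neg (by omega)]

lemma bounded_init {b : ℤ} (hb : 0 ≤ b) {m : ℕ} {regs : List ℤ} {vals : List (ℤ → ℤ)}
    (hr : ∀ v ∈ regs, |v| ≤ b) (hv : ∀ v ∈ vals, ∀ k : ℤ, 0 ≤ k → k < m → |v k| ≤ b) :
    (State.init regs (vals.map fun v => tab m v fun _ => 0)).Bounded b := by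
  refine ⟨fun r => ?_, fun a z => ?_⟩
  · change |regs.getD r 0| ≤ b
    rcases lt_or_ge r regs.length with h | h
    · rw [List.getD_eq_getElem _ _ h]
      exact hr _ (List.getElem_mem h)
    · rw [List.getD_eq_default _ _ h]; simpa using hb
  · change |(vals.map fun v => tab m v fun _ => 0).getD a (fun _ => 0) z| ≤ b
    rcases lt_or_ge a (vals.map fun v => tab m v fun _ => 0).length with h | h
    · rw [List.getD_eq_getElem _ _ h, List.getElem_map]
      unfold tab
      split_ifs with hz
      · exact hv _ (List.getElem_mem _) z hz.1 hz.2
      · simpa using hb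
    · rw [List.getD_eq_default _ _ h]; simpa using hb

end WordRAM

namespace TriCover

open Ex

lemma sel_cases {q : ℤ} {f₀ f₁ f₂ : ℤ → ℤ} {P : ℤ → Prop} (h₀ : ∀ z, 0 ≤ z → z < q → P (f₀ z))
    (h₁ : ∀ z, 0 ≤ z → z < q → P (f₁ z)) (h₂ : ∀ z, 0 ≤ z → z < q → P (f₂ z)) {e : ℤ}
    (h0 : 0 ≤ e) (h : e < 3 * q) : P (sel q f₀ f₁ f₂ e) := by
  unfold sel
  split_ifs
  · exact h₀ _ h0 (by omega)
  · exact h₁ _ (by omega) (by omega)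
  · exact h₂ _ (by omega) (by omega)

section
variable {s : ℤ} (hs : 0 < s)
include hs

/-- Points with equal coordinates are equal. -/
lemma pt_inj {e e' : ℤ} (h0 : 0 ≤ e) (h : e < 3 * (s * s)) (h0' : 0 ≤ e') (h' : e' < 3 * (s * s))
    (hx : ptX s e = ptX s e') (hy : ptY s e = ptY s e') : e = e' := by
  obtain ⟨a, b, ha, ha', hb, hb', he⟩ := exists_block hs h0 h
  obtain ⟨c, d, hc, hc', hd, hd', he'⟩ := exists_block hs h0' h'
  have q0 := cell_nonneg hs ha ha' hb hb'
  have q1 := cell_nonneg hs hc hc' hd hd'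
  rcases he with rfl | rfl | rfl <;> rcases he' with rfl | rfl | rfl <;>
    simp only [ptX, ptY, sel_zero hs ha ha' hb hb', sel_zero hs hc hc' hd hd',
      sel_one hs ha ha' hb hb', sel_one hs hc hc' hd hd',
      sel_two hs ha ha' hb hb', sel_two hs hc hc' hd hd',
      cell_div hs ha ha' hb hb', cell_div hs hc hc' hd hd',
      cell_mod hs ha ha' hb hb', cell_mod hs hc hc' hd hd'] at hx hy
  · obtain rfl : a = c := hx
    omega
  · omega
  · omega
  · omega
  · obtain rfl : a = c := hy
    omega
  · omega
  · omega
  · omega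
  · omega

/-- Orthants with equal data are equal. -/
lemma obj_inj {e e' : ℤ} (h0 : 0 ≤ e) (h : e < 3 * (s * s)) (h0' : 0 ≤ e') (h' : e' < 3 * (s * s))
    (hx : apX s e = apX s e') (hy : apY s e = apY s e') (hu : upX s e = upX s e')
    (hv : upY s e = upY s e') : e = e' := by
  obtain ⟨a, b, ha, ha', hb, hb', he⟩ := exists_block hs h0 h
  obtain ⟨c, d, hc, hc', hd, hd', he'⟩ := exists_block hs h0' h'
  rcases he with rfl | rfl | rfl <;> rcases he' with rfl | rfl | rfl <;>
    simp only [apX, apY, upX, upY, sel_zero hs ha ha' hb hb', sel_zero hs hc hc' hd hd',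
      sel_one hs ha ha' hb hb', sel_one hs hc hc' hd hd',
      sel_two hs ha ha' hb hb', sel_two hs hc hc' hd hd',
      cell_div hs ha ha' hb hb', cell_div hs hc hc' hd hd',
      cell_mod hs ha ha' hb hb', cell_mod hs hc hc' hd hd', zero_ne_one, one_ne_zero] at hx hy hu hv
  · obtain rfl : a = c := by omega
    omega
  · obtain rfl : b = d := mul_right_cancel₀ hs.ne' (by omega)
    obtain rfl : a = c := by omega
    rfl
  · obtain rfl : b = d := mul_right_cancel₀ hs.ne' (by omega)
    obtain rfl : a = c := by omega
    rfl

end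

section
variable {s U : ℤ} (hs : 0 < s) (hU : 0 ≤ U) {e : ℤ} (h0 : 0 ≤ e) (h : e < 3 * (s * s))
include hs hU h0 h

lemma pt_le : |ptX s e| ≤ bnd s U ∧ |ptY s e| ≤ bnd s U := by
  constructor
  · exact sel_cases (P := fun v => |v| ≤ bnd s U) (fun z h h' => (bound_coords hs hU h h').1)
      (fun z h h' => (bound_coords hs hU h h').2.1)
      (fun z h h' => (bound_coords hs hU h h').2.2.1) h0 h
  · exact sel_cases (P := fun v => |v| ≤ bnd s U) (fun z h h' => (bound_coords hs hU h h').2.2.2.1)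
      (fun z h h' => (bound_coords hs hU h h').1)
      (fun z h h' => (bound_coords hs hU h h').2.2.2.2.1) h0 h

lemma ap_le : |apX s e| ≤ bnd s U ∧ |apY s e| ≤ bnd s U := by
  constructor
  · exact sel_cases (P := fun v => |v| ≤ bnd s U)
      (fun z h h' => (bound_coords hs hU h h').2.2.2.2.2.1)
      (fun z h h' => (bound_coords hs hU h h').1)
      (fun z h h' => (bound_coords hs hU h h').2.2.2.2.2.2.1) h0 h
  · exact sel_cases (P := fun v => |v| ≤ bnd s U)
      (fun z h h' => (bound_coords hs hU h h').2.2.2.2.2.2.2.1)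
      (fun z h h' => (bound_coords hs hU h h').2.2.2.2.2.2.2.2.1)
      (fun z h h' => (bound_coords hs hU h h').2.2.2.2.2.2.2.2.2.1) h0 h

lemma weight_le {A B C : ℤ → ℤ} (hA : ∀ z, |A z| ≤ U) (hB : ∀ z, |B z| ≤ U)
    (hC : ∀ z, |C z| ≤ U) : 0 ≤ weight s U A B C e ∧ weight s U A B C e ≤ bnd s U :=
  sel_cases (P := fun v => 0 ≤ v ∧ v ≤ bnd s U)
    (fun _ h h' => (bound_weights hs hU hA hB hC h h').1)
    (fun _ h h' => (bound_weights hs hU hA hB hC h h').2.1)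
    (fun _ h h' => (bound_weights hs hU hA hB hC h h').2.2) h0 h

end

lemma up_cases {s e : ℤ} (h0 : 0 ≤ e) (h : e < 3 * (s * s)) :
    (upX s e = 0 ∨ upX s e = 1) ∧ (upY s e = 0 ∨ upY s e = 1) := by
  constructor <;> exact sel_cases (P := fun v => v = 0 ∨ v = 1) (fun _ _ _ => by simp)
    (fun _ _ _ => by simp) (fun _ _ _ => by simp) h0 h

/-- With `n = 3 * s * s` one has `s + 1 ≤ n`, so `U ≤ n ^ c` and the bound is at most `80 * n ^ (c +
1)`. Since `n ≥ 3`, the factor `80` is below `n ^ 5`; this is where `c + 6` comes from. -/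
lemma bnd_le {c : ℕ} (x : TriInstance c) :
    bnd x.s x.U ≤ ((3 * (x.s * x.s) : ℕ) : ℤ) ^ (c + 6) := by
  have hs : (1 : ℤ) ≤ x.s := by exact_mod_cast x.s_pos
  push_cast
  set n : ℤ := 3 * ((x.s : ℤ) * x.s) with hn
  have hss : (x.s : ℤ) ≤ x.s * x.s := by nlinarith
  have hn3 : 3 ≤ n := by omega
  have hsn : (x.s : ℤ) + 1 ≤ n := by omega
  have hU : (x.U : ℤ) ≤ n ^ c := by
    have : (x.U : ℤ) ≤ ((x.s : ℤ) + 1) ^ c := by exact_mod_cast x.U_le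
    exact this.trans (pow_le_pow_left₀ (by positivity) hsn c)
  have h1 : (1 : ℤ) ≤ n ^ c := one_le_pow₀ (by omega)
  have h2 : bnd x.s x.U ≤ 40 * (2 * n ^ c) * n := by
    unfold bnd
    have : (x.s : ℤ) * x.s ≤ n := by omega
    exact mul_le_mul (by linarith) this (by positivity) (by positivity)
  have h3 : (3 : ℤ) ^ 5 ≤ n ^ 5 := pow_le_pow_left₀ (by norm_num) hn3 5
  have h4 : 0 ≤ n ^ c * n := by positivity
  have h5 := mul_le_mul_of_nonneg_right h3 h4
  have h6 : n ^ (c + 6) = n ^ 5 * (n ^ c * n) := by ring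
  rw [h6]
  linarith

/-! ### The orthant instance and the reduction to it -/

section
variable {c : ℕ} (x : TriInstance c)

lemma index_facts (i : Fin (3 * (x.s * x.s))) :
    (0 : ℤ) < x.s ∧ (0 : ℤ) ≤ x.U ∧ (0 : ℤ) ≤ (i : ℕ) ∧ ((i : ℕ) : ℤ) < 3 * (x.s * x.s) :=
  ⟨by exact_mod_cast x.s_pos, by positivity, by positivity, by exact_mod_cast i.2⟩

/-- The covering instance for orthants. -/
def orthantInstance : OrthantInstance (c + 6) where
  n := 3 * (x.s * x.s)
  n_pos := by have := x.s_pos; positivity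
  point i := ![ptX x.s (i : ℕ), ptY x.s (i : ℕ)]
  point_inj i j h := by
    obtain ⟨hs, -, h1, h2⟩ := index_facts x i
    obtain ⟨-, -, h3, h4⟩ := index_facts x j
    exact Fin.ext (by exact_mod_cast pt_inj hs h1 h2 h3 h4 (congrFun h 0) (congrFun h 1))
  orthant i := ⟨![apX x.s (i : ℕ), apY x.s (i : ℕ)],
    ![decide (upX x.s (i : ℕ) = 1), decide (upY x.s (i : ℕ) = 1)]⟩
  orthant_inj i j h := by
    obtain ⟨hs, -, h1, h2⟩ := index_facts x i
    obtain ⟨-, -, h3, h4⟩ := index_facts x j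
    have ha := congrArg Orthant.apex h
    have hu := congrArg Orthant.up h
    have hu0 : (upX x.s (i : ℕ) = 1) ↔ (upX x.s (j : ℕ) = 1) := decide_eq_decide.1 (congrFun hu 0)
    have hu1 : (upY x.s (i : ℕ) = 1) ↔ (upY x.s (j : ℕ) = 1) := decide_eq_decide.1 (congrFun hu 1)
    have ci := up_cases h1 h2
    have cj := up_cases h3 h4
    have := obj_inj hs h1 h2 h3 h4 (congrFun ha 0) (congrFun ha 1) (by omega) (by omega)
    exact Fin.ext (by exact_mod_cast this)
  weight i := (weight x.s x.U x.A x.B x.C (i : ℕ)).toNat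
  point_le i d := by
    obtain ⟨hs, hU, h1, h2⟩ := index_facts x i
    have := pt_le hs hU h1 h2
    fin_cases d
    · exact this.1.trans (bnd_le x)
    · exact this.2.trans (bnd_le x)
  apex_le i d := by
    obtain ⟨hs, hU, h1, h2⟩ := index_facts x i
    have := ap_le hs hU h1 h2
    fin_cases d
    · exact this.1.trans (bnd_le x)
    · exact this.2.trans (bnd_le x)
  weight_le i := by
    obtain ⟨hs, hU, h1, h2⟩ := index_facts x i
    have := (weight_le hs hU h1 h2 x.A_le x.B_le x.C_le).2.trans (bnd_le x)
    rw [Int.toNat_le]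
    exact_mod_cast this

end

/-- Minimum-weight triangle reduces to size-3 cover with orthants. -/
theorem minTri_of_orthant (c : ℕ) {δ : ℝ} (hδ : 0 < δ) (hδ' : δ ≤ 1 / 2)
    (h : (weightedOrthantCover3 (c + 6)).SolvableInTime fun n => (n : ℝ) ^ ((3 : ℝ) / 2 - δ)) :
    (MinTri c).SolvableInTime fun n => (n : ℝ) ^ (3 - 2 * δ) := by
  -- The input state is identified with the list of tabulated functions that the solver writes, so
  -- one list of formulas describes both.
  have hval : ∀ x : TriInstance c, (weightedOrthantCover3 (c + 6)).input (orthantInstance x) =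
      State.init [((3 * (x.s * x.s) : ℕ) : ℤ)] (([ptX x.s, ptY x.s, apX x.s, apY x.s, upX x.s,
        upY x.s, weight x.s x.U x.A x.B x.C]).map fun v => tab (3 * (x.s * x.s)) v fun _ => 0) := by
    intro x
    unfold weightedOrthantCover3
    simp only [List.map]
    congr 1
    have hup : ∀ i : Fin (3 * (x.s * x.s)), _ := fun i =>
      up_cases (index_facts x i).2.2.1 (index_facts x i).2.2.2
    refine congrArg₂ _ (array_eq_tab _ _ fun i => rfl) <| congrArg₂ _ (array_eq_tab _ _ fun i => rfl)
      <| congrArg₂ _ (array_eq_tab _ _ fun i => rfl) <| congrArg₂ _ (array_eq_tab _ _ fun i => rfl)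
      <| congrArg₂ _ (array_eq_tab _ _ fun i => ?_) <| congrArg₂ _ (array_eq_tab _ _ fun i => ?_)
      <| congrArg₂ _ (array_eq_tab _ _ fun i => ?_) rfl
    · rcases (hup i).1 with h | h <;> simp [orthantInstance, h]
    · rcases (hup i).2 with h | h <;> simp [orthantInstance, h]
    · obtain ⟨hs, hU, h1, h2⟩ := index_facts x i
      exact Int.toNat_of_nonneg (weight_le hs hU h1 h2 x.A_le x.B_le x.C_le).1
  refine minTri_solvable (κ := c + 6) (P := weightedOrthantCover3 (c + 6)) orthantInstance 7 (lit 0)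
    [selEx (fun x => x / var 0) (fun x => lit (-1) - x % var 0) (fun x => var 0 + x),
      selEx (fun x => lit 0 - x % var 0) (fun x => x / var 0) (fun x => var 2 + var 0 - x),
      selEx (fun x => x / var 0 - lit 1) (fun x => x / var 0)
        (fun x => x % var 0 * var 0 + var 0 + var 0 - lit 1),
      selEx (fun x => x % var 0) (fun x => var 2 - x % var 0 * var 0) (fun x => x / var 0 + lit 1),
      selEx (fun _ => lit 0) (fun _ => lit 1) (fun _ => lit 0),
      selEx (fun _ => lit 0) (fun _ => lit 0) (fun _ => lit 1),
      selEx (fun x => get 0 x + var 1 + var 5 * (x / var 0 + x % var 0))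
        (fun x => get 1 x + var 1 + var 5 * ((var 0 - x / var 0) + (var 0 - x % var 0)))
        (fun x => get 2 x + var 1 + var 5 * ((var 0 - x / var 0) + x % var 0))]
    (fun x => [ptX x.s, ptY x.s, apX x.s, apY x.s, upX x.s, upY x.s, weight x.s x.U x.A x.B x.C])
    (fun _ => 0) (fun _ => rfl) ?_ ?_ ?_ ?_ ?_ ?_ ?_ ?_ hδ hδ' h
  · intro x; rw [hval]; simp [State.init]
  · intro x; rw [hval]; simp [State.init]
  · intro x r hr; rw [hval]; exact List.getD_eq_default _ _ (by simp; omega)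
  · intro x a; rw [hval]; rfl
  · intro x
    have hs : (0 : ℤ) < x.s := by exact_mod_cast x.s_pos
    have hU : (0 : ℤ) ≤ x.U := by positivity
    have hb := bnd_le x
    have hb1 : 3 * ((x.s : ℤ) * x.s) ≤ bnd x.s x.U := by
      obtain ⟨-, -, -, h7, h8, h9, -⟩ :=
        small_facts hs hU le_rfl (by positivity : (0 : ℤ) < x.s * x.s)
      linarith [mul_pos hs hs]
    have hss : 0 < (x.s : ℤ) * x.s := by positivity
    rw [hval]
    refine bounded_init (by linarith) (fun v hv => ?_) (fun v hv k hk hk' => ?_)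
    · simp only [List.mem_singleton] at hv
      rw [hv, abs_of_nonneg (by positivity)]
      exact le_trans (by exact_mod_cast hb1) hb
    · have hk'' : k < 3 * ((x.s : ℤ) * x.s) := by exact_mod_cast hk'
      refine le_trans ?_ hb
      have hup := up_cases hk hk''
      have hW := weight_le hs hU hk hk'' x.A_le x.B_le x.C_le
      simp only [List.mem_cons, List.not_mem_nil, or_false] at hv
      rcases hv with rfl | rfl | rfl | rfl | rfl | rfl | rfl
      · exact (pt_le hs hU hk hk'').1
      · exact (pt_le hs hU hk hk'').2
      · exact (ap_le hs hU hk hk'').1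
      · exact (ap_le hs hU hk hk'').2
      · rcases hup.1 with h | h <;> rw [h] <;> simp <;> omega
      · rcases hup.2 with h | h <;> rw [h] <;> simp <;> omega
      · rw [abs_of_nonneg hW.1]; exact hW.2
  · intro x w st hw _ _
    simp
  · intro x w st hw hZ hE
    have hs : (0 : ℤ) < x.s := by exact_mod_cast x.s_pos
    have hU : (0 : ℤ) ≤ x.U := by positivity
    have hss : 3 * ((x.s : ℤ) * x.s) ≤ bnd x.s x.U := by
      obtain ⟨-, -, -, h7, h8, h9, -⟩ :=
        small_facts hs hU le_rfl (by positivity : (0 : ℤ) < x.s * x.s)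
      linarith [mul_pos hs hs]
    have hone : 1 ≤ bnd x.s x.U := by have : 0 < (x.s : ℤ) * x.s := by positivity
                                      omega
    have b := fun z (h : 0 ≤ z) (h' : z < (x.s : ℤ) * x.s) => bound_coords hs hU h h'
    have b' := fun z (h : 0 ≤ z) (h' : z < (x.s : ℤ) * x.s) =>
      bound_weights hs hU x.A_le x.B_le x.C_le h h'
    obtain ⟨c1, c2, c3, c4, c5, c6, c7, c8, c9, c10, -⟩ := computes_coords hE hs hU hZ
    obtain ⟨k0, k1⟩ := computes_const (st := st) (s := x.s) hw
    obtain ⟨w1, w2, w3⟩ := computes_weights hE hs hU x.A_le x.B_le x.C_le hZ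
    have z0 : ∀ z : ℤ, 0 ≤ z → z < (x.s : ℤ) * x.s → |(0 : ℤ)| ≤ bnd x.s x.U := fun _ _ _ => by
      simp; omega
    have z1 : ∀ z : ℤ, 0 ≤ z → z < (x.s : ℤ) * x.s → |(1 : ℤ)| ≤ bnd x.s x.U := fun _ _ _ => by
      simp; omega
    refine .cons ?_ (.cons ?_ (.cons ?_ (.cons ?_ (.cons ?_ (.cons ?_ (.cons ?_ .nil)))))) <;>
      intro k hk h7
    · exact computes_sel hw hE hss hZ c1 c2 c3 (fun z h h' => (b z h h').1)
        (fun z h h' => (b z h h').2.1) (fun z h h' => (b z h h').2.2.1) hk h7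
    · exact computes_sel hw hE hss hZ c4 c1 c5 (fun z h h' => (b z h h').2.2.2.1)
        (fun z h h' => (b z h h').1) (fun z h h' => (b z h h').2.2.2.2.1) hk h7
    · exact computes_sel hw hE hss hZ c6 c1 c7 (fun z h h' => (b z h h').2.2.2.2.2.1)
        (fun z h h' => (b z h h').1) (fun z h h' => (b z h h').2.2.2.2.2.2.1) hk h7
    · exact computes_sel hw hE hss hZ c8 c9 c10 (fun z h h' => (b z h h').2.2.2.2.2.2.2.1)
        (fun z h h' => (b z h h').2.2.2.2.2.2.2.2.1)
        (fun z h h' => (b z h h').2.2.2.2.2.2.2.2.2.1) hk h7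
    · exact computes_sel hw hE hss hZ k0 k1 k0 z0 z1 z0 hk h7
    · exact computes_sel hw hE hss hZ k0 k0 k1 z0 z0 z1 hk h7
    · exact computes_sel hw hE hss hZ w1 w2 w3
        (fun z h h' => by rw [abs_of_nonneg (b' z h h').1.1]; exact (b' z h h').1.2)
        (fun z h h' => by rw [abs_of_nonneg (b' z h h').2.1.1]; exact (b' z h h').2.1.2)
        (fun z h h' => by rw [abs_of_nonneg (b' z h h').2.2.1]; exact (b' z h h').2.2.2) hk h7
  · intro x s₁ hc
    refine isMinTri_of_answers x.s_pos rfl x.A_le x.B_le x.C_le ?_ ?_ hc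
    · intro i j
      change (∀ d, _) ↔ _
      rw [Fin.forall_fin_two]
      simp only [orthantInstance, Cov, decide_eq_true_eq, Matrix.cons_val_zero, Matrix.cons_val_one]
      norm_cast
    · intro j
      obtain ⟨hs, hU, h1, h2⟩ := index_facts x j
      exact Int.toNat_of_nonneg (weight_le hs hU h1 h2 x.A_le x.B_le x.C_le).1

end TriCover

/-! ### The unit square instance and the reduction to it -/

namespace TriCover

open Ex

/-- Lower left corners of the squares of side `4 * s * s` that stand for the orthants. -/
def cnX (s : ℤ) : ℤ → ℤ := sel (s * s) (fun z => z / s - 1 - 4 * (s * s)) (fun z => z / s)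
  (fun z => z % s * s + s + s - 1 - 4 * (s * s))
def cnY (s : ℤ) : ℤ → ℤ := sel (s * s) (fun z => z % s - 4 * (s * s))
  (fun z => s * s - z % s * s - 4 * (s * s)) (fun z => z / s + 1)

section
variable {s : ℤ} (hs : 0 < s)
include hs

lemma cn_inj {e e' : ℤ} (h0 : 0 ≤ e) (h : e < 3 * (s * s)) (h0' : 0 ≤ e') (h' : e' < 3 * (s * s))
    (hx : cnX s e = cnX s e') (hy : cnY s e = cnY s e') : e = e' := by
  obtain ⟨a, b, ha, ha', hb, hb', he⟩ := exists_block hs h0 h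
  obtain ⟨c, d, hc, hc', hd, hd', he'⟩ := exists_block hs h0' h'
  have q0 : 0 ≤ b * s := by positivity
  have q1 : 0 ≤ d * s := by positivity
  have q2 : b * s < s * s := mul_lt_mul_of_pos_right hb' hs
  have q3 : d * s < s * s := mul_lt_mul_of_pos_right hd' hs
  have q4 : s ≤ s * s := by nlinarith
  rcases he with rfl | rfl | rfl <;> rcases he' with rfl | rfl | rfl <;>
    simp only [cnX, cnY, sel_zero hs ha ha' hb hb', sel_zero hs hc hc' hd hd',
      sel_one hs ha ha' hb hb', sel_one hs hc hc' hd hd',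
      sel_two hs ha ha' hb hb', sel_two hs hc hc' hd hd',
      cell_div hs ha ha' hb hb', cell_div hs hc hc' hd hd',
      cell_mod hs ha ha' hb hb', cell_mod hs hc hc' hd hd'] at hx hy
  · obtain rfl : a = c := by omega
    omega
  · omega
  · omega
  · omega
  · obtain rfl : b = d := mul_right_cancel₀ hs.ne' (by omega)
    obtain rfl : a = c := by omega
    rfl
  · omega
  · omega
  · omega
  · obtain rfl : b = d := mul_right_cancel₀ hs.ne' (by omega)
    obtain rfl : a = c := by omega
    rfl

/-- The squares contain the same points as the orthants. -/
lemma cov_iff_square {e i : ℤ} (h0 : 0 ≤ e) (h : e < 3 * (s * s)) (hi : 0 ≤ i)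
    (hi' : i < 3 * (s * s)) :
    Cov s e i ↔ (cnX s e ≤ ptX s i ∧ ptX s i ≤ cnX s e + 4 * (s * s)) ∧
      (cnY s e ≤ ptY s i ∧ ptY s i ≤ cnY s e + 4 * (s * s)) := by
  have q4 : s ≤ s * s := by nlinarith
  have f := fun z (h : 0 ≤ z) (h' : z < s * s) => small_facts hs le_rfl h h'
  -- Point coordinates lie in `[-s, s * s + s]` and apex coordinates in `[-1, s * s + 2 * s]`. They
  -- differ by at most `s * s + 3 * s ≤ 4 * (s * s)`, so the far sides of the squares cut off no
  -- point.
  have px : -s ≤ ptX s i ∧ ptX s i ≤ s + s * s :=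
    sel_cases (P := fun v => -s ≤ v ∧ v ≤ s + s * s)
      (fun z h h' => by obtain ⟨f1, f2, f3, -⟩ := f z h h'; constructor <;> omega)
      (fun z h h' => by obtain ⟨f1, f2, f3, -⟩ := f z h h'; constructor <;> omega)
      (fun z h h' => by obtain ⟨f1, f2, f3, -⟩ := f z h h'; constructor <;> omega) hi hi'
  have py : -s ≤ ptY s i ∧ ptY s i ≤ s + s * s :=
    sel_cases (P := fun v => -s ≤ v ∧ v ≤ s + s * s)
      (fun z h h' => by obtain ⟨f1, f2, f3, -⟩ := f z h h'; constructor <;> omega)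
      (fun z h h' => by obtain ⟨f1, f2, f3, -⟩ := f z h h'; constructor <;> omega)
      (fun z h h' => by obtain ⟨f1, f2, f3, -⟩ := f z h h'; constructor <;> omega) hi hi'
  have ax : -1 ≤ apX s e ∧ apX s e ≤ 2 * s + s * s :=
    sel_cases (P := fun v => -1 ≤ v ∧ v ≤ 2 * s + s * s)
      (fun z h h' => by obtain ⟨f1, f2, f3, -⟩ := f z h h'; constructor <;> omega)
      (fun z h h' => by obtain ⟨f1, f2, f3, -⟩ := f z h h'; constructor <;> omega)
      (fun z h h' => by obtain ⟨f1, f2, f3, -⟩ := f z h h'; constructor <;> omega) h0 h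
  have ay : -1 ≤ apY s e ∧ apY s e ≤ 2 * s + s * s :=
    sel_cases (P := fun v => -1 ≤ v ∧ v ≤ 2 * s + s * s)
      (fun z h h' => by obtain ⟨f1, f2, f3, -⟩ := f z h h'; constructor <;> omega)
      (fun z h h' => by obtain ⟨f1, f2, f3, -⟩ := f z h h'; constructor <;> omega)
      (fun z h h' => by obtain ⟨f1, f2, f3, -⟩ := f z h h'; constructor <;> omega) h0 h
  have hcx : cnX s e = if upX s e = 1 then apX s e else apX s e - 4 * (s * s) := by
    unfold cnX upX apX sel; split_ifs <;> simp_all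
  have hcy : cnY s e = if upY s e = 1 then apY s e else apY s e - 4 * (s * s) := by
    unfold cnY upY apY sel; split_ifs <;> simp_all
  unfold Cov
  rw [hcx, hcy]
  split_ifs <;> omega

variable {U : ℤ} (hU : 0 ≤ U)
include hU

lemma cn_le {e : ℤ} (h0 : 0 ≤ e) (h : e < 3 * (s * s)) :
    |cnX s e| ≤ bnd s U ∧ |cnY s e| ≤ bnd s U := by
  constructor
  · exact sel_cases (P := fun v => |v| ≤ bnd s U)
      (fun z h h' => (bound_coords hs hU h h').2.2.2.2.2.2.2.2.2.2.1)
      (fun z h h' => (bound_coords hs hU h h').1)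
      (fun z h h' => (bound_coords hs hU h h').2.2.2.2.2.2.2.2.2.2.2.1) h0 h
  · exact sel_cases (P := fun v => |v| ≤ bnd s U)
      (fun z h h' => (bound_coords hs hU h h').2.2.2.2.2.2.2.2.2.2.2.2.1)
      (fun z h h' => (bound_coords hs hU h h').2.2.2.2.2.2.2.2.2.2.2.2.2)
      (fun z h h' => (bound_coords hs hU h h').2.2.2.2.2.2.2.2.2.1) h0 h

lemma four_mul_le_bnd : 4 * (s * s) ≤ bnd s U := by
  obtain ⟨-, -, -, h7, h8, h9, -⟩ := small_facts hs hU le_rfl (by positivity : (0 : ℤ) < s * s)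
  linarith [mul_pos hs hs]

end

section
variable {c : ℕ} (x : TriInstance c)

/-- The covering instance for unit squares. -/
def unitSquareInstance : UnitSquareInstance (c + 6) where
  n := 3 * (x.s * x.s)
  n_pos := by have := x.s_pos; positivity
  -- Dividing by the side length turns the squares into unit squares without changing any numerator.
  denom := 4 * (x.s * x.s)
  denom_pos := by have := x.s_pos; positivity
  point i := ![ptX x.s (i : ℕ), ptY x.s (i : ℕ)]
  point_inj i j h := by
    obtain ⟨hs, -, h1, h2⟩ := index_facts x i
    obtain ⟨-, -, h3, h4⟩ := index_facts x j
    exact Fin.ext (by exact_mod_cast pt_inj hs h1 h2 h3 h4 (congrFun h 0) (congrFun h 1))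
  corner i := ![cnX x.s (i : ℕ), cnY x.s (i : ℕ)]
  corner_inj i j h := by
    obtain ⟨hs, -, h1, h2⟩ := index_facts x i
    obtain ⟨-, -, h3, h4⟩ := index_facts x j
    exact Fin.ext (by exact_mod_cast cn_inj hs h1 h2 h3 h4 (congrFun h 0) (congrFun h 1))
  weight i := (weight x.s x.U x.A x.B x.C (i : ℕ)).toNat
  denom_le := by
    have := (four_mul_le_bnd (s := x.s) (U := x.U) (by exact_mod_cast x.s_pos)
      (by positivity)).trans (bnd_le x)
    exact_mod_cast this
  point_le i d := by
    obtain ⟨hs, hU, h1, h2⟩ := index_facts x i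
    have := pt_le hs hU h1 h2
    fin_cases d
    · exact this.1.trans (bnd_le x)
    · exact this.2.trans (bnd_le x)
  corner_le i d := by
    obtain ⟨hs, hU, h1, h2⟩ := index_facts x i
    have := cn_le hs hU h1 h2
    fin_cases d
    · exact this.1.trans (bnd_le x)
    · exact this.2.trans (bnd_le x)
  weight_le i := by
    obtain ⟨hs, hU, h1, h2⟩ := index_facts x i
    have := (weight_le hs hU h1 h2 x.A_le x.B_le x.C_le).2.trans (bnd_le x)
    rw [Int.toNat_le]
    exact_mod_cast this

end

/-- Minimum-weight triangle reduces to size-3 cover with unit squares. -/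
theorem minTri_of_unitSquare (c : ℕ) {δ : ℝ} (hδ : 0 < δ) (hδ' : δ ≤ 1 / 2)
    (h : (weightedUnitSquareCover3 (c + 6)).SolvableInTime
      fun n => (n : ℝ) ^ ((3 : ℝ) / 2 - δ)) :
    (MinTri c).SolvableInTime fun n => (n : ℝ) ^ (3 - 2 * δ) := by
  have hval : ∀ x : TriInstance c,
      (weightedUnitSquareCover3 (c + 6)).input (unitSquareInstance x) =
      State.init [((3 * (x.s * x.s) : ℕ) : ℤ), ((4 * (x.s * x.s) : ℕ) : ℤ)]
        (([ptX x.s, ptY x.s, cnX x.s, cnY x.s, weight x.s x.U x.A x.B x.C]).map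
          fun v => tab (3 * (x.s * x.s)) v fun _ => 0) := by
    intro x
    unfold weightedUnitSquareCover3
    simp only [List.map]
    congr 1
    refine congrArg₂ _ (array_eq_tab _ _ fun i => rfl) <| congrArg₂ _ (array_eq_tab _ _ fun i => rfl)
      <| congrArg₂ _ (array_eq_tab _ _ fun i => rfl) <| congrArg₂ _ (array_eq_tab _ _ fun i => rfl)
      <| congrArg₂ _ (array_eq_tab _ _ fun i => ?_) rfl
    obtain ⟨hs, hU, h1, h2⟩ := index_facts x i
    exact Int.toNat_of_nonneg (weight_le hs hU h1 h2 x.A_le x.B_le x.C_le).1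
  refine minTri_solvable (κ := c + 6) (P := weightedUnitSquareCover3 (c + 6)) unitSquareInstance 5
    (var 6)
    [selEx (fun x => x / var 0) (fun x => lit (-1) - x % var 0) (fun x => var 0 + x),
      selEx (fun x => lit 0 - x % var 0) (fun x => x / var 0) (fun x => var 2 + var 0 - x),
      selEx (fun x => x / var 0 - lit 1 - var 6) (fun x => x / var 0)
        (fun x => x % var 0 * var 0 + var 0 + var 0 - lit 1 - var 6),
      selEx (fun x => x % var 0 - var 6) (fun x => var 2 - x % var 0 * var 0 - var 6)
        (fun x => x / var 0 + lit 1),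
      selEx (fun x => get 0 x + var 1 + var 5 * (x / var 0 + x % var 0))
        (fun x => get 1 x + var 1 + var 5 * ((var 0 - x / var 0) + (var 0 - x % var 0)))
        (fun x => get 2 x + var 1 + var 5 * ((var 0 - x / var 0) + x % var 0))]
    (fun x => [ptX x.s, ptY x.s, cnX x.s, cnY x.s, weight x.s x.U x.A x.B x.C])
    (fun x => 4 * (x.s * x.s)) (fun _ => rfl) ?_ ?_ ?_ ?_ ?_ ?_ ?_ ?_ hδ hδ' h
  · intro x; rw [hval]; simp [State.init]
  · intro x; rw [hval]; simp [State.init]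
  · intro x r hr; rw [hval]; exact List.getD_eq_default _ _ (by simp; omega)
  · intro x a; rw [hval]; rfl
  · intro x
    have hs : (0 : ℤ) < x.s := by exact_mod_cast x.s_pos
    have hU : (0 : ℤ) ≤ x.U := by positivity
    have hb := bnd_le x
    have hb1 := four_mul_le_bnd hs hU
    have hss : 0 < (x.s : ℤ) * x.s := by positivity
    rw [hval]
    refine bounded_init (by linarith) (fun v hv => ?_) (fun v hv k hk hk' => ?_)
    · simp only [List.mem_cons, List.not_mem_nil, or_false] at hv
      refine le_trans ?_ hb
      rcases hv with rfl | rfl <;> rw [abs_of_nonneg (by positivity)] <;> push_cast <;> linarith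
    · have hk'' : k < 3 * ((x.s : ℤ) * x.s) := by exact_mod_cast hk'
      refine le_trans ?_ hb
      have hW := weight_le hs hU hk hk'' x.A_le x.B_le x.C_le
      simp only [List.mem_cons, List.not_mem_nil, or_false] at hv
      rcases hv with rfl | rfl | rfl | rfl | rfl
      · exact (pt_le hs hU hk hk'').1
      · exact (pt_le hs hU hk hk'').2
      · exact (cn_le hs hU hk hk'').1
      · exact (cn_le hs hU hk hk'').2
      · rw [abs_of_nonneg hW.1]; exact hW.2
  · intro x w st hw hZ hE
    have hs : (0 : ℤ) < x.s := by exact_mod_cast x.s_pos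
    have hb1 := four_mul_le_bnd (U := x.U) hs (by positivity)
    exact ⟨by simp; decide, by simpa using hE.r6, by rw [abs_of_nonneg] <;> [omega; positivity]⟩
  · intro x w st hw hZ hE
    have hs : (0 : ℤ) < x.s := by exact_mod_cast x.s_pos
    have hU : (0 : ℤ) ≤ x.U := by positivity
    have hss : 3 * ((x.s : ℤ) * x.s) ≤ bnd x.s x.U := by
      have := four_mul_le_bnd hs hU
      linarith [mul_pos hs hs]
    have b := fun z (h : 0 ≤ z) (h' : z < (x.s : ℤ) * x.s) => bound_coords hs hU h h'
    have b' := fun z (h : 0 ≤ z) (h' : z < (x.s : ℤ) * x.s) =>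
      bound_weights hs hU x.A_le x.B_le x.C_le h h'
    obtain ⟨c1, c2, c3, c4, c5, c6, c7, c8, c9, c10, c11, c12, c13, c14⟩ :=
      computes_coords hE hs hU hZ
    obtain ⟨w1, w2, w3⟩ := computes_weights hE hs hU x.A_le x.B_le x.C_le hZ
    refine .cons ?_ (.cons ?_ (.cons ?_ (.cons ?_ (.cons ?_ .nil)))) <;> intro k hk h7
    · exact computes_sel hw hE hss hZ c1 c2 c3 (fun z h h' => (b z h h').1)
        (fun z h h' => (b z h h').2.1) (fun z h h' => (b z h h').2.2.1) hk h7
    · exact computes_sel hw hE hss hZ c4 c1 c5 (fun z h h' => (b z h h').2.2.2.1)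
        (fun z h h' => (b z h h').1) (fun z h h' => (b z h h').2.2.2.2.1) hk h7
    · exact computes_sel hw hE hss hZ c11 c1 c12
        (fun z h h' => (b z h h').2.2.2.2.2.2.2.2.2.2.1) (fun z h h' => (b z h h').1)
        (fun z h h' => (b z h h').2.2.2.2.2.2.2.2.2.2.2.1) hk h7
    · exact computes_sel hw hE hss hZ c13 c14 c10
        (fun z h h' => (b z h h').2.2.2.2.2.2.2.2.2.2.2.2.1)
        (fun z h h' => (b z h h').2.2.2.2.2.2.2.2.2.2.2.2.2)
        (fun z h h' => (b z h h').2.2.2.2.2.2.2.2.2.1) hk h7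
    · exact computes_sel hw hE hss hZ w1 w2 w3
        (fun z h h' => by rw [abs_of_nonneg (b' z h h').1.1]; exact (b' z h h').1.2)
        (fun z h h' => by rw [abs_of_nonneg (b' z h h').2.1.1]; exact (b' z h h').2.1.2)
        (fun z h h' => by rw [abs_of_nonneg (b' z h h').2.2.1]; exact (b' z h h').2.2.2) hk h7
  · intro x s₁ hc
    refine isMinTri_of_answers x.s_pos rfl x.A_le x.B_le x.C_le ?_ ?_ hc
    · intro i j
      obtain ⟨hs, hU, h1, h2⟩ := index_facts x j
      obtain ⟨-, -, h3, h4⟩ := index_facts x i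
      rw [cov_iff_square hs h1 h2 h3 h4]
      have hD : (0 : ℝ) < ((4 * (x.s * x.s) : ℕ) : ℝ) := by
        have := x.s_pos
        positivity
      change (∀ d, _) ↔ _
      rw [Fin.forall_fin_two]
      have key : ∀ p q : ℤ, ((p : ℝ) / ((4 * (x.s * x.s) : ℕ) : ℝ) ≤ q / ((4 * (x.s * x.s) : ℕ) : ℝ) ∧
          (q : ℝ) / ((4 * (x.s * x.s) : ℕ) : ℝ) ≤ p / ((4 * (x.s * x.s) : ℕ) : ℝ) + 1) ↔
          (p ≤ q ∧ q ≤ p + 4 * ((x.s : ℤ) * x.s)) := by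
        intro p q
        rw [div_le_div_iff_of_pos_right hD, div_le_iff₀ hD, add_mul, div_mul_cancel₀ _ hD.ne',
          one_mul]
        norm_cast
      exact and_congr (key _ _) (key _ _)
    · intro j
      obtain ⟨hs, hU, h1, h2⟩ := index_facts x j
      exact Int.toNat_of_nonneg (weight_le hs hU h1 h2 x.A_le x.B_le x.C_le).1

end TriCover
/-! ## Walks and min-plus powers -/

section
variable (N : ℕ) (W : ℕ → ℕ → ℤ)

/-- In the complete graph on `0, …, N - 1` with edge weights `W`, there is a walk with exactly `L`
edges from `i` to `j`, of total weight `a`. -/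
def WalkLen : ℕ → ℕ → ℕ → ℤ → Prop
  | 0, i, j, a => i = j ∧ a = 0
  | L + 1, i, j, a => ∃ k < N, ∃ b, WalkLen L k j b ∧ a = W i k + b

/-- `D` is the matrix of the minimum weights of walks with exactly `L` edges. -/
def IsWalkMin (L : ℕ) (D : ℕ → ℕ → ℤ) : Prop :=
  ∀ i < N, ∀ j < N, WalkLen N W L i j (D i j) ∧ ∀ a, WalkLen N W L i j a → D i j ≤ a

variable {N W}

lemma WalkLen.append {L M : ℕ} {i j k : ℕ} {a b : ℤ} (h : WalkLen N W L i k a)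
    (h' : WalkLen N W M k j b) : WalkLen N W (L + M) i j (a + b) := by
  induction L generalizing i a with
  | zero => obtain ⟨rfl, rfl⟩ := h; simpa using h'
  | succ L ih =>
    obtain ⟨x, hx, c, hc, rfl⟩ := h
    rw [Nat.succ_add]
    exact ⟨x, hx, c + b, ih hc, by ring⟩

lemma WalkLen.split {L M : ℕ} {i j : ℕ} {a : ℤ} (hi : i < N) (h : WalkLen N W (L + M) i j a) :
    ∃ k < N, ∃ b c, WalkLen N W L i k b ∧ WalkLen N W M k j c ∧ a = b + c := by
  induction L generalizing i a with
  | zero => exact ⟨i, hi, 0, a, ⟨rfl, rfl⟩, by simpa using h, by ring⟩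
  | succ L ih =>
    rw [Nat.succ_add] at h
    obtain ⟨x, hx, c, hc, rfl⟩ := h
    obtain ⟨k, hk, b, d, h1, h2, rfl⟩ := ih hx hc
    exact ⟨k, hk, W i x + b, d, ⟨x, hx, b, h1, rfl⟩, h2, by ring⟩

lemma WalkLen.abs_le {X : ℤ} (hW : ∀ i j, |W i j| ≤ X) {L i j : ℕ} {a : ℤ}
    (h : WalkLen N W L i j a) : |a| ≤ L * X := by
  induction L generalizing i a with
  | zero => obtain ⟨-, rfl⟩ := h; simp
  | succ L ih =>
    obtain ⟨x, hx, c, hc, rfl⟩ := h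
    push_cast
    linarith [abs_add_le (W i x) c, hW i x, ih hc]

lemma WalkLen.ge {X : ℤ} (hW : ∀ i j, -X ≤ W i j) {L i j : ℕ} {a : ℤ}
    (h : WalkLen N W L i j a) : -(L * X) ≤ a := by
  induction L generalizing i a with
  | zero => obtain ⟨-, rfl⟩ := h; simp
  | succ L ih =>
    obtain ⟨x, hx, c, hc, rfl⟩ := h
    push_cast
    linarith [hW i x, ih hc]

/-- Zero loops prolong a walk for free, so minimizing over walks with exactly `N` edges includes all
shorter walks. -/
lemma WalkLen.pad (h0 : ∀ i, W i i = 0) {L M i j : ℕ} {a : ℤ} (hi : i < N)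
    (h : WalkLen N W L i j a) (hLM : L ≤ M) : WalkLen N W M i j a := by
  induction M, hLM using Nat.le_induction with
  | base => exact h
  | succ M _ ih => exact ⟨i, hi, a, ih, by rw [h0]; ring⟩

lemma isWalkMin_one : IsWalkMin N W 1 W := by
  intro i hi j hj
  refine ⟨⟨j, hj, 0, ⟨rfl, rfl⟩, by ring⟩, ?_⟩
  rintro a ⟨k, hk, b, ⟨rfl, rfl⟩, rfl⟩
  simp

/-- The min-plus square of the matrix for `L` is the one for `2 * L`. -/
lemma IsWalkMin.square {L : ℕ} {D D' : ℕ → ℕ → ℤ} (h : IsWalkMin N W L D)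
    (hle : ∀ i < N, ∀ j < N, ∀ k < N, D' i j ≤ D i k + D k j)
    (hex : ∀ i < N, ∀ j < N, ∃ k < N, D' i j = D i k + D k j) : IsWalkMin N W (L + L) D' := by
  intro i hi j hj
  constructor
  · obtain ⟨k, hk, e⟩ := hex i hi j hj
    rw [e]
    exact (h i hi k hk).1.append (h k hk j hj).1
  · intro a ha
    obtain ⟨k, hk, b, c, h1, h2, rfl⟩ := ha.split hi
    linarith [hle i hi j hj k hk, (h i hi k hk).2 b h1, (h k hk j hj).2 c h2]

end

/-! ### Removing cycles, and the completion of a graph -/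

section
variable {n : ℕ} (W : Fin n → Fin n → Option ℤ)

/-- A walk all of whose vertices are in `S`. -/
inductive WalkIn (S : Finset (Fin n)) : Fin n → Fin n → ℤ → Prop where
  | nil (u : Fin n) (hu : u ∈ S) : WalkIn S u u 0
  | cons {u v x : Fin n} {a b : ℤ} (hu : u ∈ S) (h : W u v = some a) (hw : WalkIn S v x b) :
      WalkIn S u x (a + b)

variable {W}

lemma HasWalk.walkIn {u v : Fin n} {a : ℤ} (h : HasWalk W u v a) : WalkIn W Finset.univ u v a := by
  induction h with
  | nil u => exact .nil u (Finset.mem_univ u)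
  | cons h _ ih => exact .cons (Finset.mem_univ _) h ih

lemma WalkIn.left_mem {S : Finset (Fin n)} {u v : Fin n} {a : ℤ} (h : WalkIn W S u v a) :
    u ∈ S := by
  cases h <;> assumption

/-- Split a walk at its last visit to `x`. -/
lemma WalkIn.last_visit {S : Finset (Fin n)} (x : Fin n) {u v : Fin n} {a : ℤ}
    (h : WalkIn W S u v a) : WalkIn W (S.erase x) u v a ∨ ∃ b c, HasWalk W u x b ∧ a = b + c ∧
      (x = v ∧ c = 0 ∨ ∃ y d e, W x y = some d ∧ WalkIn W (S.erase x) y v e ∧ c = d + e) := by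
  induction h with
  | nil u hu =>
    by_cases hx : u = x
    · subst hx
      exact Or.inr ⟨0, 0, .nil u, by ring, Or.inl ⟨rfl, rfl⟩⟩
    · exact Or.inl (.nil u (Finset.mem_erase.2 ⟨hx, hu⟩))
  | @cons u y v d e hu h hw ih =>
    rcases ih with ih | ⟨b, c, h1, rfl, h2⟩
    · by_cases hx : u = x
      · subst hx
        exact Or.inr ⟨0, d + e, .nil u, by ring, Or.inr ⟨y, d, e, h, ih, rfl⟩⟩
      · exact Or.inl (.cons (Finset.mem_erase.2 ⟨hx, hu⟩) h ih)
    · exact Or.inr ⟨d + b, c, .cons h h1, by ring, h2⟩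

/-- The complete graph with weights `W'` contains the graph `W`. -/
lemma WalkIn.exists_walkLen {N : ℕ} {W' : ℕ → ℕ → ℤ} {X : ℤ} (hN : n ≤ N)
    (hW : ∀ (u v : Fin n) (a : ℤ), W u v = some a → W' u v ≤ a ∧ W' u v ≤ X)
    (hneg : ∀ u a, HasWalk W u u a → 0 ≤ a) {S : Finset (Fin n)} {u v : Fin n} {a : ℤ}
    (h : WalkIn W S u v a) :
    ∃ L < S.card, ∃ b, b ≤ a ∧ b ≤ L * X ∧ WalkLen N W' L u v b := by
  induction hk : S.card using Nat.strong_induction_on generalizing S u v a with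
  | _ k ih =>
    have hu := h.left_mem
    -- The walk is cut at the last visit to its own start `u`. What precedes is a closed walk of
    -- nonnegative weight and is dropped; what follows the next edge avoids `u`, and induction on
    -- the size of `S` applies.
    rcases h.last_visit u with h1 | ⟨b, c, hb, rfl, ⟨rfl, rfl⟩ | ⟨y, d, e, hd, he, rfl⟩⟩
    · exact absurd h1.left_mem (Finset.notMem_erase u S)
    · exact ⟨0, hk ▸ Finset.card_pos.2 ⟨u, hu⟩, 0, by linarith [hneg u b hb], by simp, rfl, rfl⟩
    · have hlt : (S.erase u).card < k := by rw [← hk]; exact Finset.card_erase_lt_of_mem hu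
      obtain ⟨L, hL, f, hf1, hf2, hf3⟩ := ih _ hlt he rfl
      obtain ⟨hd1, hd2⟩ := hW u y d hd
      refine ⟨L + 1, by omega, W' u y + f, ?_, ?_, y, by omega, f, hf3, rfl⟩
      · linarith [hneg u b hb]
      · push_cast; linarith

/-- Short light walks in the complete graph avoid the edges that are not in `W`. -/
lemma WalkLen.hasWalk {N : ℕ} {W' : ℕ → ℕ → ℤ} {X Y : ℤ} (hX : 0 ≤ X)
    (hge : ∀ i j, -X ≤ W' i j)
    (hW : ∀ (u : Fin n) (j : ℕ), (u : ℕ) = j ∧ W' u j = 0 ∨ W' u j = Y ∨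
      ∃ v : Fin n, j = v ∧ W u v = some (W' u j))
    {L : ℕ} {u v : Fin n} {a : ℤ} (h : WalkLen N W' L u v a) :
    HasWalk W u v a ∨ Y - L * X ≤ a := by
  induction L generalizing u a with
  | zero =>
    obtain ⟨h1, rfl⟩ := h
    obtain rfl : u = v := Fin.ext h1
    exact Or.inl (.nil u)
  | succ L ih =>
    obtain ⟨k, hk, b, hb, rfl⟩ := h
    have hb' := hb.ge hge
    push_cast
    rcases hW u k with ⟨rfl, h0⟩ | h0 | ⟨x, rfl, h0⟩
    · rcases ih hb with h1 | h1
      · rw [h0, zero_add]; exact Or.inl h1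
      · right; linarith
    · right; linarith
    · rcases ih hb with h1 | h1
      · exact Or.inl (.cons h0 h1)
      · right; linarith [hge u x]

end

/-- The complete graph on `ℕ` that contains the graph `W`; missing edges have weight `Y`. -/
def completion {n : ℕ} (W : Fin n → Fin n → Option ℤ) (Y : ℤ) (i j : ℕ) : ℤ :=
  if i = j then 0 else if h : i < n ∧ j < n then (W ⟨i, h.1⟩ ⟨j, h.2⟩).getD Y else Y

/-- Distances can be read off from the walks with `N` edges in the completion. -/
lemma distance_of_isWalkMin {c : ℕ} (x : APSPInstance c) {N : ℕ} (hN : x.n ≤ N) {V : ℤ}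
    (hV : N * (N : ℤ) ^ c ≤ V) {D : ℕ → ℕ → ℤ}
    (hD : IsWalkMin N (completion x.W (4 * V)) N D) (u v : Fin x.n) :
    (D u v ≤ V → IsLeast {a | HasWalk x.W u v a} (D u v)) ∧
      (V < D u v → ∀ a, ¬ HasWalk x.W u v a) := by
  have hn := x.n_pos
  have hNpos : (0 : ℤ) < N := by exact_mod_cast (by omega : 0 < N)
  set X : ℤ := (N : ℤ) ^ c with hX
  have hX0 : 0 < X := by positivity
  have hV0 : 0 < V := lt_of_lt_of_le (by positivity) hV
  have hXV : X ≤ V := le_trans (by nlinarith) hV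
  have hwt : ∀ u v a, x.W u v = some a → |a| ≤ X := fun u v a h =>
    (x.weight_le u v a h).trans (pow_le_pow_left₀ (by positivity) (by exact_mod_cast hN) c)
  have hge : ∀ i j, -X ≤ completion x.W (4 * V) i j := by
    intro i j
    unfold completion
    split_ifs with h1 h2
    · omega
    · cases h : x.W ⟨i, h2.1⟩ ⟨j, h2.2⟩ with
      | none => simp; omega
      | some a => simpa using (abs_le.1 (hwt _ _ _ h)).1
    · omega
  obtain ⟨hmem, hmin⟩ := hD u (by omega) v (by omega)
  -- Any walk can be replaced by one with fewer than `n` edges, each of weight at most `X`; hence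
  -- reachability already forces the entry to be at most `N * X ≤ V`.
  have short : ∀ a, HasWalk x.W u v a → D u v ≤ a ∧ D u v ≤ V := by
    intro a ha
    obtain ⟨L, hL, b, hb1, hb2, hb3⟩ := ha.walkIn.exists_walkLen (W' := completion x.W (4 * V)) (X := X)
      hN (fun u v a h => by
        have h' := abs_le.1 (hwt u v a h)
        by_cases huv : u = v
        · subst huv
          -- Replacing a loop by weight zero is harmless: a loop is a closed walk, so its weight is
          -- not negative.
          have := x.no_neg_cycle u (a + 0) (.cons h (.nil u))
          simp [completion]; omega
        · have : ¬ (u : ℕ) = v := fun e => huv (Fin.ext e)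
          simp [completion, this, h]; omega) x.no_neg_cycle
    rw [Finset.card_univ, Fintype.card_fin] at hL
    have := hmin b (hb3.pad (fun i => by simp [completion]) (by omega) (by omega))
    have hLN : (L : ℤ) * X ≤ N * X :=
      mul_le_mul_of_nonneg_right (by exact_mod_cast (by omega : L ≤ N)) hX0.le
    constructor <;> linarith
  refine ⟨fun hle => ⟨?_, fun a ha => (short a ha).1⟩, fun hlt a ha => ?_⟩
  -- A walk using a missing edge weighs at least `4 * V - N * X ≥ 3 * V`, which exceeds `V`. The
  -- threshold `V` thus separates genuine distances from artefacts of the completion.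
  · rcases hmem.hasWalk (W := x.W) (Y := 4 * V) hX0.le hge (fun u j => by
      by_cases hj : (u : ℕ) = j
      · exact Or.inl ⟨hj, by simp [completion, hj]⟩
      · by_cases hjn : j < x.n
        · cases h : x.W u ⟨j, hjn⟩ with
          | none => right; left; simp [completion, hj, hjn, h]
          | some a => exact Or.inr (Or.inr ⟨⟨j, hjn⟩, rfl, by simp [completion, hj, hjn, h]⟩)
        · right; left; simp [completion, hj, hjn]) with h | h
    · exact h
    · exfalso; linarith
  · linarith [(short a ha).2]
/-! ## Calls of a program for minimum-weight triangle -/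

namespace WordRAM

namespace Ex

/-- The expression evaluates to `v` without overflow. -/
def Val (w : ℕ) (st : State) (e : Ex) (v : ℤ) : Prop := e.Ok w st ∧ e.eval st = v

variable {w : ℕ} {st : State} {a b c : Ex} {x y z : ℤ}

lemma Val.var {r : ℕ} (hr : ¬ IsTemp r) (h : st.reg r = x) : (Ex.var r).Val w st x := ⟨hr, h⟩

lemma Val.lit (h : |x| < 2 ^ w) : (Ex.lit x).Val w st x := ⟨h, rfl⟩

lemma Val.add (ha : a.Val w st x) (hb : b.Val w st y) (h : |x + y| < 2 ^ w) :
    (a + b).Val w st (x + y) :=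
  ⟨⟨ha.1, hb.1, by simpa only [BinOp.eval, ha.2, hb.2] using h⟩, by simp [ha.2, hb.2]⟩

lemma Val.sub (ha : a.Val w st x) (hb : b.Val w st y) (h : |x - y| < 2 ^ w) :
    (a - b).Val w st (x - y) :=
  ⟨⟨ha.1, hb.1, by simpa only [BinOp.eval, ha.2, hb.2] using h⟩, by simp [ha.2, hb.2]⟩

lemma Val.mul (ha : a.Val w st x) (hb : b.Val w st y) (h : |x * y| < 2 ^ w) :
    (a * b).Val w st (x * y) :=
  ⟨⟨ha.1, hb.1, by simpa only [BinOp.eval, ha.2, hb.2] using h⟩, by simp [ha.2, hb.2]⟩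

lemma Val.div (ha : a.Val w st x) (hb : b.Val w st y) (h : |x / y| < 2 ^ w) :
    (a / b).Val w st (x / y) :=
  ⟨⟨ha.1, hb.1, by simpa only [BinOp.eval, ha.2, hb.2] using h⟩, by simp [ha.2, hb.2]⟩

lemma Val.mod (ha : a.Val w st x) (hb : b.Val w st y) (h : |x % y| < 2 ^ w) :
    (a % b).Val w st (x % y) :=
  ⟨⟨ha.1, hb.1, by simpa only [BinOp.eval, ha.2, hb.2] using h⟩, by simp [ha.2, hb.2]⟩

lemma Val.lt (hw : 0 < w) (ha : a.Val w st x) (hb : b.Val w st y) :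
    (Ex.lt a b).Val w st (if x < y then 1 else 0) :=
  ⟨(ok_lt _ _ _ _ hw).2 ⟨ha.1, hb.1⟩, by simp [ha.2, hb.2]⟩

lemma Val.eq (hw : 0 < w) (ha : a.Val w st x) (hb : b.Val w st y) :
    (Ex.eq a b).Val w st (if x = y then 1 else 0) :=
  ⟨(ok_eq _ _ _ _ hw).2 ⟨ha.1, hb.1⟩, by simp [ha.2, hb.2]⟩

lemma Val.get {arr : ℕ} (ha : a.Val w st x) : (Ex.get arr a).Val w st (st.mem arr x) :=
  ⟨ha.1, by simp [ha.2]⟩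

/-- A conditional expression whose test is `p`. -/
lemma Val.cond {p : Prop} [Decidable p] (hc : c.Val w st (if p then 1 else 0))
    (ha : p → a.Val w st x ∧ |x| < 2 ^ w) (hb : ¬ p → b.Val w st y ∧ |y| < 2 ^ w) :
    (Ex.cond c a b).Val w st (if p then x else y) := by
  by_cases h : p
  · obtain ⟨h1, h2⟩ := ha h
    have hc' : c.eval st = 1 := by rw [hc.2, if_pos h]
    exact ⟨⟨hc.1, fun _ => ⟨h1.1, by rwa [h1.2]⟩, fun h0 => by omega⟩, by simp [hc', h, h1.2]⟩
  · obtain ⟨h1, h2⟩ := hb h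
    have hc' : c.eval st = 0 := by rw [hc.2, if_neg h]
    exact ⟨⟨hc.1, fun h0 => absurd hc' h0, fun _ => ⟨h1.1, by rwa [h1.2]⟩⟩, by simp [hc', h, h1.2]⟩

end Ex

lemma Runs.setVal {w : ℕ} {s : State} {d : ℕ} {e : Ex} {Q : State → ℕ → Prop} {v : ℤ}
    (h : e.Val w s v) (hr : |v| < 2 ^ w) (hQ : Q (s.setReg d v) (e.cost + 2)) :
    Runs w (WordRAM.assign d e) s Q := Runs.set v h hr hQ

/-- Registers below `k` and arrays below `a` are the same. -/
structure Same (k a : ℕ) (st st' : State) : Prop where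
  reg : ∀ r < k, st'.reg r = st.reg r
  mem : ∀ b < a, st'.mem b = st.mem b

lemma Same.refl (k a : ℕ) (st : State) : Same k a st st := ⟨fun _ _ => rfl, fun _ _ => rfl⟩

lemma Same.trans {k a : ℕ} {s₁ s₂ s₃ : State} (h : Same k a s₁ s₂) (h' : Same k a s₂ s₃) :
    Same k a s₁ s₃ :=
  ⟨fun r hr => (h'.reg r hr).trans (h.reg r hr), fun b hb => (h'.mem b hb).trans (h.mem b hb)⟩

lemma Same.weaken {k a k' a' : ℕ} {s₁ s₂ : State} (h : Same k a s₁ s₂) (hk : k' ≤ k) (ha : a' ≤ a) :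
    Same k' a' s₁ s₂ :=
  ⟨fun r hr => h.reg r (by omega), fun b hb => h.mem b (by omega)⟩

lemma Same.setReg {k a d : ℕ} {s₁ s₂ : State} (h : Same k a s₁ s₂) (hd : k ≤ d) (v : ℤ) :
    Same k a s₁ (s₂.setReg d v) :=
  ⟨fun r hr => by rw [State.setReg_reg_ne _ _ (by omega), h.reg r hr], h.mem⟩

lemma Same.setArr {k a d : ℕ} {s₁ s₂ : State} (h : Same k a s₁ s₂) (hd : a ≤ d) (f : ℤ → ℤ) :
    Same k a s₁ (s₂.setArr d f) :=
  ⟨h.reg, fun b hb => by rw [State.setArr_mem_ne _ _ (by omega), h.mem b hb]⟩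

lemma Same.setMem {k a d : ℕ} {s₁ s₂ : State} (h : Same k a s₁ s₂) (hd : a ≤ d) (z v : ℤ) :
    Same k a s₁ (s₂.setMem d z v) :=
  ⟨h.reg, fun b hb => by rw [State.setMem_mem_ne _ _ _ (by omega), h.mem b hb]⟩

/-- The storage for calls of a program: `cnt` of `M` calls have been made, and `m` bounds the
registers used. -/
structure Pool (M m cnt : ℕ) (st : State) : Prop where
  mul : st.reg 40 = M
  off : st.reg 41 = cnt
  reg : ∀ r, m ≤ r → st.reg (breg r) = 0
  mem : ∀ a (y : ℤ), cnt ≤ y % M → st.mem (20 + a) y = 0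

lemma Pool.setReg {M m cnt d : ℕ} {st : State} (h : Pool M m cnt st) (hd : d < 40) (v : ℤ) :
    Pool M m cnt (st.setReg d v) :=
  ⟨by rw [State.setReg_reg_ne _ _ (by omega), h.mul],
    by rw [State.setReg_reg_ne _ _ (by omega), h.off],
    fun r hr => by rw [State.setReg_reg_ne _ _ (by unfold breg; omega), h.reg r hr], h.mem⟩

lemma Pool.setArr {M m cnt d : ℕ} {st : State} (h : Pool M m cnt st) (hd : d < 20) (f : ℤ → ℤ) :
    Pool M m cnt (st.setArr d f) :=
  ⟨h.mul, h.off, h.reg, fun a y hy => by rw [State.setArr_mem_ne _ _ (by omega), h.mem a y hy]⟩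

lemma Pool.setMem {M m cnt d : ℕ} {st : State} (h : Pool M m cnt st) (hd : d < 20) (z v : ℤ) :
    Pool M m cnt (st.setMem d z v) :=
  ⟨h.mul, h.off, h.reg, fun a y hy => by rw [State.setMem_mem_ne _ _ _ (by omega), h.mem a y hy]⟩

end WordRAM

/-! ### Parameters, and the triangle weights of a block -/

namespace MinPlus

open Ex

/-- The quantities that occur in the reduction of all-pairs shortest paths to minimum-weight
triangle for the program `p`. -/
structure Params (c : ℕ) (p : Prog) where
  -- `s` is the size of a part, and `s * s * s = 2 ^ R` the padded number of vertices; `V` is the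
  -- threshold for finite distances and `2 ^ e` the range of the binary search. `w` and `w₀` are the
  -- outer and inner word lengths, `m` bounds the registers that `p` writes, `t₀` its time per call,
  -- and `b` the values it handles.
  (n s R V e w w₀ m t₀ b : ℕ)
  n_pos : 0 < n
  s_pos : 0 < s
  n_le : n ≤ s * s * s
  pow_R : 2 ^ R = s * s * s
  V_ge : s * s * s ≤ V
  pow_e : 2 ^ e = 16 * (s * s * s) * V
  U_le : 2 * 2 ^ e ≤ (s + 1) ^ c
  two_le_m : 2 ≤ m
  b_ge : 2 * 2 ^ e ≤ b
  b_ge' : 2 ^ w₀ ≤ b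
  w_le : w₀ ≤ w
  b_le : (b + 1) * (4 * (s * s * s) * 2 ^ e * (s * s * s * (s * s * s))) < 2 ^ w
  reg_bound : ∀ w s s' t, Exec w p s s' t → ∀ r, m ≤ r → s'.reg r = s.reg r
  solves : ∀ x : TriInstance c, x.s = s → ∃ s₁ t, Exec w₀ p ((MinTri c).input x) s₁ t ∧ t ≤ t₀ ∧
    (MinTri c).correct x s₁

namespace Params

variable {c : ℕ} {p : Prog} (P : Params c p)

def N : ℕ := P.s * P.s * P.s
def E : ℕ := 2 ^ P.e
-- The stride of the relocated memory, a generous bound for the total number of calls. Being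
-- wasteful is free: time is charged per access whatever the address, and the address needs only
-- `O(log n)` bits.
def M : ℕ := 4 * P.N * P.E * (P.N * P.N)

lemma N_pos : 0 < P.N := by have := P.s_pos; unfold N; positivity

lemma E_pos : 0 < P.E := by unfold E; positivity

lemma E_eq : P.E = 16 * P.N * P.V := P.pow_e

lemma N_le_V : P.N ≤ P.V := P.V_ge

lemma s_le_ss : P.s ≤ P.s * P.s := Nat.le_mul_self _

lemma ss_le_N : P.s * P.s ≤ P.N := Nat.le_mul_of_pos_right _ P.s_pos

lemma N_le_NN : P.N ≤ P.N * P.N := Nat.le_mul_self _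

lemma NN_le_E : 16 * (P.N * P.N) ≤ P.E := by
  rw [E_eq]
  have := Nat.mul_le_mul_left (16 * P.N) P.N_le_V
  linarith

lemma E_le_M : 4 * P.E ≤ P.M := by
  have h := P.N_pos
  unfold M
  calc 4 * P.E = 4 * 1 * P.E * (1 * 1) := by ring
    _ ≤ _ := by gcongr <;> omega

lemma two_E_le_b : 2 * P.E ≤ P.b := P.b_ge

lemma b_lt : P.b * P.M + P.M < 2 ^ P.w := by
  have := P.b_le
  calc P.b * P.M + P.M = (P.b + 1) * P.M := by ring
    _ < _ := this

lemma abs_lt_of_le {x : ℤ} (h : |x| ≤ 3 * P.M) : |x| < 2 ^ P.w := by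
  have h1 : (P.b : ℤ) * P.M + P.M < 2 ^ P.w := by exact_mod_cast P.b_lt
  have h2 : 3 ≤ P.b := by have := P.two_E_le_b; have := P.NN_le_E; have := P.N_le_NN; have := P.N_pos; omega
  have h3 : (3 : ℤ) * P.M ≤ P.b * P.M :=
    mul_le_mul_of_nonneg_right (by exact_mod_cast h2) (by positivity)
  have h4 : (0 : ℤ) ≤ P.M := by positivity
  omega

lemma natCast_lt {x : ℕ} (h : x ≤ 3 * P.M) : |(x : ℤ)| < 2 ^ P.w := by
  apply P.abs_lt_of_le
  rw [abs_of_nonneg (by positivity)]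
  exact_mod_cast h

lemma w_pos : 0 < P.w := by
  rcases Nat.eq_zero_or_pos P.w with h | h
  · have := P.b_lt
    have := P.E_le_M
    have := P.E_pos
    rw [h, pow_zero] at *
    omega
  · exact h

lemma NN_le_M : P.N * P.N ≤ P.M := by
  have := P.NN_le_E
  have := P.E_le_M
  omega

end Params

/-- The registers that hold the parameters. -/
structure Consts {c : ℕ} {p : Prog} (P : Params c p) (st : State) : Prop where
  r0 : st.reg 0 = P.n
  r1 : st.reg 1 = P.s
  r2 : st.reg 2 = P.N
  r3 : st.reg 3 = (P.N * P.N : ℕ)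
  r4 : st.reg 4 = (P.s * P.s : ℕ)
  r5 : st.reg 5 = P.R
  r6 : st.reg 6 = P.V
  r7 : st.reg 7 = (4 * P.V : ℕ)
  r8 : st.reg 8 = P.E
  r9 : st.reg 9 = (2 * P.E : ℕ)
  r10 : st.reg 10 = (P.n * P.n : ℕ)

variable {c : ℕ} {p : Prog} {P : Params c p}

lemma Consts.same {st st' : State} (h : Consts P st) {k a : ℕ} (hs : Same k a st st')
    (hk : 11 ≤ k) : Consts P st' :=
  ⟨by rw [hs.reg _ (by omega), h.r0], by rw [hs.reg _ (by omega), h.r1],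
    by rw [hs.reg _ (by omega), h.r2], by rw [hs.reg _ (by omega), h.r3],
    by rw [hs.reg _ (by omega), h.r4], by rw [hs.reg _ (by omega), h.r5],
    by rw [hs.reg _ (by omega), h.r6], by rw [hs.reg _ (by omega), h.r7],
    by rw [hs.reg _ (by omega), h.r8], by rw [hs.reg _ (by omega), h.r9],
    by rw [hs.reg _ (by omega), h.r10]⟩

lemma cell_lt_mul {a b N : ℕ} (ha : a < N) (hb : b < N) : a * N + b < N * N := by nlinarith

/-- The expression for the cell of a matrix entry. -/
lemma val_cell {st : State} (h : Consts P st) {a b : Ex} {i j : ℕ} (ha : a.Val P.w st i)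
    (hb : b.Val P.w st j) (hi : i < P.N) (hj : j < P.N) :
    (a * var 2 + b).Val P.w st (i * P.N + j) := by
  have h1 := cell_lt_mul hi hj
  have h2 := P.NN_le_M
  refine (ha.mul (Val.var (by decide) h.r2) ?_).add hb ?_
  · exact_mod_cast P.natCast_lt (x := i * P.N) (by omega)
  · exact_mod_cast P.natCast_lt (x := i * P.N + j) (by omega)

/-- The registers and arrays from which the triangle instance for a block is computed. -/
structure Block (P : Params c p) (I J K : ℕ) (D T : ℤ → ℤ) (st : State) : Prop where
  consts : Consts P st
  r20 : st.reg 20 = (I * P.s : ℕ)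
  r21 : st.reg 21 = (J * P.s : ℕ)
  r22 : st.reg 22 = (K * P.s : ℕ)
  mD : st.mem 4 = D
  mT : st.mem 6 = T

lemma off_lt {s N I a : ℕ} (hN : N = s * s * s) (hI : I < s * s) (ha : a < s) : I * s + a < N := by
  have : (I + 1) * s ≤ s * s * s := Nat.mul_le_mul_right s hI
  rw [hN]; linarith

lemma val_offset {st : State} (h : Consts P st) {k I r : ℕ} (hk : k < P.s * P.s)
    (hI : I < P.s * P.s) (hr : ¬ IsTemp r) (hrI : st.reg r = (I * P.s : ℕ))
    (h18 : st.reg 18 = k) :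
    (var r + var 18 / var 1).Val P.w st (I * P.s + k / P.s : ℕ) ∧
      (var r + var 18 % var 1).Val P.w st (I * P.s + k % P.s : ℕ) ∧
      I * P.s + k / P.s < P.N ∧ I * P.s + k % P.s < P.N := by
  have h1 := off_lt (N := P.N) rfl hI (Nat.div_lt_of_lt_mul hk)
  have h2 := off_lt (N := P.N) rfl hI (Nat.mod_lt k P.s_pos)
  have h3 := P.NN_le_M
  have h4 := P.N_le_NN
  have v18 : (var 18).Val P.w st k := Val.var (by decide) h18
  have v1 : (var 1).Val P.w st P.s := Val.var (by decide) h.r1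
  refine ⟨?_, ?_, h1, h2⟩
  · push_cast
    have := (Val.var (w := P.w) hr hrI).add (v18.div v1 ?_) ?_
    · exact_mod_cast this
    · exact_mod_cast P.natCast_lt (x := k / P.s) (by omega)
    · exact_mod_cast P.natCast_lt (x := I * P.s + k / P.s) (by omega)
  · push_cast
    have := (Val.var (w := P.w) hr hrI).add (v18.mod v1 ?_) ?_
    · exact_mod_cast this
    · exact_mod_cast P.natCast_lt (x := k % P.s) (by omega)
    · exact_mod_cast P.natCast_lt (x := I * P.s + k % P.s) (by omega)

/-- The weights of the triangle instance for a block. -/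
def blockA (s N I J : ℕ) (T : ℤ → ℤ) (z : ℤ) : ℤ :=
  0 - T ((I * s + z / s) * N + (J * s + z % s))
def blockB (s N I K : ℕ) (D : ℤ → ℤ) (z : ℤ) : ℤ :=
  D ((I * s + z / s) * N + (K * s + z % s))
-- Cell `(b, d)` of the third weight matrix stands for a pair `(j, k)`, whereas the sum needs the
-- entry at `(k, j)`; hence quotient and remainder appear in exchanged positions.
def blockC (s N J K : ℕ) (D : ℤ → ℤ) (z : ℤ) : ℤ :=
  D ((K * s + z % s) * N + (J * s + z / s))

def exA : Ex := lit 0 - get 6 ((var 20 + var 18 / var 1) * var 2 + (var 21 + var 18 % var 1))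
def exB : Ex := get 4 ((var 20 + var 18 / var 1) * var 2 + (var 22 + var 18 % var 1))
def exC : Ex := get 4 ((var 22 + var 18 % var 1) * var 2 + (var 21 + var 18 / var 1))

lemma val_block {st : State} {I J K : ℕ} {D T : ℤ → ℤ} (h : Block P I J K D T st)
    (hI : I < P.s * P.s) (hJ : J < P.s * P.s) (hK : K < P.s * P.s)
    (hT : ∀ i < P.N, ∀ j < P.N, |T (i * P.N + j)| ≤ 2 * P.E)
    {k : ℕ} (hk : k < P.s * P.s) (h18 : st.reg 18 = k) :
    exA.Val P.w st (blockA P.s P.N I J T k) ∧ exB.Val P.w st (blockB P.s P.N I K D k) ∧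
      exC.Val P.w st (blockC P.s P.N J K D k) := by
  obtain ⟨a1, a2, a3, a4⟩ := val_offset h.consts hk hI (by decide) h.r20 h18
  obtain ⟨b1, b2, b3, b4⟩ := val_offset h.consts hk hJ (by decide) h.r21 h18
  obtain ⟨c1, c2, c3, c4⟩ := val_offset h.consts hk hK (by decide) h.r22 h18
  have hM : (4 * P.E : ℤ) ≤ P.M := by exact_mod_cast P.E_le_M
  have e1 := (val_cell h.consts a1 b2 a3 b4).get (arr := 6)
  have e2 := (val_cell h.consts a1 c2 a3 c4).get (arr := 4)
  have e3 := (val_cell h.consts c2 b1 c4 b3).get (arr := 4)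
  have l0 : (lit 0).Val P.w st 0 := Val.lit (by simp)
  rw [h.mT] at e1
  rw [h.mD] at e2 e3
  have hT' := hT _ a3 _ b4
  have e1' := l0.sub e1 (P.abs_lt_of_le (by rw [zero_sub, abs_neg]; linarith))
  push_cast at e1' e2 e3
  exact ⟨e1', e2, e3⟩

end MinPlus

/-! ### The storage of a single call -/

namespace WordRAM

/-- The storage of call number `cnt`, whose arrays are given by the list `vals`. -/
structure Slot (M m cnt : ℕ) (vals : List (ℤ → ℤ)) (st : State) : Prop where
  mul : st.reg 40 = M
  off : st.reg 41 = cnt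
  reg : ∀ r, m ≤ r → st.reg (breg r) = 0
  mem : ∀ a (y : ℤ), cnt + 1 ≤ y % M → st.mem (20 + a) y = 0
  arr : ∀ a (z : ℤ), st.mem (20 + a) (z * M + cnt) = vals.getD a (fun _ => 0) z

lemma emod_address {M cnt : ℕ} (h : cnt < M) (z : ℤ) : (z * M + cnt) % M = cnt := by
  rw [add_comm, Int.add_mul_emod_self_right, Int.emod_eq_of_lt (by positivity) (by exact_mod_cast h)]

lemma Pool.slot {M m cnt : ℕ} {st : State} (h : Pool M m cnt st) (hc : cnt < M) :
    Slot M m cnt [] st :=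
  ⟨h.mul, h.off, h.reg, fun a y hy => h.mem a y (by omega),
    fun a z => by rw [h.mem a _ (emod_address hc z).ge]; simp⟩

lemma Slot.setReg {M m cnt d : ℕ} {vals : List (ℤ → ℤ)} {st : State} (h : Slot M m cnt vals st)
    (hd : d < 40) (v : ℤ) : Slot M m cnt vals (st.setReg d v) :=
  ⟨by rw [State.setReg_reg_ne _ _ (by omega), h.mul],
    by rw [State.setReg_reg_ne _ _ (by omega), h.off],
    fun r hr => by rw [State.setReg_reg_ne _ _ (by unfold breg; omega), h.reg r hr], h.mem, h.arr⟩

lemma Slot.fill {M m cnt k : ℕ} {vals : List (ℤ → ℤ)} {st : State} (h : Slot M m cnt vals st)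
    (hc : cnt < M) (f : ℤ → ℤ) :
    Slot M m cnt (vals ++ [tab k f fun _ => 0])
      (st.setArr (20 + vals.length) (rtab M cnt k f (st.mem (20 + vals.length)))) := by
  refine ⟨h.mul, h.off, h.reg, fun a y hy => ?_, fun a z => ?_⟩
  · rw [State.setArr_mem]
    split_ifs with ha
    · rw [rtab_ne _ _ _ (by omega), h.mem _ _ hy]
    · exact h.mem a y hy
  · rw [State.setArr_mem]
    split_ifs with ha
    · obtain rfl : a = vals.length := by omega
      rw [rtab_apply (by positivity) (by exact_mod_cast hc)]
      have := h.arr vals.length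
      simp only [List.getD_eq_getElem?_getD, List.getElem?_concat_length, Option.getD_some]
      simp only [List.getD_eq_default _ _ le_rfl] at this
      simp only [this]
    · rw [h.arr]
      rcases Nat.lt_or_gt_of_ne (show a ≠ vals.length by omega) with h' | h'
      · simp only [List.getD_eq_getElem?_getD, List.getElem?_append_left h']
      · rw [List.getD_eq_default _ _ (by omega), List.getD_eq_default _ _ (by simp; omega)]

lemma abs_tab_le {m : ℕ} {f : ℤ → ℤ} {X : ℤ} (hX : 0 ≤ X) (h : ∀ k : ℕ, k < m → |f k| ≤ X) (z : ℤ) :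
    |tab m f (fun _ => 0) z| ≤ X := by
  unfold tab
  split_ifs with hz
  · obtain ⟨k, rfl⟩ := Int.eq_ofNat_of_zero_le hz.1
    exact h k (by exact_mod_cast hz.2)
  · simpa using hX

end WordRAM

namespace MinPlus

open Ex

variable {c : ℕ} {p : Prog} {P : Params c p}

lemma Block.same {I J K : ℕ} {D T : ℤ → ℤ} {st st' : State} (h : Block P I J K D T st)
    (hs : Same 18 20 st st') (h20 : st'.reg 20 = st.reg 20) (h21 : st'.reg 21 = st.reg 21)
    (h22 : st'.reg 22 = st.reg 22) : Block P I J K D T st' :=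
  ⟨h.consts.same hs (by omega), h20.trans h.r20, h21.trans h.r21, h22.trans h.r22,
    by rw [hs.mem 4 (by omega), h.mD], by rw [hs.mem 6 (by omega), h.mT]⟩

lemma rfill_block {I J K cnt : ℕ} {D T : ℤ → ℤ} {vals : List (ℤ → ℤ)} {st : State}
    (h : Block P I J K D T st) (hS : Slot P.M P.m cnt vals st) (hc : cnt < P.M)
    {e : Ex} {f : ℤ → ℤ}
    (he : ∀ st', Block P I J K D T st' → ∀ k : ℕ, k < P.s * P.s → st'.reg 18 = k → e.Val P.w st' (f k))
    {Q : State → ℕ → Prop}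
    (hQ : ∀ st', Block P I J K D T st' → Slot P.M P.m cnt (vals ++ [tab (P.s * P.s) f fun _ => 0]) st' →
      Same 18 20 st st' → Q st' ((e.cost + 17) * (P.s * P.s) + 9)) :
    Runs P.w (rfill vals.length 18 4 e) st Q := by
  have hM := P.N_le_NN
  have hM2 := P.NN_le_M
  have hM3 := P.ss_le_N
  have hM4 := P.NN_le_E
  have hM5 := P.two_E_le_b
  refine Runs.rfill (N := P.M) (i := cnt) f (P.s * P.s) P.w_pos ?_ (by positivity)
    (by exact_mod_cast hc) ?_ (by decide) (by decide) (by omega) (by omega) (by omega)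
    h.consts.r4 hS.mul hS.off ?_ ?_
  · have := P.natCast_lt (x := P.s * P.s) (by omega)
    rwa [abs_of_nonneg (by positivity)] at this
  · have h1 : P.s * P.s * P.M + P.M ≤ P.b * P.M + P.M := by gcongr; omega
    exact_mod_cast h1.trans_lt P.b_lt
  · rintro k hk st' rfl
    refine he _ (h.same ?_ ?_ ?_ ?_) k hk (State.setReg_reg_same _ _ _)
    · exact ((Same.refl _ _ st).setArr (by omega) _).setReg le_rfl _
    all_goals rw [State.setReg_reg_ne _ _ (by omega)]; rfl
  · refine hQ _ (h.same ?_ ?_ ?_ ?_) ((hS.fill hc f).setReg (by omega) _) ?_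
    · exact ((Same.refl _ _ st).setArr (by omega) _).setReg le_rfl _
    · rw [State.setReg_reg_ne _ _ (by omega)]; rfl
    · rw [State.setReg_reg_ne _ _ (by omega)]; rfl
    · rw [State.setReg_reg_ne _ _ (by omega)]; rfl
    · exact ((Same.refl _ _ st).setArr (by omega) _).setReg le_rfl _

lemma block_cell_lt {s N I J k : ℕ} (hs : 0 < s) (hN : N = s * s * s) (hI : I < s * s) (hJ : J < s * s)
    (hk : k < s * s) :
    (I * s + k / s < N ∧ J * s + k % s < N) :=
  ⟨off_lt hN hI (Nat.div_lt_of_lt_mul hk), off_lt hN hJ (Nat.mod_lt k hs)⟩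

/-- The triangle instance for a block. -/
def blockInst (P : Params c p) {I J K : ℕ} {D T : ℤ → ℤ} (hI : I < P.s * P.s) (hJ : J < P.s * P.s)
    (hK : K < P.s * P.s) (hD : ∀ i < P.N, ∀ j < P.N, |D (i * P.N + j)| ≤ 2 * P.E)
    (hT : ∀ i < P.N, ∀ j < P.N, |T (i * P.N + j)| ≤ 2 * P.E) : TriInstance c where
  s := P.s
  s_pos := P.s_pos
  U := 2 * P.E
  U_le := P.U_le
  -- The bounds in `TriInstance` concern all integer arguments, so the weights are cut off outside
  -- the block.
  A := tab (P.s * P.s) (blockA P.s P.N I J T) fun _ => 0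
  B := tab (P.s * P.s) (blockB P.s P.N I K D) fun _ => 0
  C := tab (P.s * P.s) (blockC P.s P.N J K D) fun _ => 0
  A_le := abs_tab_le (by positivity) fun k hk => by
    obtain ⟨h1, h2⟩ := block_cell_lt P.s_pos rfl hI hJ hk
    have := hT _ h1 _ h2
    push_cast at this ⊢
    rwa [blockA, zero_sub, abs_neg]
  B_le := abs_tab_le (by positivity) fun k hk => by
    obtain ⟨h1, h2⟩ := block_cell_lt P.s_pos rfl hI hK hk
    have := hD _ h1 _ h2
    push_cast at this ⊢
    exact this
  C_le := abs_tab_le (by positivity) fun k hk => by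
    obtain ⟨h1, -⟩ := block_cell_lt P.s_pos rfl hJ hK hk
    obtain ⟨-, h2⟩ := block_cell_lt P.s_pos rfl hJ hK hk
    have := hD _ h2 _ h1
    push_cast at this ⊢
    exact this

lemma tab_tab (m : ℕ) (f g : ℤ → ℤ) : tab m (tab m f g) g = tab m f g := by
  funext z
  unfold tab
  split_ifs <;> rfl

lemma tab_cell {s a b : ℕ} (f : ℤ → ℤ) (ha : a < s) (hb : b < s) :
    tab (s * s) f (fun _ => 0) (a * s + b) = f (a * s + b) :=
  tab_of_lt (by positivity) (by exact_mod_cast cell_lt_mul ha hb)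

/-- The sum that a triangle of the instance for a block stands for. -/
lemma triWeight_block {s N I J K a b d : ℕ} {D T : ℤ → ℤ} (ha : a < s) (hb : b < s) (hd : d < s) :
    triWeight s (tab (s * s) (blockA s N I J T) fun _ => 0) (tab (s * s) (blockB s N I K D) fun _ => 0)
      (tab (s * s) (blockC s N J K D) fun _ => 0) a b d =
    D ((I * s + a : ℕ) * N + (K * s + d : ℕ)) + D ((K * s + d : ℕ) * N + (J * s + b : ℕ)) -
      T ((I * s + a : ℕ) * N + (J * s + b : ℕ)) := by
  have hs : (0 : ℤ) < s := by exact_mod_cast (by omega : 0 < s)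
  have hdiv : ∀ x y : ℕ, x < s → y < s →
      ((x : ℤ) * s + y) / s = x ∧ ((x : ℤ) * s + y) % s = y := fun x y hx hy =>
    ⟨TriCover.cell_div hs (by positivity) (by exact_mod_cast hx) (by positivity)
      (by exact_mod_cast hy), TriCover.cell_mod hs (by positivity) (by exact_mod_cast hx)
      (by positivity) (by exact_mod_cast hy)⟩
  rw [triWeight, tab_cell _ ha hb, tab_cell _ ha hd, tab_cell _ hb hd, blockA, blockB, blockC]
  simp only [(hdiv a b ha hb).1, (hdiv a b ha hb).2, (hdiv a d ha hd).1, (hdiv a d ha hd).2,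
    (hdiv b d hb hd).1, (hdiv b d hb hd).2]
  push_cast
  ring

/-- Solve the triangle instance for the block number `reg 17` with the program `p`. -/
def call (p : Prog) (m : ℕ) : Prog :=
  .seq (assign 20 (var 17 / var 4 / var 4 * var 1)) <|
  .seq (assign 21 (var 17 / var 4 % var 4 * var 1)) <|
  .seq (assign 22 (var 17 % var 4 * var 1)) <|
  .seq (rfill 0 18 4 exA) <| .seq (rfill 1 18 4 exB) <| .seq (rfill 2 18 4 exC) <|
  .seq (clearRegs m) <| .seq (assign (breg 0) (var 1)) <| .seq (assign (breg 1) (var 9)) <|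
  .seq (reloc p) <| .seq (assign 23 (var 20 + get 23 (var 41))) <|
  .seq (assign 24 (var 21 + get 23 (var 40 + var 41))) <|
  .seq (assign 25 (var 22 + get 23 (lit 2 * var 40 + var 41))) (assign 41 (var 41 + lit 1))

lemma bounded_blockInst {I J K : ℕ} {D T : ℤ → ℤ} (hI : I < P.s * P.s) (hJ : J < P.s * P.s)
    (hK : K < P.s * P.s) (hD : ∀ i < P.N, ∀ j < P.N, |D (i * P.N + j)| ≤ 2 * P.E)
    (hT : ∀ i < P.N, ∀ j < P.N, |T (i * P.N + j)| ≤ 2 * P.E) :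
    ((MinTri c).input (blockInst P hI hJ hK hD hT)).Bounded P.b := by
  have h1 := P.two_E_le_b
  have h2 := P.NN_le_E
  have h3 := P.N_le_NN
  have h4 := P.ss_le_N
  have h5 := P.s_le_ss
  have hU : ((2 * P.E : ℕ) : ℤ) ≤ P.b := by exact_mod_cast h1
  have hs : (P.s : ℤ) ≤ P.b := by exact_mod_cast (by omega : P.s ≤ P.b)
  set x := blockInst P hI hJ hK hD hT
  refine ⟨fun r => ?_, fun a z => ?_⟩
  · rcases r with _ | _ | r
    · change |(P.s : ℤ)| ≤ P.b
      rwa [abs_of_nonneg (by positivity)]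
    · change |((2 * P.E : ℕ) : ℤ)| ≤ P.b
      rwa [abs_of_nonneg (by positivity)]
    · change |(0 : ℤ)| ≤ _
      simp
  · have hx : ((x.U : ℕ) : ℤ) ≤ P.b := hU
    rcases a with _ | _ | _ | a
    · exact (abs_tab_le (by positivity) (fun k _ => x.A_le k) z).trans hx
    · exact (abs_tab_le (by positivity) (fun k _ => x.B_le k) z).trans hx
    · exact (abs_tab_le (by positivity) (fun k _ => x.C_le k) z).trans hx
    · change |(0 : ℤ)| ≤ _
      simp

end MinPlus

/-! ### Correctness of a call -/

namespace MinPlus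

open Ex

variable {c : ℕ} {p : Prog} {P : Params c p}

lemma val_block_index {st : State} (h : Consts P st) {q : ℕ} (hq : q < P.N * P.N)
    (h17 : st.reg 17 = q) :
    (var 17 / var 4 / var 4 * var 1).Val P.w st (q / (P.s * P.s) / (P.s * P.s) * P.s : ℕ) ∧
    (var 17 / var 4 % var 4 * var 1).Val P.w st (q / (P.s * P.s) % (P.s * P.s) * P.s : ℕ) ∧
    (var 17 % var 4 * var 1).Val P.w st (q % (P.s * P.s) * P.s : ℕ) ∧
    q / (P.s * P.s) / (P.s * P.s) < P.s * P.s ∧ q / (P.s * P.s) % (P.s * P.s) < P.s * P.s ∧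
    q % (P.s * P.s) < P.s * P.s := by
  have hs := P.s_pos
  have hss : 0 < P.s * P.s := by positivity
  have hlt : ∀ i, i < P.s * P.s → i * P.s < P.N := fun i hi => by
    have := off_lt (N := P.N) rfl hi hs
    omega
  have h1 : q / (P.s * P.s) / (P.s * P.s) < P.s * P.s := by
    rw [Nat.div_div_eq_div_mul]
    refine Nat.div_lt_of_lt_mul (hq.trans_eq ?_)
    rw [Params.N]; ring
  have h2 := Nat.mod_lt (q / (P.s * P.s)) hss
  have h3 := Nat.mod_lt q hss
  have h4 := P.NN_le_M
  have h5 := P.N_le_NN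
  have h6 := P.ss_le_N
  have h7 := Nat.div_le_self q (P.s * P.s)
  have v17 : (var 17).Val P.w st q := Val.var (by decide) h17
  have v4 : (var 4).Val P.w st (P.s * P.s : ℕ) := Val.var (by decide) h.r4
  have v1 : (var 1).Val P.w st P.s := Val.var (by decide) h.r1
  have vd := v17.div v4 (by exact_mod_cast P.natCast_lt (x := q / (P.s * P.s)) (by omega))
  have vdd := vd.div v4
    (by exact_mod_cast P.natCast_lt (x := q / (P.s * P.s) / (P.s * P.s)) (by omega))
  have vdm := vd.mod v4
    (by exact_mod_cast P.natCast_lt (x := q / (P.s * P.s) % (P.s * P.s)) (by omega))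
  have vm := v17.mod v4 (by exact_mod_cast P.natCast_lt (x := q % (P.s * P.s)) (by omega))
  refine ⟨?_, ?_, ?_, h1, h2, h3⟩
  · have := hlt _ h1
    exact_mod_cast vdd.mul v1 (by
      exact_mod_cast P.natCast_lt (x := q / (P.s * P.s) / (P.s * P.s) * P.s) (by omega))
  · have := hlt _ h2
    exact_mod_cast vdm.mul v1 (by
      exact_mod_cast P.natCast_lt (x := q / (P.s * P.s) % (P.s * P.s) * P.s) (by omega))
  · have := hlt _ h3
    exact_mod_cast vm.mul v1 (by
      exact_mod_cast P.natCast_lt (x := q % (P.s * P.s) * P.s) (by omega))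

/-- The triple `(i, j, k)` belongs to block number `q`. -/
def InBlock (s q i j k : ℕ) : Prop :=
  i / s = q / (s * s) / (s * s) ∧ j / s = q / (s * s) % (s * s) ∧ k / s = q % (s * s)

/-- By `triWeight_block`, a minimum triangle is a triple of the block that minimizes `D i k + D k j
- T i j`. The call uses up the residue class `cnt` of memory; the result, relative to the block, is
shifted by the offsets in registers 20 to 22. -/
lemma call_runs {st : State} {cnt q : ℕ} (hC : Consts P st) (hP : Pool P.M P.m cnt st)
    (hcnt : cnt + 1 ≤ P.M) (hq : q < P.N * P.N) (h17 : st.reg 17 = q)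
    (hD : ∀ i < P.N, ∀ j < P.N, |st.mem 4 (i * P.N + j)| ≤ 2 * P.E)
    (hT : ∀ i < P.N, ∀ j < P.N, |st.mem 6 (i * P.N + j)| ≤ 2 * P.E) {Q : State → ℕ → Prop}
    (hQ : ∀ (st' : State) (T i j k : ℕ), Same 18 20 st st' → Pool P.M P.m (cnt + 1) st' →
      st'.reg 23 = i → st'.reg 24 = j → st'.reg 25 = k → i < P.N → j < P.N → k < P.N →
      (∀ i' < P.N, ∀ j' < P.N, ∀ k' < P.N, InBlock P.s q i' j' k' →
        st.mem 4 (i * P.N + k) + st.mem 4 (k * P.N + j) - st.mem 6 (i * P.N + j) ≤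
        st.mem 4 (i' * P.N + k') + st.mem 4 (k' * P.N + j') - st.mem 6 (i' * P.N + j')) →
      T ≤ 3 * P.t₀ + 200 * (P.s * P.s) + P.m + 200 → Q st' T) :
    Runs P.w (call p P.m) st Q := by
  obtain ⟨v1, v2, v3, hI, hJ, hK⟩ := val_block_index hC hq h17
  obtain ⟨I, eI⟩ : ∃ I, q / (P.s * P.s) / (P.s * P.s) = I := ⟨_, rfl⟩
  obtain ⟨J, eJ⟩ : ∃ J, q / (P.s * P.s) % (P.s * P.s) = J := ⟨_, rfl⟩
  obtain ⟨K, eK⟩ : ∃ K, q % (P.s * P.s) = K := ⟨_, rfl⟩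
  simp only [eI, eJ, eK, InBlock] at v1 v2 v3 hI hJ hK hQ
  have hMpos : 0 < P.M := by omega
  have hc : cnt < P.M := by omega
  have hs := P.s_pos
  have hlt : ∀ i, i < P.s * P.s → i * P.s < P.N := fun i hi => by
    have := off_lt (N := P.N) rfl hi hs
    omega
  have h4 := P.NN_le_M
  have h5 := P.N_le_NN
  have h6 := P.ss_le_N
  have h7 := P.s_le_ss
  have h8 := P.E_le_M
  have hwt : ∀ (d : ℕ) (s : State) (r : ℕ) (v : ℤ), r < 100 → 100 ≤ d →
      (s.setReg d v).reg r = s.reg r := fun d s r v hr hd => State.setReg_reg_ne _ _ (by omega)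
  unfold call
  refine Runs.seq (Runs.setVal v1 (P.natCast_lt (by have := hlt _ hI; omega)) ?_)
  have s1 : Same 18 20 st (st.setReg 20 (I * P.s : ℕ)) := (Same.refl _ _ _).setReg (by omega) _
  have p1 := hP.setReg (d := 20) (by omega) (I * P.s : ℕ)
  have r1 : (st.setReg 20 (I * P.s : ℕ)).reg 20 = (I * P.s : ℕ) := State.setReg_reg_same _ _ _
  generalize st.setReg 20 (I * P.s : ℕ) = st1 at *
  obtain ⟨-, v2, v3, -⟩ := val_block_index (hC.same s1 (by omega)) hq
    ((s1.reg 17 (by omega)).trans h17)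
  simp only [eJ, eK] at v2 v3
  refine Runs.seq (Runs.setVal v2 (P.natCast_lt (by have := hlt _ hJ; omega)) ?_)
  have s2 : Same 18 20 st (st1.setReg 21 (J * P.s : ℕ)) := s1.setReg (by omega) _
  have p2 := p1.setReg (d := 21) (by omega) (J * P.s : ℕ)
  have r2 : (st1.setReg 21 (J * P.s : ℕ)).reg 21 = (J * P.s : ℕ) := State.setReg_reg_same _ _ _
  have r1' : (st1.setReg 21 (J * P.s : ℕ)).reg 20 = (I * P.s : ℕ) := by
    rw [State.setReg_reg_ne _ _ (by omega), r1]
  generalize st1.setReg 21 (J * P.s : ℕ) = st2 at *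
  obtain ⟨-, -, v3, -⟩ := val_block_index (hC.same s2 (by omega)) hq
    ((s2.reg 17 (by omega)).trans h17)
  simp only [eK] at v3
  refine Runs.seq (Runs.setVal v3 (P.natCast_lt (by have := hlt _ hK; omega)) ?_)
  have s3 : Same 18 20 st (st2.setReg 22 (K * P.s : ℕ)) := s2.setReg (by omega) _
  have p3 := p2.setReg (d := 22) (by omega) (K * P.s : ℕ)
  have b3 : Block P I J K (st.mem 4) (st.mem 6) (st2.setReg 22 (K * P.s : ℕ)) :=
    ⟨hC.same s3 (by omega), by rw [State.setReg_reg_ne _ _ (by omega), r1'],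
      by rw [State.setReg_reg_ne _ _ (by omega), r2], State.setReg_reg_same _ _ _,
      s3.mem 4 (by omega), s3.mem 6 (by omega)⟩
  generalize st2.setReg 22 (K * P.s : ℕ) = st3 at *
  refine Runs.seq (rfill_block (vals := []) b3 (p3.slot hc) hc
    (fun st' hb k hk h18 => (val_block hb hI hJ hK hT hk h18).1) ?_)
  intro st4 b4 q4 s4
  refine Runs.seq (rfill_block b4 q4 hc
    (fun st' hb k hk h18 => (val_block hb hI hJ hK hT hk h18).2.1) ?_)
  intro st5 b5 q5 s5
  refine Runs.seq (rfill_block b5 q5 hc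
    (fun st' hb k hk h18 => (val_block hb hI hJ hK hT hk h18).2.2) ?_)
  intro st6 b6 q6 s6
  have s6' := ((s3.trans s4).trans s5).trans s6
  clear s4 s5 s6 s3 s2 s1 p1 p2 p3 b3 b4 b5 q4 q5
  -- Memory is fresh, but registers are shared between calls. Those from `m` on are never written by
  -- `p` and are still zero, so clearing a constant number is enough.
  refine Runs.seq (Runs.clearRegs P.m ?_)
  intro st7 m7 g7 z7 k7
  have c7 : Consts P st7 := b6.consts.same (k := 18) (a := 0)
    ⟨fun r hr => g7 r (by omega), fun b hb => by omega⟩ (by omega)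
  refine Runs.seq (Runs.setVal (Val.var (by decide) c7.r1) (P.natCast_lt (by omega)) ?_)
  refine Runs.seq (Runs.setVal (v := (2 * P.E : ℕ)) (Val.var (by decide) ?_)
    (P.natCast_lt (by omega)) ?_)
  · rw [State.setReg_reg_ne _ _ (by unfold breg; omega)]; exact c7.r9
  obtain ⟨s₁, t, hexec, ht, a, b, d, o1, o2, o3, ha, hb, hd, hmin⟩ :=
    P.solves (blockInst P hI hJ hK hD hT) rfl
  change a < P.s at ha
  change b < P.s at hb
  change d < P.s at hd
  refine Runs.seq (Runs.reloc (N := P.M) (i := cnt) (b := P.b) P.w_le (by positivity)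
    (by exact_mod_cast hc) (by exact_mod_cast P.b_ge') (by exact_mod_cast P.b_lt) hexec
    (bounded_blockInst hI hJ hK hD hT) ⟨fun r => ?_, fun a z => ?_, ?_, ?_⟩ ?_)
  · rcases r with _ | _ | r
    · rw [State.setReg_reg_ne _ _ (by unfold breg; omega), State.setReg_reg_same]; rfl
    · rw [State.setReg_reg_same]; rfl
    · rw [State.setReg_reg_ne _ _ (by unfold breg; omega),
        State.setReg_reg_ne _ _ (by unfold breg; omega)]
      change _ = (0 : ℤ)
      rcases Nat.lt_or_ge (r + 2) P.m with h | h
      · exact z7 _ h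
      · rw [k7 _ h, q6.reg _ h]
  · rw [State.setReg_mem, State.setReg_mem, m7, q6.arr]
    simp only [MinTri, State.init, blockInst, tab_tab, List.nil_append, List.cons_append]
  · rw [hwt _ _ _ _ (by omega) (by unfold breg; omega),
      hwt _ _ _ _ (by omega) (by unfold breg; omega), g7 _ (by omega), q6.mul]
  · rw [hwt _ _ _ _ (by omega) (by unfold breg; omega),
      hwt _ _ _ _ (by omega) (by unfold breg; omega), g7 _ (by omega), q6.off]
  intro st8 hH hKp
  have g8 : ∀ r < 100, st8.reg r = st6.reg r := fun r hr => by
    rw [hKp.reg r hr, hwt _ _ _ _ hr (by unfold breg; omega),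
      hwt _ _ _ _ hr (by unfold breg; omega), g7 r hr]
  have s8 : Same 18 20 st st8 := s6'.trans ⟨fun r hr => g8 r (by omega), fun b hb => by
    rw [hKp.arr b hb, State.setReg_mem, State.setReg_mem, m7]⟩
  have z8 : ∀ a (y : ℤ), cnt + 1 ≤ y % P.M → st8.mem (20 + a) y = 0 := fun a y hy => by
    rw [hKp.mem _ _ (by omega), State.setReg_mem, State.setReg_mem, m7, q6.mem a y hy]
  have z8' : ∀ r, P.m ≤ r → st8.reg (breg r) = 0 := fun r hr => by
    rw [hH.reg, P.reg_bound _ _ _ _ hexec r hr]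
    have := P.two_le_m
    exact List.getD_eq_default _ _ (by simp; omega)
  have rd0 := hH.mem 3 0
  have rd1 := hH.mem 3 1
  have rd2 := hH.mem 3 2
  rw [zero_mul, zero_add, o1] at rd0
  rw [one_mul, o2] at rd1
  rw [o3] at rd2
  have e0 := g8 20 (by omega)
  have e1 := g8 21 (by omega)
  have e2 := g8 22 (by omega)
  have f0 := hH.off
  have f1 := hH.mul
  rw [b6.r20] at e0
  rw [b6.r21] at e1
  rw [b6.r22] at e2
  clear hKp hH hexec g8 g7 k7 z7 m7 q6 b6 s6' hP hC
  have ha' := off_lt (N := P.N) rfl hI ha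
  have hb' := off_lt (N := P.N) rfl hJ hb
  have hd' := off_lt (N := P.N) rfl hK hd
  have l41 : ∀ x : ℕ, x ≤ P.N → |(x : ℤ)| < 2 ^ P.w := fun x hx => P.natCast_lt (by omega)
  have b0 : |((I * P.s : ℕ) + a : ℤ)| < 2 ^ P.w := by exact_mod_cast l41 (I * P.s + a) (by omega)
  have b1 : |((J * P.s : ℕ) + b : ℤ)| < 2 ^ P.w := by exact_mod_cast l41 (J * P.s + b) (by omega)
  have b2 : |((K * P.s : ℕ) + d : ℤ)| < 2 ^ P.w := by exact_mod_cast l41 (K * P.s + d) (by omega)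
  have b3 : |(P.M + cnt : ℤ)| < 2 ^ P.w := by exact_mod_cast P.natCast_lt (x := P.M + cnt) (by omega)
  have b4 : |(2 * P.M : ℤ)| < 2 ^ P.w := by exact_mod_cast P.natCast_lt (x := 2 * P.M) (by omega)
  have b5 : |(2 * P.M + cnt : ℤ)| < 2 ^ P.w := by
    exact_mod_cast P.natCast_lt (x := 2 * P.M + cnt) (by omega)
  have b6 : |(cnt + 1 : ℤ)| < 2 ^ P.w := by exact_mod_cast P.natCast_lt (x := cnt + 1) (by omega)
  have b7 : |(2 : ℤ)| < 2 ^ P.w := by exact_mod_cast P.natCast_lt (x := 2) (by omega)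
  have b8 : |(1 : ℤ)| < 2 ^ P.w := by exact_mod_cast P.natCast_lt (x := 1) (by omega)
  have k23 : ∀ x : Ex, ∀ st z, x.Val P.w st z → (get 23 x).Val P.w st (st.mem 23 z) :=
    fun _ _ _ h => h.get
  have v := (Val.var (w := P.w) (by decide) e0).add
    (k23 _ _ _ (Val.var (r := 41) (by decide) f0)) (by rw [rd0]; exact b0)
  rw [rd0] at v
  refine Runs.seq (Runs.setVal v b0 ?_)
  have m1 : (st8.setReg 23 ((I * P.s : ℕ) + a)).mem = st8.mem := rfl
  have e1' : (st8.setReg 23 ((I * P.s : ℕ) + a)).reg 21 = (J * P.s : ℕ) := e1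
  have f0' : (st8.setReg 23 ((I * P.s : ℕ) + a)).reg 41 = cnt := f0
  have f1' : (st8.setReg 23 ((I * P.s : ℕ) + a)).reg 40 = P.M := f1
  have v := (Val.var (w := P.w) (by decide) e1').add
    (k23 _ _ _ ((Val.var (by decide) f1').add (Val.var (by decide) f0') b3))
      (by rw [m1, rd1]; exact b1)
  rw [m1, rd1] at v
  refine Runs.seq (Runs.setVal v b1 ?_)
  clear m1 e1' f0' f1'
  have m1 : ((st8.setReg 23 ((I * P.s : ℕ) + a)).setReg 24 ((J * P.s : ℕ) + b)).mem = st8.mem := rfl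
  have e2' : ((st8.setReg 23 ((I * P.s : ℕ) + a)).setReg 24 ((J * P.s : ℕ) + b)).reg 22 =
    (K * P.s : ℕ) := e2
  have f0' : ((st8.setReg 23 ((I * P.s : ℕ) + a)).setReg 24 ((J * P.s : ℕ) + b)).reg 41 = cnt := f0
  have f1' : ((st8.setReg 23 ((I * P.s : ℕ) + a)).setReg 24 ((J * P.s : ℕ) + b)).reg 40 = P.M := f1
  have v := (Val.var (w := P.w) (by decide) e2').add
    (k23 _ _ _ (((Val.lit b7).mul (Val.var (by decide) f1') b4).add (Val.var (by decide) f0') b5))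
      (by rw [m1, rd2]; exact b2)
  rw [m1, rd2] at v
  refine Runs.seq (Runs.setVal v b2 ?_)
  refine Runs.setVal (v := cnt + 1) ((Val.var (by decide) ?_).add (Val.lit b8) b6) b6 ?_
  · simpa [State.setReg_reg] using f0
  refine hQ _ _ (I * P.s + a) (J * P.s + b) (K * P.s + d)
    ((((s8.setReg (d := 23) (by omega) _).setReg (d := 24) (by omega) _).setReg (d := 25)
      (by omega) _).setReg (d := 41) (by omega) _)
    ⟨?_, ?_, fun r hr => ?_, fun x y hy => ?_⟩ ?_ ?_ ?_ ha' hb' hd' ?_ ?_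
  · simpa [State.setReg_reg] using f1
  · simp
  · simpa [State.setReg_reg, breg, show 101 + 2 * r ≠ 23 by omega, show 101 + 2 * r ≠ 24 by omega,
      show 101 + 2 * r ≠ 25 by omega, show 101 + 2 * r ≠ 41 by omega] using z8' r hr
  · exact z8 x y (by exact_mod_cast hy)
  · simp [State.setReg_reg]
  · simp [State.setReg_reg]
  · simp [State.setReg_reg]
  · rintro i' - j' - k' - ⟨rfl, rfl, rfl⟩
    have h := hmin (i' % P.s) (j' % P.s) (k' % P.s) (Nat.mod_lt _ hs) (Nat.mod_lt _ hs)
      (Nat.mod_lt _ hs)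
    simp only [blockInst] at h
    rw [triWeight_block ha hb hd, triWeight_block (Nat.mod_lt _ hs) (Nat.mod_lt _ hs)
      (Nat.mod_lt _ hs)] at h
    simpa only [Nat.div_add_mod'] using h
  · simp only [exA, exB, exC, cost_var, cost_get, cost_add, cost_sub, cost_mul, cost_div, cost_mod,
      cost_lit]
    omega

end MinPlus
/-! ## Comparing a matrix with a min-plus square -/

namespace MinPlus

open Ex

variable {c : ℕ} {p : Prog} {P : Params c p}

lemma cell_inj {N i j i' j' : ℕ} (hj : j < N) (hj' : j' < N)
    (h : (i : ℤ) * N + j = i' * N + j') : i = i' ∧ j = j' := by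
  have hN : 0 < N := by omega
  have h' : j + N * i = j' + N * i' := by
    have : (j : ℤ) + N * i = j' + N * i' := by linarith
    exact_mod_cast this
  have h1 := congrArg (· % N) h'
  simp only [Nat.add_mul_mod_self_left, Nat.mod_eq_of_lt hj, Nat.mod_eq_of_lt hj'] at h1
  subst h1
  exact ⟨Nat.eq_of_mul_eq_mul_left hN (by omega), rfl⟩

/-- The number of matrix entries different from `v`. -/
def unmarked (N : ℕ) (v : ℤ) (f : ℤ → ℤ) : ℕ :=
  ((Finset.range N ×ˢ Finset.range N).filter fun x => f (x.1 * N + x.2) ≠ v).card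

lemma unmarked_le (N : ℕ) (v : ℤ) (f : ℤ → ℤ) : unmarked N v f ≤ N * N := by
  refine (Finset.card_filter_le _ _).trans ?_
  simp

lemma unmarked_update {N : ℕ} {v : ℤ} {f g : ℤ → ℤ} {i j : ℕ} (hi : i < N) (hj : j < N)
    (h : f (i * N + j) ≠ v) (hg : g (i * N + j) = v)
    (hfg : ∀ i' < N, ∀ j' < N, ¬ (i' = i ∧ j' = j) → g (i' * N + j') = f (i' * N + j')) :
    unmarked N v g < unmarked N v f := by
  refine Finset.card_lt_card ?_
  rw [Finset.ssubset_iff_of_subset]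
  · exact ⟨(i, j), by simp [hi, hj, h], by simp [hg]⟩
  · rintro ⟨a, b⟩ hx
    simp only [Finset.mem_filter, Finset.mem_product, Finset.mem_range] at hx ⊢
    refine ⟨hx.1, ?_⟩
    rw [← hfg a hx.1.1 b hx.1.2]
    · exact hx.2
    · rintro ⟨rfl, rfl⟩
      exact hx.2 hg

/-- The block number has the three interval numbers as its digits in base `s * s`, so there are `s ^
6` of them, the square of `s * s * s`. -/
lemma exists_inBlock {s i j k : ℕ} (hs : 0 < s) (hi : i < s * s * s) (hj : j < s * s * s)
    (hk : k < s * s * s) : ∃ q < s * s * s * (s * s * s), InBlock s q i j k := by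
  have hss : 0 < s * s := by positivity
  have h1 : i / s < s * s := Nat.div_lt_of_lt_mul (by rw [Nat.mul_comm]; exact hi)
  have h2 : j / s < s * s := Nat.div_lt_of_lt_mul (by rw [Nat.mul_comm]; exact hj)
  have h3 : k / s < s * s := Nat.div_lt_of_lt_mul (by rw [Nat.mul_comm]; exact hk)
  unfold InBlock
  generalize i / s = I at *
  generalize j / s = J at *
  generalize k / s = K at *
  have e1 : (I * (s * s) + J) * (s * s) + K = K + (s * s) * (J + (s * s) * I) := by ring
  refine ⟨(I * (s * s) + J) * (s * s) + K, ?_, ?_, ?_, ?_⟩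
  · have h4 : I * (s * s) + J + 1 ≤ (s * s) * (s * s) := by
      have := cell_lt_mul h1 h2; omega
    have h5 := Nat.mul_le_mul_right (s * s) h4
    have h6 : s * s * s * (s * s * s) = s * s * (s * s) * (s * s) := by ring
    rw [h6]
    linarith
  · rw [e1, Nat.add_mul_div_left _ _ hss, Nat.div_eq_of_lt h3, zero_add,
      Nat.add_mul_div_left _ _ hss, Nat.div_eq_of_lt h2, zero_add]
  · rw [e1, Nat.add_mul_div_left _ _ hss, Nat.div_eq_of_lt h3, zero_add,
      Nat.add_mul_mod_self_left, Nat.mod_eq_of_lt h2]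
  · rw [e1, Nat.add_mul_mod_self_left, Nat.mod_eq_of_lt h3]

/-- Process block number `reg 17`: mark an entry of array 6 that exceeds the corresponding entry of
the min-plus square of array 4, or proceed to the next block if there is none. -/
def step (p : Prog) (m : ℕ) : Prog :=
  .seq (call p m) (branch (lt (get 4 (var 23 * var 2 + var 25) + get 4 (var 25 * var 2 + var 24))
      (get 6 (var 23 * var 2 + var 24)))
    (write 6 (var 23 * var 2 + var 24) (lit 0 - var 8)) (assign 17 (var 17 + lit 1)))

/-- Mark the entries of array 6 that exceed those of the min-plus square of array 4. -/
def detect (p : Prog) (m : ℕ) : Prog :=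
  .seq (assign 17 (lit 0)) (while_ (lt (var 17) (var 3)) (step p m))

variable (P) in
/-- The running time of the treatment of one block. -/
def stepTime : ℕ := 3 * P.t₀ + 200 * (P.s * P.s) + P.m + 300

/-- The state after some iterations of the loop in `detect`, started in `st₀` with the matrices
`D` and `T`; `k` bounds the number of the remaining iterations. -/
structure DetectInv (P : Params c p) (D T : ℕ → ℕ → ℤ) (cnt₀ : ℕ) (st₀ : State) (k : ℕ)
    (st : State) (q cnt : ℕ) : Prop where
  q_le : q ≤ P.N * P.N
  same : Same 17 6 st₀ st
  pool : Pool P.M P.m cnt st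
  r17 : st.reg 17 = q
  mark : ∀ i < P.N, ∀ j < P.N, st.mem 6 (i * P.N + j) = T i j ∨
    st.mem 6 (i * P.N + j) = -P.E ∧ ∃ k < P.N, D i k + D k j < T i j
  done : ∀ i < P.N, ∀ j < P.N, ∀ k < P.N, ∀ q' < q, InBlock P.s q' i j k →
    st.mem 6 (i * P.N + j) ≤ D i k + D k j
  -- An iteration either passes to the next block or marks an entry, and both summands are at most
  -- `N * N`.
  fuel : P.N * P.N - q + unmarked P.N (-P.E) (st.mem 6) ≤ k
  cnt_le : cnt + k ≤ cnt₀ + 2 * (P.N * P.N)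

/-- If the minimizing triple violates its threshold, the entry was unmarked and gets marked, and the
block is tried again. If not, minimality shows that no triple of the block does, so the block is
finished. -/
lemma step_runs {D T : ℕ → ℕ → ℤ} {cnt₀ k q cnt : ℕ} {st₀ st : State}
    (hC : Consts P st₀) (hc : cnt₀ + 2 * (P.N * P.N) ≤ P.M)
    (hD : ∀ i < P.N, ∀ j < P.N, st₀.mem 4 (i * P.N + j) = D i j)
    (hDb : ∀ i < P.N, ∀ j < P.N, 2 * |D i j| ≤ P.E)
    (hT : ∀ i < P.N, ∀ j < P.N, |T i j| ≤ 2 * P.E)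
    (h : DetectInv P D T cnt₀ st₀ k st q cnt) (hq : q < P.N * P.N) :
    Runs P.w (step p P.m) st (fun st' t => t ≤ stepTime P ∧ ∃ k' < k, ∃ q' cnt',
      DetectInv P D T cnt₀ st₀ k' st' q' cnt') := by
  have hfuel := h.fuel
  have hcle := h.cnt_le
  have hEM : (4 * P.E : ℤ) ≤ P.M := by exact_mod_cast P.E_le_M
  have hE0 : (0 : ℤ) < P.E := by exact_mod_cast P.E_pos
  have hM := P.NN_le_M
  have hD' : ∀ i < P.N, ∀ j < P.N, st.mem 4 (i * P.N + j) = D i j := fun i hi j hj => by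
    rw [h.same.mem 4 (by omega), hD i hi j hj]
  have hCs := hC.same h.same (by omega)
  have hTb : ∀ i < P.N, ∀ j < P.N, |st.mem 6 (i * P.N + j)| ≤ 2 * P.E := fun i hi j hj => by
    rcases h.mark i hi j hj with h1 | ⟨h1, -⟩
    · rw [h1]; exact hT i hi j hj
    · rw [h1, abs_neg, abs_of_pos hE0]; omega
  have hDb' : ∀ i < P.N, ∀ j < P.N, |st.mem 4 (i * P.N + j)| ≤ 2 * P.E := fun i hi j hj => by
    rw [hD' i hi j hj]; linarith [hDb i hi j hj, abs_nonneg (D i j)]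
  refine Runs.seq (call_runs hCs h.pool (by omega) hq h.r17 hDb' hTb ?_)
  intro st1 t i j l s1 p1 r23 r24 r25 hi hj hl hmin ht
  have c1 := hCs.same s1 (by omega)
  have v23 : (var 23).Val P.w st1 i := Val.var (by decide) r23
  have v24 : (var 24).Val P.w st1 j := Val.var (by decide) r24
  have v25 : (var 25).Val P.w st1 l := Val.var (by decide) r25
  have vij := val_cell c1 v23 v24 hi hj
  have m4 : st1.mem 4 = st.mem 4 := s1.mem 4 (by omega)
  have m6 : st1.mem 6 = st.mem 6 := s1.mem 6 (by omega)
  have b1 := abs_le.1 (hDb' i hi l hl)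
  have b2 := abs_le.1 (hDb' l hl j hj)
  have vil := (val_cell c1 v23 v25 hi hl).get (arr := 4)
  have vlj := (val_cell c1 v25 v24 hl hj).get (arr := 4)
  have vT := vij.get (arr := 6)
  rw [m4] at vil vlj
  rw [m6] at vT
  have vs := (vil.add vlj (P.abs_lt_of_le (by rw [abs_le]; constructor <;> linarith))).lt P.w_pos vT
  rw [hD' i hi l hl, hD' l hl j hj] at vs hmin
  -- No sum lies below `-E`. So an entry marked by `-E` satisfies every inequality asked for in
  -- `done`, and can never be found again.
  have dsum : ∀ l < P.N, -(P.E : ℤ) ≤ D i l + D l j := fun l hl => by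
    have g1 := abs_le.1 (show |D i l| ≤ |D i l| from le_rfl)
    have g2 := abs_le.1 (show |D l j| ≤ |D l j| from le_rfl)
    have g3 := hDb i hi l hl
    have g4 := hDb l hl j hj
    linarith
  have dl := dsum l hl
  refine Runs.branch vs.1 ?_ ?_
  · intro hcond
    have hlt : D i l + D l j < st.mem 6 (i * P.N + j) := by
      by_contra hcon
      exact hcond (by rw [vs.2, if_neg hcon])
    have hT0 : st.mem 6 (i * P.N + j) = T i j := by
      rcases h.mark i hi j hj with h1 | ⟨h1, -⟩
      · exact h1
      · exfalso; linarith
    refine Runs.put (i * P.N + j) (0 - P.E) vij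
      ((Val.lit (by simp)).sub (Val.var (by decide) c1.r8) (P.abs_lt_of_le ?_)) ?_
    · rw [abs_le]; constructor <;> linarith
    have hmem : ∀ i' < P.N, ∀ j' < P.N, (st1.setMem 6 (i * P.N + j) (0 - P.E)).mem 6
        (i' * P.N + j') = if i' = i ∧ j' = j then -(P.E : ℤ) else st.mem 6 (i' * P.N + j') := by
      intro i' hi' j' hj'
      rw [State.setMem_mem, m6, zero_sub]
      by_cases he : i' = i ∧ j' = j
      · obtain ⟨rfl, rfl⟩ := he; simp
      · rw [if_neg he, if_neg]
        rintro ⟨-, h'⟩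
        exact he (cell_inj hj' hj h')
    have hun : unmarked P.N (-P.E) ((st1.setMem 6 (i * P.N + j) (0 - P.E)).mem 6) <
        unmarked P.N (-P.E) (st.mem 6) := by
      refine unmarked_update hi hj (by omega) (by rw [hmem i hi j hj]; simp) ?_
      intro i' hi' j' hj' he
      rw [hmem i' hi' j' hj', if_neg he]
    refine ⟨?_, k - 1, by omega, q, cnt + 1, h.q_le,
      h.same.trans ((s1.weaken (by omega) (by omega)).setMem le_rfl _ _), p1.setMem (by omega) _ _,
      by rw [State.setMem_reg, s1.reg 17 (by omega), h.r17], ?_, ?_, by omega, by omega⟩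
    · simp only [stepTime, cost_lt, cost_get, cost_add, cost_sub, cost_mul, cost_var, cost_lit]
      omega
    · intro i' hi' j' hj'
      rw [hmem i' hi' j' hj']
      split_ifs with he
      · obtain ⟨rfl, rfl⟩ := he
        exact Or.inr ⟨rfl, l, hl, by rw [← hT0]; exact hlt⟩
      · exact h.mark i' hi' j' hj'
    · intro i' hi' j' hj' k' hk' q' hq' hb
      rw [hmem i' hi' j' hj']
      split_ifs with he
      · obtain ⟨rfl, rfl⟩ := he
        exact dsum k' hk'
      · exact h.done i' hi' j' hj' k' hk' q' hq' hb
  · intro hcond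
    have hge : st.mem 6 (i * P.N + j) ≤ D i l + D l j := by
      by_contra hcon
      rw [vs.2, if_pos (by linarith)] at hcond
      exact one_ne_zero hcond
    have hq1 : |(q + 1 : ℤ)| < 2 ^ P.w := by exact_mod_cast P.natCast_lt (x := q + 1) (by omega)
    refine Runs.setVal (v := q + 1) ((Val.var (by decide) ?_).add (Val.lit ?_) hq1) hq1 ?_
    · rw [s1.reg 17 (by omega), h.r17]
    · exact_mod_cast P.natCast_lt (x := 1) (by omega)
    refine ⟨?_, k - 1, by omega, q + 1, cnt + 1, hq,
      h.same.trans ((s1.weaken (by omega) (by omega)).setReg le_rfl _), p1.setReg (by omega) _,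
      by simp, ?_, ?_, ?_, by omega⟩
    · simp only [stepTime, cost_lt, cost_get, cost_add, cost_mul, cost_var, cost_lit]
      omega
    · rw [State.setReg_mem, m6]; exact h.mark
    · intro i' hi' j' hj' k' hk' q' hq' hb
      rw [State.setReg_mem, m6]
      rcases Nat.lt_succ_iff_lt_or_eq.1 hq' with hq' | rfl
      · exact h.done i' hi' j' hj' k' hk' q' hq' hb
      · have := hmin i' hi' j' hj' k' hk' hb
        rw [hD' i' hi' k' hk', hD' k' hk' j' hj'] at this
        linarith
    · rw [State.setReg_mem, m6]; omega

/-- The initial fuel is at most `2 * (N * N)`, which bounds both the time and the number of calls.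
At the end every triple `(i, j, k)` belongs to a finished block, so an unmarked entry is at most all
of its sums. -/
lemma detect_runs {D T : ℕ → ℕ → ℤ} {cnt : ℕ} {st : State}
    (hC : Consts P st) (hP : Pool P.M P.m cnt st) (hc : cnt + 2 * (P.N * P.N) ≤ P.M)
    (hD : ∀ i < P.N, ∀ j < P.N, st.mem 4 (i * P.N + j) = D i j)
    (hDb : ∀ i < P.N, ∀ j < P.N, 2 * |D i j| ≤ P.E)
    (hm : ∀ i < P.N, ∀ j < P.N, st.mem 6 (i * P.N + j) = T i j)
    (hT : ∀ i < P.N, ∀ j < P.N, |T i j| ≤ 2 * P.E) {Q : State → ℕ → Prop}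
    (hQ : ∀ (st' : State) (cnt' : ℕ), Same 17 6 st st' → Pool P.M P.m cnt' st' →
      cnt' ≤ cnt + 2 * (P.N * P.N) →
      (∀ i < P.N, ∀ j < P.N,
        (st'.mem 6 (i * P.N + j) = T i j ∧ ∀ k < P.N, T i j ≤ D i k + D k j) ∨
        (st'.mem 6 (i * P.N + j) = -P.E ∧ ∃ k < P.N, D i k + D k j < T i j)) →
      Q st' ((stepTime P + 6) * (2 * (P.N * P.N)) + 9)) :
    Runs P.w (detect p P.m) st Q := by
  refine Runs.seq (Runs.setVal (Val.lit (by simp)) (by simp) ?_)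
  have hun := unmarked_le P.N (-P.E) (st.mem 6)
  refine Runs.while (k₀ := 2 * (P.N * P.N)) (fun k st' => ∃ q cnt', DetectInv P D T cnt st k st' q cnt')
    (2 * (P.N * P.N)) (stepTime P) ⟨0, cnt, ⟨by omega, (Same.refl _ _ _).setReg le_rfl _,
      hP.setReg (by omega) _, by simp, fun i hi j hj => Or.inl (hm i hi j hj), by omega, ?_, le_rfl⟩⟩
    ?_ ?_ ?_ le_rfl
  · rw [State.setReg_mem]; omega
  · rintro k s ⟨q, cnt', h⟩
    have := (Val.var (w := P.w) (by decide) h.r17).lt P.w_pos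
      (Val.var (by decide) (hC.same h.same (by omega)).r3)
    exact ⟨this.1, Ex.abs_bool_lt P.w_pos _⟩
  · rintro k s ⟨q, cnt', h⟩ hcond
    refine step_runs hC hc hD hDb hT h ?_
    by_contra hcon
    apply hcond
    simp only [eval_lt, eval_var, h.r17, (hC.same h.same (by omega)).r3]
    rw [if_neg (by exact_mod_cast hcon)]
  · rintro k s ⟨q, cnt', h⟩ hcond t rfl
    have hq : q = P.N * P.N := by
      by_contra hcon
      have := h.q_le
      simp only [eval_lt, eval_var, h.r17, (hC.same h.same (by omega)).r3] at hcond
      rw [if_pos (by exact_mod_cast (by omega : q < P.N * P.N))] at hcond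
      exact one_ne_zero hcond
    subst hq
    have := hQ s cnt' h.same h.pool (by have := h.cnt_le; omega) ?_
    · convert this using 1
      simp only [cost_lt, cost_var, cost_lit]
      ring
    · intro i hi j hj
      rcases h.mark i hi j hj with h1 | h1
      · refine Or.inl ⟨h1, fun k' hk' => ?_⟩
        obtain ⟨q', hq', hb⟩ := exists_inBlock P.s_pos hi hj hk'
        rw [← h1]
        exact h.done i hi j hj k' hk' q' hq' hb
      · exact Or.inr h1

end MinPlus
/-! ## Min-plus squares and powers -/

namespace MinPlus

open Ex

variable {c : ℕ} {p : Prog} {P : Params c p}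

lemma forall_cell {N : ℕ} {φ : ℤ → Prop} (h : ∀ i < N, ∀ j < N, φ (i * N + j)) {k : ℕ}
    (hk : k < N * N) : φ k := by
  have hN : 0 < N := Nat.pos_of_ne_zero (by rintro rfl; simp at hk)
  have := h (k / N) (Nat.div_lt_of_lt_mul hk) (k % N) (Nat.mod_lt k hN)
  have e : ((k / N : ℕ) : ℤ) * N + (k % N : ℕ) = k := by exact_mod_cast Nat.div_add_mod' k N
  rwa [e] at this

/-- The last premise of `he` leaves the target array known from cell `k` on; this permits updating
an array from its own entries. -/
lemma fill_runs {st : State} {cnt arr lim m : ℕ} {e : Ex} (hC : Consts P st)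
    (hP : Pool P.M P.m cnt st) (ha : arr < 20) (hl : lim < 18) (hlm : st.reg lim = m)
    (hm : m ≤ P.N * P.N) (val : ℤ → ℤ)
    (he : ∀ st', Consts P st' → Same 18 0 st st' → ∀ k < m, st'.reg 18 = k →
      (∀ b (z : ℤ), b ≠ arr ∨ k ≤ z → st'.mem b z = st.mem b z) → e.Val P.w st' (val k))
    {Q : State → ℕ → Prop}
    (hQ : ∀ st', Same 18 arr st st' → Pool P.M P.m cnt st' → (∀ b ≠ arr, st'.mem b = st.mem b) →
      (∀ k < m, st'.mem arr k = val k) → Q st' ((e.cost + 13) * m + 9)) :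
    Runs P.w (fill arr 18 lim e) st Q := by
  have h1 := P.NN_le_M
  have hlt : ¬ IsTemp lim := fun h => by have := h.1; omega
  refine Runs.fill val m P.w_pos ?_ (by decide) hlt (by omega) hlm ?_ ?_
  · have := P.natCast_lt (x := m) (by omega)
    rwa [abs_of_nonneg (by positivity)] at this
  · rintro k hk st' rfl
    refine he _ ?_ ?_ k hk (State.setReg_reg_same _ _ _) ?_
    · exact hC.same (((Same.refl 18 0 st).setArr (by omega) _).setReg le_rfl _) (by omega)
    · exact ((Same.refl _ _ st).setArr (by omega) _).setReg le_rfl _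
    · intro b z hb
      rw [State.setReg_mem, State.setArr_mem]
      split_ifs with h
      · rw [tab_of_ge (by rcases hb with hb | hb; exacts [absurd h hb, hb]), h]
      · rfl
  · refine hQ _ (((Same.refl _ _ st).setArr le_rfl _).setReg le_rfl _)
      ((hP.setArr ha _).setReg (by omega) _) ?_ ?_
    · intro b hb
      rw [State.setReg_mem, State.setArr_mem_ne _ _ hb]
    · intro k hk
      rw [State.setReg_mem, State.setArr_mem_same, tab_of_lt (by positivity) (by exact_mod_cast hk)]

/-- One step of a binary search for all entries of the min-plus square. -/
def bit (p : Prog) (m : ℕ) : Prog :=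
  .seq (fill 6 18 3 (get 5 (var 18) + var 16)) <| .seq (detect p m) <|
  .seq (fill 5 18 3 (cond (eq (get 6 (var 18)) (lit 0 - var 8)) (get 5 (var 18)) (get 6 (var 18))))
    (assign 16 (var 16 / lit 2))

/-- Write the min-plus square of array 4 to array 5. -/
def square (p : Prog) (m : ℕ) : Prog :=
  .seq (fill 5 18 3 (lit 0 - var 8)) <| .seq (assign 16 (var 8)) (while_ (var 16) (bit p m))

variable (P) in
/-- The running time of a step of the binary search. -/
def bitTime : ℕ := (stepTime P + 30) * (2 * (P.N * P.N)) + 40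

/-- The state of the binary search in `square`, started in `st₀` with the matrix `D`. -/
structure BitInv (P : Params c p) (D : ℕ → ℕ → ℤ) (cnt₀ : ℕ) (st₀ : State) (f : ℕ) (st : State)
    (cnt : ℕ) : Prop where
  same : Same 16 5 st₀ st
  pool : Pool P.M P.m cnt st
  f_le : f ≤ P.e + 1
  -- The halved power is zero exactly at `f = 0`, so the step width also serves as the loop test.
  r16 : st.reg 16 = (2 ^ f / 2 : ℕ)
  le : ∀ i < P.N, ∀ j < P.N, ∀ k < P.N, st.mem 5 (i * P.N + j) ≤ D i k + D k j
  ex : ∀ i < P.N, ∀ j < P.N, ∃ k < P.N, D i k + D k j < st.mem 5 (i * P.N + j) + 2 ^ f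
  ge : ∀ i < P.N, ∀ j < P.N, -(P.E : ℤ) ≤ st.mem 5 (i * P.N + j)
  cnt_le : cnt + f * (2 * (P.N * P.N)) ≤ cnt₀ + (P.e + 1) * (2 * (P.N * P.N))

/-- One detection decides all comparisons: the thresholds are the current lower bounds plus `2 ^ f`.
Where no mark appears, the threshold is a new lower bound; where one appears, some sum is below it.
Either way the interval is halved. -/
lemma bit_runs {D : ℕ → ℕ → ℤ} {cnt₀ f cnt : ℕ} {st₀ st : State}
    (hC : Consts P st₀) (hc : cnt₀ + (P.e + 1) * (2 * (P.N * P.N)) ≤ P.M)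
    (hD : ∀ i < P.N, ∀ j < P.N, st₀.mem 4 (i * P.N + j) = D i j)
    (hDb : ∀ i < P.N, ∀ j < P.N, 4 * |D i j| ≤ P.E)
    (h : BitInv P D cnt₀ st₀ (f + 1) st cnt) :
    Runs P.w (bit p P.m) st (fun st' t => t ≤ bitTime P ∧ ∃ cnt', BitInv P D cnt₀ st₀ f st' cnt') := by
  have hEM : (4 * P.E : ℤ) ≤ P.M := by exact_mod_cast P.E_le_M
  have hE0 : (0 : ℤ) < P.E := by exact_mod_cast P.E_pos
  have hcle := h.cnt_le
  rw [Nat.succ_mul] at hcle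
  have hCs := hC.same h.same (by omega)
  have hfE : (2 : ℤ) ^ f ≤ P.E := by
    have : 2 ^ f ≤ P.E := Nat.pow_le_pow_right (by norm_num) (by have := h.f_le; omega)
    exact_mod_cast this
  have hf0 : (0 : ℤ) < 2 ^ f := by positivity
  have r16 : st.reg 16 = 2 ^ f := by
    rw [h.r16, pow_succ, Nat.mul_div_cancel _ (by norm_num)]; push_cast; rfl
  have cub : ∀ i < P.N, ∀ j < P.N, 2 * st.mem 5 (i * P.N + j) ≤ P.E := fun i hi j hj => by
    have h1 := h.le i hi j hj i hi
    have g1 := abs_le.1 (show |D i i| ≤ |D i i| from le_rfl)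
    have g2 := abs_le.1 (show |D i j| ≤ |D i j| from le_rfl)
    have g3 := hDb i hi i hi
    have g4 := hDb i hi j hj
    linarith
  have hTb : ∀ i < P.N, ∀ j < P.N, |st.mem 5 (i * P.N + j) + 2 ^ f| ≤ 2 * P.E := fun i hi j hj => by
    have h1 := h.ge i hi j hj
    have h2 := cub i hi j hj
    rw [abs_le]
    constructor <;> linarith
  refine Runs.seq (fill_runs hCs h.pool (by omega) (by omega) hCs.r3 le_rfl
    (fun z => st.mem 5 z + 2 ^ f) ?_ ?_)
  · intro st' hC' hS k hk h18 hm
    have v18 : (var 18).Val P.w st' k := Val.var (by decide) h18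
    have v := v18.get (arr := 5)
    rw [hm 5 k (by omega)] at v
    refine v.add (Val.var (by decide) (by rw [hS.reg 16 (by omega), r16])) (P.abs_lt_of_le ?_)
    have := forall_cell (φ := fun z => |st.mem 5 z + 2 ^ f| ≤ 2 * P.E) hTb hk
    linarith
  intro st1 s1 p1 m1 v1
  have v1' : ∀ i < P.N, ∀ j < P.N, st1.mem 6 (i * P.N + j) = st.mem 5 (i * P.N + j) + 2 ^ f :=
    fun i hi j hj => by exact_mod_cast v1 (i * P.N + j) (cell_lt_mul hi hj)
  have m14 : ∀ i < P.N, ∀ j < P.N, st1.mem 4 (i * P.N + j) = D i j := fun i hi j hj => by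
    rw [m1 4 (by omega), h.same.mem 4 (by omega), hD i hi j hj]
  refine Runs.seq (detect_runs (hCs.same s1 (by omega)) p1 (by omega) m14
    (fun i hi j hj => by linarith [hDb i hi j hj, abs_nonneg (D i j)]) v1' hTb ?_)
  intro st2 cnt' s2 p2 hcnt' hres
  have m25 : st2.mem 5 = st.mem 5 := by rw [s2.mem 5 (by omega), m1 5 (by omega)]
  have s12 := (s1.weaken (show 17 ≤ 18 by omega) le_rfl).trans s2
  have c2 := hCs.same s12 (by omega)
  refine Runs.seq (fill_runs c2 p2 (by omega) (by omega) c2.r3 le_rfl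
    (fun z => if st2.mem 6 z = 0 - P.E then st.mem 5 z else st2.mem 6 z) ?_ ?_)
  · intro st' hC' hS k hk h18 hm
    have v18 : (var 18).Val P.w st' k := Val.var (by decide) h18
    have w5 := v18.get (arr := 5)
    have w6 := v18.get (arr := 6)
    rw [hm 5 k (by omega), m25] at w5
    rw [hm 6 k (by omega)] at w6
    have b1 := forall_cell (φ := fun z => -(P.E : ℤ) ≤ st.mem 5 z) h.ge hk
    have b2 := forall_cell (φ := fun z => 2 * st.mem 5 z ≤ P.E) cub hk
    have b3 : |st2.mem 6 k| ≤ 2 * P.E :=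
      forall_cell (φ := fun z => |st2.mem 6 z| ≤ 2 * P.E) (fun i hi j hj => by
        rcases hres i hi j hj with ⟨h1, -⟩ | ⟨h1, -⟩
        · rw [h1]; exact hTb i hi j hj
        · rw [h1, abs_neg, abs_of_pos hE0]; linarith) hk
    refine Val.cond (w6.eq P.w_pos ((Val.lit (by simp)).sub (Val.var (by decide) hC'.r8) ?_))
      (fun _ => ⟨w5, ?_⟩) (fun _ => ⟨w6, ?_⟩)
    · apply P.abs_lt_of_le; rw [abs_le]; constructor <;> linarith
    · apply P.abs_lt_of_le; rw [abs_le]; constructor <;> linarith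
    · exact P.abs_lt_of_le (by linarith)
  intro st3 s3 p3 m3 v3
  have v3' : ∀ i < P.N, ∀ j < P.N, st3.mem 5 (i * P.N + j) =
      if st2.mem 6 (i * P.N + j) = 0 - P.E then st.mem 5 (i * P.N + j) else st2.mem 6 (i * P.N + j) :=
    fun i hi j hj => by exact_mod_cast v3 (i * P.N + j) (cell_lt_mul hi hj)
  have key : ∀ i < P.N, ∀ j < P.N,
      (st3.mem 5 (i * P.N + j) = st.mem 5 (i * P.N + j) + 2 ^ f ∧
        ∀ k < P.N, st.mem 5 (i * P.N + j) + 2 ^ f ≤ D i k + D k j) ∨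
      (st3.mem 5 (i * P.N + j) = st.mem 5 (i * P.N + j) ∧
        ∃ k < P.N, D i k + D k j < st.mem 5 (i * P.N + j) + 2 ^ f) := by
    intro i hi j hj
    rcases hres i hi j hj with ⟨h1, h2⟩ | ⟨h1, h2⟩
    · refine Or.inl ⟨?_, h2⟩
      have := h.ge i hi j hj
      -- A lower bound is at least `-E`, so the threshold is strictly larger and an unmarked entry
      -- cannot be mistaken for a mark.
      rw [v3' i hi j hj, if_neg (by rw [h1]; linarith), h1]
    · exact Or.inr ⟨by rw [v3' i hi j hj, if_pos (by rw [h1, zero_sub])], h2⟩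
  have hhalf : |((2 ^ f / 2 : ℕ) : ℤ)| < 2 ^ P.w := by
    apply P.natCast_lt
    have : 2 ^ f ≤ P.E := by exact_mod_cast hfE
    have := P.E_le_M
    omega
  have r16' : st3.reg 16 = 2 ^ f := by
    rw [s3.reg 16 (by omega), s12.reg 16 (by omega), r16]
  have vh : (var 16 / lit 2).Val P.w st3 (2 ^ f / 2 : ℕ) := by
    push_cast at hhalf ⊢
    refine (Val.var (by decide) r16').div (Val.lit ?_) hhalf
    apply P.abs_lt_of_le; rw [abs_le]; constructor <;> linarith
  refine Runs.setVal vh hhalf ⟨?_, cnt', ?_, p3.setReg (by omega) _, by have := h.f_le; omega,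
    by simp, ?_, ?_, ?_, by omega⟩
  · simp only [bitTime, cost_cond, cost_eq, cost_get, cost_add, cost_sub, cost_div, cost_var, cost_lit]
    ring_nf; omega
  · exact h.same.trans ((s12.weaken (by omega) (by omega)).trans
      ((s3.weaken (by omega) (by omega)).setReg le_rfl _))
  · intro i hi j hj k hk
    rw [State.setReg_mem]
    rcases key i hi j hj with ⟨h1, h2⟩ | ⟨h1, h2⟩
    · rw [h1]; exact h2 k hk
    · rw [h1]; exact h.le i hi j hj k hk
  · intro i hi j hj
    rw [State.setReg_mem]
    rcases key i hi j hj with ⟨h1, h2⟩ | ⟨h1, h2⟩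
    · obtain ⟨k, hk, h3⟩ := h.ex i hi j hj
      rw [pow_succ] at h3
      exact ⟨k, hk, by rw [h1]; linarith⟩
    · rw [h1]; exact h2
  · intro i hi j hj
    rw [State.setReg_mem]
    have := h.ge i hi j hj
    rcases key i hi j hj with ⟨h1, h2⟩ | ⟨h1, h2⟩ <;> rw [h1] <;> linarith

variable (P) in
/-- The running time of `square`. -/
def squareTime : ℕ := (bitTime P + 4) * (P.e + 1) + 16 * (P.N * P.N) + 16

/-- The sums lie between `-E / 2` and `E / 2`, inside the initial interval from `-E` of length `2 *
E = 2 ^ (e + 1)`. When the length has come down to `1`, integrality makes the lower bound equal to a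
sum. -/
lemma square_runs {D : ℕ → ℕ → ℤ} {cnt : ℕ} {st : State}
    (hC : Consts P st) (hP : Pool P.M P.m cnt st)
    (hc : cnt + (P.e + 1) * (2 * (P.N * P.N)) ≤ P.M)
    (hD : ∀ i < P.N, ∀ j < P.N, st.mem 4 (i * P.N + j) = D i j)
    (hDb : ∀ i < P.N, ∀ j < P.N, 4 * |D i j| ≤ P.E) {Q : State → ℕ → Prop}
    (hQ : ∀ (st' : State) (cnt' : ℕ), Same 16 5 st st' → Pool P.M P.m cnt' st' →
      cnt' ≤ cnt + (P.e + 1) * (2 * (P.N * P.N)) →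
      (∀ i < P.N, ∀ j < P.N, ∀ k < P.N, st'.mem 5 (i * P.N + j) ≤ D i k + D k j) →
      (∀ i < P.N, ∀ j < P.N, ∃ k < P.N, st'.mem 5 (i * P.N + j) = D i k + D k j) →
      Q st' (squareTime P)) :
    Runs P.w (square p P.m) st Q := by
  have hEM : (4 * P.E : ℤ) ≤ P.M := by exact_mod_cast P.E_le_M
  have hE0 : (0 : ℤ) < P.E := by exact_mod_cast P.E_pos
  refine Runs.seq (fill_runs hC hP (by omega) (by omega) hC.r3 le_rfl (fun _ => 0 - P.E) ?_ ?_)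
  · intro st' hC' hS k hk h18 hm
    exact (Val.lit (by simp)).sub (Val.var (by decide) hC'.r8)
      (P.abs_lt_of_le (by rw [abs_le]; constructor <;> linarith))
  intro st1 s1 p1 m1 v1
  have v1' : ∀ i < P.N, ∀ j < P.N, st1.mem 5 (i * P.N + j) = -P.E :=
    fun i hi j hj => by rw [← zero_sub]; exact_mod_cast v1 (i * P.N + j) (cell_lt_mul hi hj)
  have hEw : |(P.E : ℤ)| < 2 ^ P.w :=
    P.abs_lt_of_le (by rw [abs_le]; constructor <;> linarith)
  refine Runs.seq (Runs.setVal (Val.var (by decide) (hC.same s1 (by omega)).r8) hEw ?_)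
  have dsum : ∀ i < P.N, ∀ j < P.N, ∀ k < P.N, |D i k + D k j| * 2 ≤ P.E := by
    intro i hi j hj k hk
    linarith [abs_add_le (D i k) (D k j), hDb i hi k hk, hDb k hk j hj]
  have hEe : (P.E : ℤ) = 2 ^ P.e := by simp [Params.E]
  refine Runs.while (k₀ := P.e + 1) (fun f st' => ∃ cnt', BitInv P D cnt st f st' cnt')
    (P.e + 1) (bitTime P) ⟨cnt, ⟨(s1.weaken (by omega) (by omega)).setReg le_rfl _,
      p1.setReg (by omega) _, le_rfl, ?_, ?_, ?_, ?_, le_rfl⟩⟩ ?_ ?_ ?_ le_rfl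
  · rw [State.setReg_reg_same, pow_succ, Nat.mul_div_cancel _ (by norm_num)]; rfl
  · intro i hi j hj k hk
    rw [State.setReg_mem, v1' i hi j hj]
    have := dsum i hi j hj k hk
    have := neg_abs_le (D i k + D k j)
    have := abs_nonneg (D i k + D k j)
    linarith
  · intro i hi j hj
    refine ⟨i, hi, ?_⟩
    rw [State.setReg_mem, v1' i hi j hj, pow_succ, ← hEe]
    have := dsum i hi j hj i hi
    have := le_abs_self (D i i + D i j)
    have := abs_nonneg (D i i + D i j)
    linarith
  · intro i hi j hj
    rw [State.setReg_mem, v1' i hi j hj]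
  · rintro f s ⟨cnt', h⟩
    refine ⟨by simp; decide, ?_⟩
    rw [eval_var, h.r16]
    apply P.natCast_lt
    have h1 : 2 ^ f ≤ 2 ^ (P.e + 1) := Nat.pow_le_pow_right (by norm_num) h.f_le
    have h2 : 2 ^ (P.e + 1) = P.E * 2 := pow_succ _ _
    have := P.E_le_M
    omega
  · rintro f s ⟨cnt', h⟩ hcond
    rcases f with _ | f
    · exact absurd (by rw [eval_var, h.r16]; rfl) hcond
    · exact (bit_runs hC hc hD hDb h).mono fun s' T hT => ⟨hT.1, f, by omega, hT.2⟩
  · rintro f s ⟨cnt', h⟩ hcond T rfl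
    have hf : f = 0 := by
      by_contra hf
      obtain ⟨g, rfl⟩ := Nat.exists_eq_succ_of_ne_zero hf
      rw [eval_var, h.r16, pow_succ, Nat.mul_div_cancel _ (by norm_num)] at hcond
      exact absurd (by exact_mod_cast hcond) (pow_ne_zero g (two_ne_zero (α := ℕ)))
    subst hf
    have := hQ s cnt' h.same h.pool (by have := h.cnt_le; omega) h.le ?_
    · convert this using 1
      simp only [squareTime, cost_var, cost_lit, cost_sub]
      ring
    · intro i hi j hj
      obtain ⟨k, hk, h1⟩ := h.ex i hi j hj
      rw [pow_zero] at h1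
      exact ⟨k, hk, by have := h.le i hi j hj k hk; omega⟩

/-- Replace the matrix in array 4 by its min-plus power with exponent `2 ^ reg 5`. -/
def power (p : Prog) (m : ℕ) : Prog :=
  for_ 15 5 (.seq (square p m) (fill 4 18 3 (get 5 (var 18))))

/-- Repeated squaring, with `2 ^ R = N`. Entries for walks of at most `N` edges are at most `4 * N *
V = E / 4` in absolute value, as each squaring requires; this explains `E = 16 * N * V`. -/
lemma power_runs {W : ℕ → ℕ → ℤ} {st : State} (hC : Consts P st) (hP : Pool P.M P.m 0 st)
    (hD : ∀ i < P.N, ∀ j < P.N, st.mem 4 (i * P.N + j) = W i j)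
    (hW : ∀ i j, |W i j| ≤ 4 * P.V) {Q : State → ℕ → Prop}
    (hQ : ∀ (st' : State) (cnt' : ℕ) (D : ℕ → ℕ → ℤ), Same 15 4 st st' → Pool P.M P.m cnt' st' →
      (∀ i < P.N, ∀ j < P.N, st'.mem 4 (i * P.N + j) = D i j) → IsWalkMin P.N W P.N D →
      Q st' ((squareTime P + 15 * (P.N * P.N) + 20) * P.R + 9)) :
    Runs P.w (power p P.m) st Q := by
  have hNR : 2 ^ P.R = P.N := P.pow_R
  have hRN : P.R < P.N := by rw [← hNR]; exact Nat.lt_two_pow_self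
  have hM := P.NN_le_M
  have hM' := P.N_le_NN
  have heE : P.e + 1 ≤ P.E := Nat.lt_two_pow_self
  -- The total number of calls. The crude estimates `R ≤ N` and `e + 1 ≤ E` suffice, since `M`
  -- affects only word lengths.
  have hcM : P.R * ((P.e + 1) * (2 * (P.N * P.N))) ≤ P.M := by
    calc P.R * ((P.e + 1) * (2 * (P.N * P.N))) ≤ P.N * (P.E * (2 * (P.N * P.N))) := by gcongr
      _ = 2 * P.N * P.E * (P.N * P.N) := by ring
      _ ≤ P.M := by unfold Params.M; gcongr; omega
  refine Runs.for (fun r st' => Same 15 4 st st' ∧ ∃ cnt D, Pool P.M P.m cnt st' ∧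
    cnt ≤ r * ((P.e + 1) * (2 * (P.N * P.N))) ∧
    (∀ i < P.N, ∀ j < P.N, st'.mem 4 (i * P.N + j) = D i j) ∧ IsWalkMin P.N W (2 ^ r) D) P.R
    (squareTime P + 15 * (P.N * P.N) + 9) P.w_pos ?_ (by decide) (by decide) (by omega) hC.r5 ?_ ?_ ?_
  · have := P.natCast_lt (x := P.R) (by omega)
    rwa [abs_of_nonneg (by positivity)] at this
  · exact ⟨(Same.refl _ _ _).setReg le_rfl _, 0, W, hP.setReg (by omega) _, by omega, hD,
      isWalkMin_one⟩
  · rintro r hr s ⟨hS, cnt, D, hp, hcnt, hm, hmin⟩ h15 h5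
    have hcs := hC.same hS (by omega)
    have hr1 : cnt + (P.e + 1) * (2 * (P.N * P.N)) ≤ (r + 1) * ((P.e + 1) * (2 * (P.N * P.N))) := by
      rw [Nat.succ_mul r]; omega
    have hDb : ∀ i < P.N, ∀ j < P.N, 4 * |D i j| ≤ P.E := by
      intro i hi j hj
      have h1 := (hmin i hi j hj).1.abs_le hW
      have h2 : 2 ^ r ≤ P.N := by rw [← hNR]; exact Nat.pow_le_pow_right (by norm_num) hr.le
      have h3 : ((2 ^ r : ℕ) : ℤ) * (4 * P.V) ≤ P.N * (4 * P.V) :=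
        mul_le_mul_of_nonneg_right (by exact_mod_cast h2) (by positivity)
      have h4 : (P.E : ℤ) = 16 * P.N * P.V := by exact_mod_cast P.E_eq
      linarith
    refine Runs.seq (square_runs hcs hp
      (hr1.trans ((Nat.mul_le_mul_right _ hr).trans hcM)) hm hDb ?_)
    intro st1 cnt1 s1 p1 hcnt1 hle hex
    have c1 := hcs.same s1 (by omega)
    refine fill_runs c1 p1 (by omega) (by omega) c1.r3 le_rfl (st1.mem 5) ?_ ?_
    · intro st' hC' hS' k hk h18 hm'
      have v := (Val.var (w := P.w) (r := 18) (by decide) h18).get (arr := 5)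
      rwa [hm' 5 k (by omega)] at v
    intro st2 s2 p2 m2 v2
    have v2' : ∀ i < P.N, ∀ j < P.N, st2.mem 4 (i * P.N + j) = st1.mem 5 (i * P.N + j) :=
      fun i hi j hj => by exact_mod_cast v2 (i * P.N + j) (cell_lt_mul hi hj)
    refine ⟨by simp only [cost_get, cost_var]; omega, ?_, ?_, ?_, cnt1,
      fun i j => st1.mem 5 (i * P.N + j), p2.setReg (by omega) _, hcnt1.trans hr1, v2', ?_⟩
    · rw [s2.reg 15 (by omega), s1.reg 15 (by omega), h15]
    · rw [s2.reg 5 (by omega), s1.reg 5 (by omega), h5]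
    · exact hS.trans ((s1.weaken (by omega) (by omega)).trans
        ((s2.weaken (by omega) le_rfl).setReg le_rfl _))
    · rw [pow_succ, mul_two]
      exact hmin.square hle hex
  · rintro s ⟨hS, cnt, D, hp, hcnt, hm, hmin⟩ - -
    rw [hNR] at hmin
    have := hQ s cnt D hS hp hm hmin
    convert this using 1

end MinPlus
/-! ## The program for all-pairs shortest paths -/

namespace WordRAM

lemma matrixArray_apply {n : ℕ} (f : Fin n → Fin n → ℤ) (u v : Fin n) :
    matrixArray f ((u : ℕ) * n + (v : ℕ)) = f u v := by
  have h : (u : ℕ) * n + v < n * n := MinPlus.cell_lt_mul u.2 v.2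
  have hn : 0 < n := by have := u.2; omega
  have e : (((u : ℕ) : ℤ) * n + ((v : ℕ) : ℤ)).toNat = u * n + v := by
    have : ((u : ℕ) : ℤ) * n + ((v : ℕ) : ℤ) = ((u * n + v : ℕ) : ℤ) := by push_cast; rfl
    rw [this, Int.toNat_natCast]
  unfold matrixArray array
  rw [dif_pos ⟨by positivity, by rw [e]; exact h⟩]
  refine congrArg₂ f (Fin.ext ?_) (Fin.ext ?_)
  · simp only [Fin.divNat, e]
    rw [Nat.add_comm, Nat.add_mul_div_right _ _ hn, Nat.div_eq_of_lt v.2, zero_add]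
  · simp only [Fin.modNat, e]
    rw [Nat.add_comm, Nat.add_mul_mod_self_right, Nat.mod_eq_of_lt v.2]

end WordRAM

namespace MinPlus

open Ex

variable {c : ℕ} {p : Prog} {P : Params c p}

/-- The power of `reg 2` with exponent `k`. -/
def powEx : ℕ → Ex
  | 0 => lit 1
  | k + 1 => powEx k * var 2

lemma powEx_cost (k : ℕ) : (powEx k).cost = 2 * k + 1 := by
  induction k with
  | zero => rfl
  | succ k ih => simp only [powEx, cost_mul, cost_var, ih]; ring

lemma val_powEx {w N k : ℕ} {st : State} (h : st.reg 2 = N) (hN : 0 < N)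
    (hk : ((N ^ k : ℕ) : ℤ) < 2 ^ w) : (powEx k).Val w st (N ^ k : ℕ) := by
  induction k with
  | zero => exact Val.lit (by simpa using hk)
  | succ k ih =>
    have h1 : N ^ k ≤ N ^ (k + 1) := Nat.pow_le_pow_right hN (Nat.le_succ k)
    have h2 := (ih (lt_of_le_of_lt (by exact_mod_cast h1) hk)).mul (Val.var (by decide) h) (by
      rw [abs_of_nonneg (by positivity)]; exact_mod_cast hk)
    rw [pow_succ]
    exact_mod_cast h2

/-- Find the least power of two whose cube is at least `reg 0`. -/
def findSize : Prog :=
  .seq (assign 1 (lit 1)) <| .seq (assign 5 (lit 0)) <|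
    while_ (lt (var 1 * var 1 * var 1) (var 0))
      (.seq (assign 1 (lit 2 * var 1)) (assign 5 (var 5 + lit 3)))

/-- Compute the parameters. -/
def params (c₀ : ℕ) : Prog :=
  .seq findSize <| .seq (assign 2 (var 1 * var 1 * var 1)) <| .seq (assign 3 (var 2 * var 2)) <|
  .seq (assign 4 (var 1 * var 1)) <| .seq (assign 6 (powEx (c₀ + 1))) <|
  .seq (assign 7 (lit 4 * var 6)) <| .seq (assign 8 (lit 16 * var 2 * var 6)) <|
  .seq (assign 9 (lit 2 * var 8)) <| .seq (assign 10 (var 0 * var 0))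
    (assign 40 (lit 4 * var 2 * var 8 * var 3))

/-- Register 5 grows by `3` with each doubling of `s`, so it ends as the binary logarithm of `s * s
* s`, the number of squarings. -/
lemma findSize_runs {j : ℕ} (hs : P.s = 2 ^ j) (hj : ∀ i < j, 2 ^ i * 2 ^ i * 2 ^ i < P.n)
    {st : State} (h0 : st.reg 0 = P.n) {Q : State → ℕ → Prop}
    (hQ : ∀ st' : State, st'.mem = st.mem → (∀ r, r ≠ 1 → r ≠ 5 → st'.reg r = st.reg r) →
      st'.reg 1 = P.s → st'.reg 5 = (3 * j : ℕ) → Q st' (22 * j + 16)) :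
    Runs P.w findSize st Q := by
  have hM := P.NN_le_M
  have hM' := P.N_le_NN
  have hM2 := P.NN_le_E
  have hM3 := P.E_le_M
  have hNpos := P.N_pos
  have hN : ∀ i ≤ j, 2 ^ i ≤ 2 ^ j := fun i hi => Nat.pow_le_pow_right (by norm_num) hi
  have hN2 : ∀ i ≤ j, 2 ^ i * 2 ^ i ≤ P.N ∧ 2 ^ i * 2 ^ i * 2 ^ i ≤ P.N ∧ 2 ^ i ≤ P.N := by
    intro i hi
    have h1 := hN i hi
    have h2 := Nat.mul_le_mul h1 h1
    have h3 := Nat.mul_le_mul h2 h1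
    rw [← hs] at h1 h2 h3
    have h4 := P.ss_le_N
    have h5 := P.s_le_ss
    refine ⟨h2.trans h4, h3, by omega⟩
  have small : ∀ x : ℕ, x ≤ 3 * P.N → |(x : ℤ)| < 2 ^ P.w := fun x hx => P.natCast_lt (by omega)
  have l : ∀ x : ℕ, x ≤ 3 → |(x : ℤ)| < 2 ^ P.w := fun x hx => small x (by omega)
  refine Runs.seq (Runs.setVal (v := 1) (Val.lit (by exact_mod_cast l 1 (by omega)))
    (by exact_mod_cast l 1 (by omega)) ?_)
  refine Runs.seq (Runs.setVal (v := 0) (Val.lit (by simp)) (by simp) ?_)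
  refine Runs.while (k₀ := j) (fun f s => ∃ i, i + f = j ∧ s.mem = st.mem ∧
    (∀ r, r ≠ 1 → r ≠ 5 → s.reg r = st.reg r) ∧ s.reg 1 = (2 ^ i : ℕ) ∧ s.reg 5 = (3 * i : ℕ)) j 12
    ⟨0, by omega, rfl, fun r h1 h5 => by simp [State.setReg_reg, h1, h5], by simp [State.setReg_reg],
      by simp⟩ ?_ ?_ ?_ le_rfl
  · rintro f s ⟨i, hi, -, hr, h1, -⟩
    obtain ⟨b1, b2, -⟩ := hN2 i (by omega)
    have v1 : (var 1).Val P.w s (2 ^ i : ℕ) := Val.var (by decide) h1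
    have v := ((v1.mul v1 (by exact_mod_cast small (2 ^ i * 2 ^ i) (by omega))).mul v1
      (by exact_mod_cast small (2 ^ i * 2 ^ i * 2 ^ i) (by omega))).lt P.w_pos
      (Val.var (r := 0) (x := P.n) (by decide) (by rw [hr 0 (by omega) (by omega), h0]))
    exact ⟨v.1, Ex.abs_bool_lt P.w_pos _⟩
  · rintro f s ⟨i, hi, hm, hr, h1, h5⟩ hcond
    have hij : i < j := by
      by_contra hcon
      obtain rfl : i = j := by omega
      apply hcond
      simp only [eval_lt, eval_mul, eval_var, h1, hr 0 (by omega) (by omega), h0]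
      rw [if_neg]
      have := P.n_le
      rw [hs] at this
      exact not_lt.2 (by exact_mod_cast this)
    obtain ⟨b1, b2, b3⟩ := hN2 (i + 1) (by omega)
    have e : (2 * (2 ^ i : ℕ) : ℤ) = (2 ^ (i + 1) : ℕ) := by rw [pow_succ]; push_cast; ring
    have hb := small (2 ^ (i + 1)) (by omega)
    have hb3 : |((3 * i : ℕ) + 3 : ℤ)| < 2 ^ P.w := by
      have h3 : i + 1 < 2 ^ (i + 1) := Nat.lt_two_pow_self
      exact_mod_cast small (3 * i + 3) (by omega)
    have v1 := (Val.lit (st := s) (x := 2) (by exact_mod_cast l 2 (by omega))).mul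
      (Val.var (w := P.w) (r := 1) (by decide) h1) (by rw [e]; exact hb)
    rw [e] at v1
    refine Runs.seq (Runs.setVal v1 hb ?_)
    refine Runs.setVal (v := (3 * i : ℕ) + 3) ((Val.var (by decide) (by simpa [State.setReg_reg] using h5)).add
      (Val.lit (by exact_mod_cast l 3 (by omega))) hb3) hb3 ?_
    refine ⟨by simp, f - 1, by omega, i + 1, by omega, hm, fun r g1 g5 => ?_, ?_, ?_⟩
    · simpa [State.setReg_reg, g1, g5] using hr r g1 g5
    · simp [State.setReg_reg]
    · rw [State.setReg_reg_same]; push_cast; ring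
  · rintro f s ⟨i, hi, hm, hr, h1, h5⟩ hcond T rfl
    have hij : i = j := by
      by_contra hcon
      have := hj i (by omega)
      simp only [eval_lt, eval_mul, eval_var, h1, hr 0 (by omega) (by omega), h0] at hcond
      rw [if_pos (by exact_mod_cast this)] at hcond
      exact one_ne_zero hcond
    subst hij
    have := hQ s hm hr (by rw [h1, hs]) h5
    convert this using 1
    simp only [cost_lt, cost_mul, cost_var, cost_lit]
    ring

lemma params_runs {c₀ j : ℕ} (hs : P.s = 2 ^ j) (hR : P.R = 3 * j)
    (hj : ∀ i < j, 2 ^ i * 2 ^ i * 2 ^ i < P.n) (hV : P.V = P.N ^ (c₀ + 1))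
    {st : State} (h0 : st.reg 0 = P.n) (hr : ∀ r, 40 < r → st.reg r = 0)
    (hm : ∀ a, st.mem (20 + a) = fun _ => 0) {Q : State → ℕ → Prop}
    (hQ : ∀ st' : State, Consts P st' → Pool P.M P.m 0 st' → st'.mem = st.mem →
      Q st' (22 * j + 2 * c₀ + 69)) :
    Runs P.w (params c₀) st Q := by
  have hM := P.NN_le_M
  have hM' := P.N_le_NN
  have hM2 := P.NN_le_E
  have hM3 := P.E_le_M
  have hNpos := P.N_pos
  have hss := P.ss_le_N
  have hEe := P.E_eq
  have hVE : 16 * P.V ≤ P.E := by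
    rw [hEe]
    calc 16 * P.V = 16 * 1 * P.V := by ring
      _ ≤ _ := by gcongr; omega
  have hNE : 4 * P.N * P.E ≤ P.M := Nat.le_mul_of_pos_right _ (by positivity)
  have hNV : 16 * P.N ≤ P.E := by omega
  have hn : P.n ≤ P.N := P.n_le
  have hnn : P.n * P.n ≤ P.N * P.N := Nat.mul_le_mul hn hn
  have small : ∀ x : ℕ, x ≤ P.M → |(x : ℤ)| < 2 ^ P.w := fun x hx => P.natCast_lt (by omega)
  have l : ∀ x : ℕ, x ≤ 16 → |(x : ℤ)| < 2 ^ P.w := fun x hx => small x (by omega)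
  refine Runs.seq (findSize_runs hs hj h0 ?_)
  intro s1 m1 g1 r1 r5
  have e0 := (g1 0 (by omega) (by omega)).trans h0
  have e2 : P.N = P.s * P.s * P.s := rfl
  have bN := small P.N (by omega)
  have v1 : ∀ {st : State}, st.reg 1 = P.s → (var 1).Val P.w st P.s := fun h => Val.var (by decide) h
  have v2 : ∀ {st : State}, st.reg 2 = P.N → (var 2).Val P.w st P.N := fun h => Val.var (by decide) h
  have v6 : ∀ {st : State}, st.reg 6 = P.V → (var 6).Val P.w st P.V := fun h => Val.var (by decide) h
  have v8 : ∀ {st : State}, st.reg 8 = P.E → (var 8).Val P.w st P.E := fun h => Val.var (by decide) h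
  have v3 : ∀ {st : State}, st.reg 3 = (P.N * P.N : ℕ) → (var 3).Val P.w st (P.N * P.N : ℕ) :=
    fun h => Val.var (by decide) h
  have v0 : ∀ {st : State}, st.reg 0 = P.n → (var 0).Val P.w st P.n := fun h => Val.var (by decide) h
  have mulN : ∀ {st : State} {a b : Ex} {x y : ℕ}, a.Val P.w st x → b.Val P.w st y → x * y ≤ P.M →
      (a * b).Val P.w st (x * y : ℕ) := fun ha hb h => by
    push_cast; exact ha.mul hb (by exact_mod_cast small _ h)
  have litN : ∀ {st : State} (x : ℕ), x ≤ 16 → (lit x).Val P.w st x := fun x hx => Val.lit (l x hx)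
  refine Runs.seq (Runs.setVal (v := P.N) (mulN (mulN (v1 r1) (v1 r1) (by omega)) (v1 r1)
    (by omega)) bN ?_)
  refine Runs.seq (Runs.setVal (v := (P.N * P.N : ℕ)) (mulN (v2 ?_) (v2 ?_) hM) (small _ hM) ?_)
  · simp
  · simp
  refine Runs.seq (Runs.setVal (v := (P.s * P.s : ℕ)) (mulN (v1 ?_) (v1 ?_) (by omega))
    (small _ (by omega)) ?_)
  · simpa [State.setReg_reg] using r1
  · simpa [State.setReg_reg] using r1
  refine Runs.seq (Runs.setVal (v := P.V) ?_ (small _ (by omega)) ?_)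
  · rw [hV]
    refine val_powEx (by simp [State.setReg_reg]) hNpos ?_
    rw [← hV]
    exact (abs_lt.1 (small _ (by omega))).2
  refine Runs.seq (Runs.setVal (v := (4 * P.V : ℕ)) (mulN (litN 4 (by omega)) (v6 ?_) (by omega))
    (small _ (by omega)) ?_)
  · simp
  refine Runs.seq (Runs.setVal (v := P.E) ?_ (small _ (by omega)) ?_)
  · rw [hEe]
    refine mulN (mulN (litN 16 (by omega)) (v2 ?_) (by omega)) (v6 ?_) (by omega)
    · simp [State.setReg_reg]
    · simp [State.setReg_reg]
  refine Runs.seq (Runs.setVal (v := (2 * P.E : ℕ)) (mulN (litN 2 (by omega)) (v8 ?_) (by omega))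
    (small _ (by omega)) ?_)
  · simp
  refine Runs.seq (Runs.setVal (v := (P.n * P.n : ℕ)) (mulN (v0 ?_) (v0 ?_) (by omega))
    (small _ (by omega)) ?_)
  · simpa [State.setReg_reg] using e0
  · simpa [State.setReg_reg] using e0
  refine Runs.setVal (v := P.M) (mulN (mulN (mulN (litN 4 (by omega)) (v2 ?_) (by omega)) (v8 ?_)
    hNE) (v3 ?_) le_rfl) (small _ le_rfl) ?_
  · simp [State.setReg_reg]
  · simp [State.setReg_reg]
  · simp [State.setReg_reg]
  have := hQ ((((((((((s1.setReg 2 P.N).setReg 3 (P.N * P.N : ℕ)).setReg 4 (P.s * P.s : ℕ)).setReg 6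
    P.V).setReg 7 (4 * P.V : ℕ)).setReg 8 P.E).setReg 9 (2 * P.E : ℕ)).setReg 10
    (P.n * P.n : ℕ)).setReg 40 P.M)) ?_ ?_ ?_
  · convert this using 1
    simp only [cost_mul, cost_var, cost_lit, powEx_cost]
    ring
  · constructor <;> simp [State.setReg_reg, e0, r1, r5, hR]
  · refine ⟨by simp, ?_, ?_, ?_⟩
    · simp [State.setReg_reg, g1 41, hr]
    · intro r _
      unfold breg
      simp [State.setReg_reg, g1 (101 + 2 * r), hr, show 101 + 2 * r ≠ 1 by omega,
        show 101 + 2 * r ≠ 2 by omega, show 101 + 2 * r ≠ 3 by omega,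
        show 101 + 2 * r ≠ 4 by omega, show 101 + 2 * r ≠ 5 by omega,
        show 101 + 2 * r ≠ 6 by omega, show 101 + 2 * r ≠ 7 by omega,
        show 101 + 2 * r ≠ 8 by omega, show 101 + 2 * r ≠ 9 by omega,
        show 101 + 2 * r ≠ 10 by omega, show 101 + 2 * r ≠ 40 by omega,
        show 40 < 101 + 2 * r by omega]
    · intro a y _
      simp only [State.setReg_mem, m1, hm]
  · simp only [State.setReg_mem, m1]

end MinPlus

/-! ### The complete program for shortest paths -/

namespace MinPlus

open Ex

variable {c : ℕ} {p : Prog} {P : Params c p}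

/-- The entry of the completed weight matrix for cell `reg 18`. -/
def initEx : Ex :=
  cond (eq (var 18 / var 2) (var 18 % var 2)) (lit 0) <|
  cond (lt (var 18 / var 2) (var 0)) (cond (lt (var 18 % var 2) (var 0))
    (cond (get 0 (var 18 / var 2 * var 0 + var 18 % var 2))
      (get 1 (var 18 / var 2 * var 0 + var 18 % var 2)) (var 7)) (var 7)) (var 7)

/-- The expression for the distance with cell number `reg 18` of the output. -/
def distEx : Ex := get 4 (var 18 / var 0 * var 2 + var 18 % var 0)

/-- All-pairs shortest paths with a program `p` for minimum-weight triangle. -/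
def apsp (p : Prog) (m c₀ : ℕ) : Prog :=
  .seq (params c₀) <| .seq (fill 4 18 3 initEx) <| .seq (power p m) <|
  .seq (fill 2 18 10 (cond (lt (var 6) distEx) (lit 0) (lit 1))) (fill 3 18 10 distEx)

lemma abs_completion_le {c₀ : ℕ} (x : APSPInstance c₀) {V : ℤ} (hV : (x.n : ℤ) ^ c₀ ≤ V) (i j : ℕ) :
    |completion x.W (4 * V) i j| ≤ 4 * V := by
  have hV0 : 0 ≤ V := le_trans (by positivity) hV
  unfold completion
  split_ifs with h1 h2
  · simpa using hV0
  · cases h : x.W ⟨i, h2.1⟩ ⟨j, h2.2⟩ with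
    | none => simp [abs_of_nonneg hV0]
    | some a =>
      have := x.weight_le _ _ _ h
      simp only [Option.getD_some]
      linarith
  · simp [abs_of_nonneg hV0]

lemma val_div_mod {st : State} {d k r : ℕ} (hr : ¬ IsTemp r) (hd : st.reg r = d)
    (hk : k < P.N * P.N) (h18 : st.reg 18 = k) :
    (var 18 / var r).Val P.w st (k / d : ℕ) ∧ (var 18 % var r).Val P.w st (k % d : ℕ) := by
  have h1 := P.NN_le_M
  have h2 := Nat.div_le_self k d
  have h3 := Nat.mod_le k d
  have v18 : (var 18).Val P.w st k := Val.var (by decide) h18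
  have vr : (var r).Val P.w st d := Val.var hr hd
  constructor
  · exact_mod_cast v18.div vr (by exact_mod_cast P.natCast_lt (x := k / d) (by omega))
  · exact_mod_cast v18.mod vr (by exact_mod_cast P.natCast_lt (x := k % d) (by omega))

/-- The row-major cell `i * n + j` represents the pair `(i, j)` only if both indices are below `n`;
padding vertices are sorted out before the input is read. -/
lemma val_initEx {c₀ : ℕ} (x : APSPInstance c₀) (hn : P.n = x.n) (hV : (x.n : ℤ) ^ c₀ ≤ P.V)
    {st : State} (hC : Consts P st)
    (h0 : ∀ u v : Fin x.n, st.mem 0 ((u : ℕ) * x.n + (v : ℕ)) = if (x.W u v).isSome then 1 else 0)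
    (h1 : ∀ u v : Fin x.n, st.mem 1 ((u : ℕ) * x.n + (v : ℕ)) = (x.W u v).getD 0)
    {k : ℕ} (hk : k < P.N * P.N) (h18 : st.reg 18 = k) :
    initEx.Val P.w st (completion x.W (4 * P.V) (k / P.N) (k % P.N)) := by
  obtain ⟨vd, vm⟩ := val_div_mod (P := P) (r := 2) (by decide) hC.r2 hk h18
  have v0 : (var 0).Val P.w st x.n := Val.var (by decide) (by rw [hC.r0, hn])
  have v7 : (var 7).Val P.w st (4 * P.V) := Val.var (by decide) (by rw [hC.r7]; push_cast; rfl)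
  have hb : ∀ i j, |completion x.W (4 * P.V) i j| < 2 ^ P.w := fun i j => by
    refine P.abs_lt_of_le ((abs_completion_le x hV i j).trans ?_)
    have h2 := P.E_eq
    have h3 := P.E_le_M
    have h4 := P.N_pos
    have h5 : 16 * 1 * P.V ≤ 16 * P.N * P.V := by gcongr; omega
    exact_mod_cast (by omega : 4 * P.V ≤ 3 * P.M)
  have hM := P.NN_le_M
  have hnN : x.n ≤ P.N := hn ▸ P.n_le
  generalize k / P.N = i at *
  generalize k % P.N = j at *
  -- The completion is rewritten as nested case distinctions in the shape that `Val.cond` produces;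
  -- `e3` below continues this.
  have e1 : completion x.W (4 * P.V) i j = if (i : ℤ) = (j : ℤ) then 0 else
      if (i : ℤ) < x.n then completion x.W (4 * P.V) i j else 4 * P.V := by
    unfold completion
    split_ifs <;> first | rfl | omega
  have hb' := hb i j
  rw [e1]
  refine Val.cond (vd.eq P.w_pos vm) (fun _ => ⟨Val.lit (by simp), by simp⟩) (fun hij => ?_)
  have hij' : i ≠ j := fun h => hij (by rw [h])
  rw [if_neg hij] at e1
  rw [← e1]
  refine ⟨?_, hb'⟩
  rw [e1]
  have hb7 : ¬ (i < x.n ∧ j < x.n) → |(4 * P.V : ℤ)| < 2 ^ P.w := fun h => by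
    have := hb'
    unfold completion at this
    rwa [if_neg hij', dif_neg h] at this
  refine Val.cond (vd.lt P.w_pos v0) (fun hi => ⟨?_, hb'⟩)
    (fun hi => ⟨v7, hb7 fun h => hi (by exact_mod_cast h.1)⟩)
  have hi' : i < x.n := by exact_mod_cast hi
  by_cases hj : j < x.n
  · have hcell := cell_lt_mul hi' hj
    have hnn := Nat.mul_le_mul hnN hnN
    have hin : i * x.n ≤ P.M := by omega
    have vc := (vd.mul v0 (by exact_mod_cast P.natCast_lt (x := i * x.n) (by omega))).add vm
      (by exact_mod_cast P.natCast_lt (x := i * x.n + j) (by omega))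
    have w0 := vc.get (arr := 0)
    have w1 := vc.get (arr := 1)
    have g0 := h0 ⟨i, hi'⟩ ⟨j, hj⟩
    have g1 := h1 ⟨i, hi'⟩ ⟨j, hj⟩
    simp only at g0 g1
    rw [g0] at w0
    rw [g1] at w1
    have e3 : completion x.W (4 * P.V) i j = if (j : ℤ) < x.n then
        if ((x.W ⟨i, hi'⟩ ⟨j, hj⟩).isSome : Prop) then (x.W ⟨i, hi'⟩ ⟨j, hj⟩).getD 0 else 4 * P.V
        else 4 * P.V := by
      rw [if_pos (by exact_mod_cast hj), completion, if_neg hij', dif_pos ⟨hi', hj⟩]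
      cases x.W ⟨i, hi'⟩ ⟨j, hj⟩ <;> simp
    have e4 : completion x.W (4 * P.V) i j =
        if ((x.W ⟨i, hi'⟩ ⟨j, hj⟩).isSome : Prop) then (x.W ⟨i, hi'⟩ ⟨j, hj⟩).getD 0 else 4 * P.V := by
      rw [e3, if_pos (by exact_mod_cast hj)]
    rw [e3]
    refine Val.cond (vm.lt P.w_pos v0) (fun _ => ⟨?_, by rw [← e4]; exact hb'⟩)
      (fun h => absurd (by exact_mod_cast hj) h)
    refine Val.cond w0 (fun h => ⟨w1, ?_⟩) (fun h => ⟨v7, ?_⟩)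
    · rw [if_pos h] at e4; rw [← e4]; exact hb'
    · rw [if_neg h] at e4; rw [← e4]; exact hb'
  · have e3 : completion x.W (4 * P.V) i j = if (j : ℤ) < x.n then (0 : ℤ) else 4 * P.V := by
      rw [if_neg (by exact_mod_cast hj), completion, if_neg hij', dif_neg (fun h => hj h.2)]
    rw [e3]
    exact Val.cond (vm.lt P.w_pos v0) (fun h => absurd (by exact_mod_cast h) hj)
      (fun _ => ⟨v7, hb7 fun h => hj h.2⟩)

lemma apsp_runs {c₀ j : ℕ} (x : APSPInstance c₀) (hn : P.n = x.n) (hs : P.s = 2 ^ j)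
    (hR : P.R = 3 * j) (hj : ∀ i < j, 2 ^ i * 2 ^ i * 2 ^ i < P.n) (hV : P.V = P.N ^ (c₀ + 1)) :
    Runs P.w (apsp p P.m c₀) ((APSP c₀).input x) (fun st T => (APSP c₀).correct x st ∧
      T ≤ (squareTime P + 15 * (P.N * P.N) + 20) * P.R + 200 * (P.N * P.N) + 22 * j + 2 * c₀ + 200) := by
  have hnN : x.n ≤ P.N := hn ▸ P.n_le
  have hnpos := x.n_pos
  have hNV : P.N * P.N ^ c₀ ≤ P.V := by rw [hV, pow_succ, Nat.mul_comm]
  have hVn : (x.n : ℤ) ^ c₀ ≤ P.V := by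
    have h1 : x.n ^ c₀ ≤ P.N ^ c₀ := Nat.pow_le_pow_left hnN c₀
    have h2 : P.N ^ c₀ ≤ P.N * P.N ^ c₀ := Nat.le_mul_of_pos_left _ P.N_pos
    exact_mod_cast h1.trans (h2.trans hNV)
  have hnn : P.n * P.n ≤ P.N * P.N := Nat.mul_le_mul P.n_le P.n_le
  have hEM : (4 * P.E : ℤ) ≤ P.M := by exact_mod_cast P.E_le_M
  refine Runs.seq (params_runs hs hR hj hV (by rw [hn]; rfl)
    (fun r hr => List.getD_eq_default _ _ (by simp; omega))
    (fun a => List.getD_eq_default _ _ (by simp; omega)) ?_)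
  intro st1 c1 p1 m1
  refine Runs.seq (fill_runs c1 p1 (by omega) (by omega) c1.r3 le_rfl
    (fun z => completion x.W (4 * P.V) (z.toNat / P.N) (z.toNat % P.N)) ?_ ?_)
  · intro st' hC' hS k hk h18 hm
    rw [Int.toNat_natCast]
    refine val_initEx x hn hVn hC' (fun u v => ?_) (fun u v => ?_) hk h18
    · rw [hm 0 _ (by omega), m1]
      exact matrixArray_apply (fun u v => if (x.W u v).isSome then 1 else 0) u v
    · rw [hm 1 _ (by omega), m1]
      exact matrixArray_apply (fun u v => (x.W u v).getD 0) u v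
  intro st2 s2 p2 m2 v2
  have c2 := c1.same s2 (by omega)
  refine Runs.seq (power_runs (W := completion x.W (4 * P.V)) c2 p2 ?_ (abs_completion_le x hVn) ?_)
  · intro a ha b hb
    have := v2 (a * P.N + b) (cell_lt_mul ha hb)
    rw [Int.toNat_natCast, Nat.add_comm, Nat.add_mul_div_right _ _ P.N_pos,
      Nat.add_mul_mod_self_right, Nat.div_eq_of_lt hb, Nat.mod_eq_of_lt hb, zero_add] at this
    rw [← this]
    push_cast
    congr 1
    ring
  intro st3 cnt D s3 p3 hD hmin
  have c3 := c2.same s3 (by omega)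
  -- `V = N ^ (c₀ + 1)` is large enough for walks with `N` edges. The padding vertices do no harm,
  -- as their only edges besides the zero loops weigh `4 * V`.
  have hdist := distance_of_isWalkMin x hnN (V := P.V) (by exact_mod_cast hNV) hmin
  have hDb : ∀ a < P.N, ∀ b < P.N, |D a b| ≤ P.E := by
    intro a ha b hb
    have h1 := (hmin a ha b hb).1.abs_le (abs_completion_le x hVn)
    have h4 : (P.E : ℤ) = 16 * P.N * P.V := by exact_mod_cast P.E_eq
    have h5 : (0 : ℤ) ≤ P.N * P.V := by positivity
    linarith
  have vdist : ∀ st', Consts P st' → st'.mem 4 = st3.mem 4 → ∀ k < P.n * P.n, st'.reg 18 = k →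
      distEx.Val P.w st' (D (k / P.n) (k % P.n)) ∧ |D (k / P.n) (k % P.n)| < 2 ^ P.w := by
    intro st' hC' hm k hk h18
    have h1 : k / P.n < P.N := (Nat.div_lt_of_lt_mul hk).trans_le P.n_le
    have h2 : k % P.n < P.N := (Nat.mod_lt k P.n_pos).trans_le P.n_le
    obtain ⟨vd, vm⟩ := val_div_mod (P := P) (r := 0) (by decide) hC'.r0 (hk.trans_le hnn) h18
    have v := (val_cell hC' vd vm h1 h2).get (arr := 4)
    rw [hm, hD _ h1 _ h2] at v
    refine ⟨v, P.abs_lt_of_le ((hDb _ h1 _ h2).trans ?_)⟩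
    linarith [hEM, show (0 : ℤ) ≤ P.E by positivity]
  refine Runs.seq (fill_runs c3 p3 (by omega) (by omega) c3.r10 hnn
    (fun z => if (P.V : ℤ) < D (z.toNat / P.n) (z.toNat % P.n) then 0 else 1) ?_ ?_)
  · intro st' hC' hS k hk h18 hm
    rw [Int.toNat_natCast]
    have hm4 : st'.mem 4 = st3.mem 4 := funext fun z => hm 4 z (by omega)
    have l1 : |(1 : ℤ)| < 2 ^ P.w := by
      have := P.E_pos
      have := P.E_le_M
      exact_mod_cast P.natCast_lt (x := 1) (by omega)
    refine Val.cond (Val.lt P.w_pos (Val.var (by decide) hC'.r6) (vdist st' hC' hm4 k hk h18).1)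
      (fun _ => ⟨Val.lit (by simp), by simp⟩) (fun _ => ⟨Val.lit l1, l1⟩)
  intro st4 s4 p4 m4 v4
  have c4 := c3.same s4 (by omega)
  refine fill_runs c4 p4 (by omega) (by omega) c4.r10 hnn
    (fun z => D (z.toNat / P.n) (z.toNat % P.n)) ?_ ?_
  · intro st' hC' hS k hk h18 hm
    rw [Int.toNat_natCast]
    have hm4 : st'.mem 4 = st3.mem 4 := funext fun z => by rw [hm 4 z (by omega), m4 4 (by omega)]
    exact (vdist st' hC' hm4 k hk h18).1
  intro st5 s5 p5 m5 v5
  constructor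
  · intro u v
    have hu : (u : ℕ) < P.n := by rw [hn]; exact u.2
    have hv : (v : ℕ) < P.n := by rw [hn]; exact v.2
    have hcell := cell_lt_mul hu hv
    have e3 := v5 _ hcell
    have e2 := v4 _ hcell
    rw [Int.toNat_natCast, Nat.add_comm, Nat.add_mul_div_right _ _ P.n_pos,
      Nat.add_mul_mod_self_right, Nat.div_eq_of_lt hv, Nat.mod_eq_of_lt hv, zero_add] at e2 e3
    have ez : ((v + u * P.n : ℕ) : ℤ) = (u : ℤ) * x.n + v := by rw [hn]; push_cast; ring
    rw [ez] at e2 e3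
    rw [← m5 2 (by omega)] at e2
    obtain ⟨d1, d2⟩ := hdist u v
    change (st5.mem 2 ((u : ℤ) * x.n + v) = 1 ∧ IsLeast _ (st5.mem 3 ((u : ℤ) * x.n + v))) ∨
      (st5.mem 2 ((u : ℤ) * x.n + v) = 0 ∧ _)
    rw [e2, e3]
    by_cases h : (P.V : ℤ) < D u v
    · exact Or.inr ⟨if_pos h, d2 h⟩
    · exact Or.inl ⟨if_neg h, d1 (not_lt.1 h)⟩
  · simp only [initEx, distEx, cost_cond, cost_lt, cost_eq, cost_get, cost_add, cost_mul, cost_div,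
      cost_mod, cost_var, cost_lit]
    omega

end MinPlus
/-! ## Reduction of all-pairs shortest paths to minimum-weight triangle -/

namespace MinPlus

variable {p : Prog}

/-- Parameters for which all numbers that occur fit in words of logarithmic length. -/
lemma exists_params {c₀ k m t₀ n s j : ℕ} (hn : 0 < n) (hs : s = 2 ^ j) (hns : n ≤ s * s * s)
    (hsn : s * s * s ≤ 8 * n) (hm : 2 ≤ m)
    (hreg : ∀ w s s' t, Exec w p s s' t → ∀ r, m ≤ r → s'.reg r = s.reg r)
    (hsol : ∀ x : TriInstance (3 * c₀ + 11), x.s = s → ∃ s₁ t,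
      Exec (k * (Nat.log 2 s + 1)) p ((MinTri (3 * c₀ + 11)).input x) s₁ t ∧ t ≤ t₀ ∧
        (MinTri (3 * c₀ + 11)).correct x s₁) :
    ∃ P : Params (3 * c₀ + 11) p, P.n = n ∧ P.s = s ∧ P.R = 3 * j ∧ P.V = P.N ^ (c₀ + 1) ∧
      P.e = 4 + 3 * j + 3 * j * (c₀ + 1) ∧ P.w = (5 * k + 8 * c₀ + 41) * (Nat.log 2 n + 1) ∧
      P.m = m ∧ P.t₀ = t₀ := by
  have hs0 : 0 < s := by rw [hs]; positivity
  have hN : 2 ^ (3 * j) = s * s * s := by rw [hs, mul_comm, pow_mul]; ring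
  obtain ⟨N, hNdef⟩ : ∃ N, s * s * s = N := ⟨_, rfl⟩
  rw [hNdef] at hN hns hsn
  have hsN : s ≤ N := by
    calc s = 1 * 1 * s := by ring
      _ ≤ s * s * s := by gcongr <;> omega
      _ = N := hNdef
  have hN0 : 0 < N := by omega
  have hnν := Nat.lt_pow_succ_log_self (b := 2) (by norm_num) n
  have hw : 2 ^ ((5 * k + 8 * c₀ + 41) * (Nat.log 2 n + 1)) =
      (2 ^ (Nat.log 2 n + 1)) ^ (5 * k + 8 * c₀ + 41) := by rw [← pow_mul, mul_comm]
  obtain ⟨ν, hν⟩ : ∃ ν, 2 ^ (Nat.log 2 n + 1) = ν := ⟨_, rfl⟩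
  rw [hν] at hw
  replace hnν : n < ν := hν ▸ hnν
  have hν2 : 2 ≤ ν := by omega
  have hνpow : ∀ i j, i ≤ j → ν ^ i ≤ ν ^ j := fun i j h => Nat.pow_le_pow_right (by omega) h
  have h2pow : ∀ i, 2 ^ i ≤ ν ^ i := fun i => Nat.pow_le_pow_left hν2 i
  have hNν : N ≤ ν ^ 4 := by
    have h1 := h2pow 3
    have h2 : ν ^ 4 = ν ^ 3 * ν := rfl
    have h3 : 2 ^ 3 * ν ≤ ν ^ 3 * ν := Nat.mul_le_mul_right _ h1
    omega
  have hE : 2 ^ (4 + 3 * j + 3 * j * (c₀ + 1)) = 16 * N * N ^ (c₀ + 1) := by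
    rw [pow_add, pow_add, pow_mul 2 (3 * j), hN]; norm_num
  have hEν : 2 * (16 * N * N ^ (c₀ + 1)) ≤ ν ^ (4 * c₀ + 13) := by
    calc 2 * (16 * N * N ^ (c₀ + 1)) = 2 ^ 5 * N ^ (c₀ + 2) := by ring
      _ ≤ ν ^ 5 * (ν ^ 4) ^ (c₀ + 2) := Nat.mul_le_mul (h2pow 5) (Nat.pow_le_pow_left hNν _)
      _ = ν ^ (4 * c₀ + 13) := by ring
  have hw₀ : 2 ^ (k * (Nat.log 2 s + 1)) ≤ ν ^ (5 * k) := by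
    rw [mul_comm k, pow_mul, pow_mul]
    refine Nat.pow_le_pow_left ?_ k
    calc 2 ^ (Nat.log 2 s + 1) = 2 ^ Nat.log 2 s * 2 := pow_succ _ _
      _ ≤ s * 2 := Nat.mul_le_mul_right _ (Nat.pow_log_le_self 2 hs0.ne')
      _ ≤ ν ^ 4 * ν := Nat.mul_le_mul (hsN.trans hNν) hν2
      _ = ν ^ 5 := (pow_succ _ _).symm
  refine ⟨⟨n, s, 3 * j, N ^ (c₀ + 1), 4 + 3 * j + 3 * j * (c₀ + 1),
    (5 * k + 8 * c₀ + 41) * (Nat.log 2 n + 1), k * (Nat.log 2 s + 1), m, t₀,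
    ν ^ (5 * k + 4 * c₀ + 13), hn, hs0, ?_, ?_, ?_, ?_, ?_, hm, ?_, ?_, ?_,
    ?_, hreg, hsol⟩, rfl, rfl, rfl, ?_, rfl, rfl, rfl, rfl⟩
  · rw [hNdef]; exact hns
  · rw [hNdef]; exact hN
  · rw [hNdef]; exact Nat.le_self_pow (by omega) N
  · rw [hNdef]; exact hE
  -- Here the exponent `3 * c₀ + 11` arises: the weight bound is `2 ^ 5 * s ^ (3 * c₀ + 6)`, and `2
  -- ≤ s + 1`.
  · rw [hE]
    calc 2 * (16 * N * N ^ (c₀ + 1)) = 2 ^ 5 * s ^ (3 * c₀ + 6) := by rw [← hNdef]; ring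
      _ ≤ (s + 1) ^ 5 * (s + 1) ^ (3 * c₀ + 6) :=
        Nat.mul_le_mul (Nat.pow_le_pow_left (by omega) _) (Nat.pow_le_pow_left (by omega) _)
      _ = (s + 1) ^ (3 * c₀ + 11) := by
        rw [← pow_add, show 5 + (3 * c₀ + 6) = 3 * c₀ + 11 by ring]
  · rw [hE]
    exact hEν.trans (hνpow _ _ (by omega))
  · exact hw₀.trans (hνpow _ _ (by omega))
  · rw [← Nat.pow_le_pow_iff_right (a := 2) (by norm_num), hw]
    exact hw₀.trans (hνpow _ _ (by omega))
  -- The largest addresses decide the word length: `b + 1`, `E`, and four factors of size `O(N)`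
  -- together stay within `ν ^ (5 * k + 8 * c₀ + 40)`, and one more factor makes the inequality
  -- strict.
  · rw [hE, hw, hNdef]
    have h1 : ν ^ (5 * k + 4 * c₀ + 13) + 1 ≤ ν ^ (5 * k + 4 * c₀ + 14) := by
      have h2 : ν ^ (5 * k + 4 * c₀ + 14) = ν ^ (5 * k + 4 * c₀ + 13) * ν := rfl
      have h3 : 1 ≤ ν ^ (5 * k + 4 * c₀ + 13) := Nat.one_le_pow _ _ (by omega)
      have h4 := Nat.mul_le_mul_left (ν ^ (5 * k + 4 * c₀ + 13)) hν2
      omega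
    calc (ν ^ (5 * k + 4 * c₀ + 13) + 1) * (4 * N * (16 * N * N ^ (c₀ + 1)) * (N * N))
        = (ν ^ (5 * k + 4 * c₀ + 13) + 1) * (2 * (2 * (16 * N * N ^ (c₀ + 1))) * (N * N * N)) := by ring
      _ ≤ ν ^ (5 * k + 4 * c₀ + 14) * (ν * ν ^ (4 * c₀ + 13) * (ν ^ 4 * ν ^ 4 * ν ^ 4)) := by gcongr
      _ = ν ^ (5 * k + 8 * c₀ + 40) := by ring
      _ < ν ^ (5 * k + 8 * c₀ + 41) := Nat.pow_lt_pow_right (by omega) (by omega)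
  · change N ^ (c₀ + 1) = (s * s * s) ^ (c₀ + 1)
    rw [hNdef]

/-- One factor `j + 1` comes from the number of squarings, the other from the number of bits of the
binary search. The rest is `2 * N ^ 2` calls, each taking `O(t₀ + s * s)` including the preparation
of its input. -/
lemma nat_time_le {c c₀ : ℕ} (P : Params c p) {j T : ℕ} (hR : P.R = 3 * j)
    (he : P.e = 4 + 3 * j + 3 * j * (c₀ + 1))
    (hT : T ≤ (squareTime P + 15 * (P.N * P.N) + 20) * P.R + 200 * (P.N * P.N) + 22 * j + 2 * c₀ + 200) :
    T ≤ (3 * ((1110 + 2 * P.m) * (3 * c₀ + 11) + 67) + 422 + 2 * c₀) *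
      ((j + 1) * (j + 1) * (P.N * P.N * (P.t₀ + P.s * P.s))) := by
  obtain ⟨X, hX⟩ : ∃ X, P.N * P.N = X := ⟨_, rfl⟩
  obtain ⟨Y, hY⟩ : ∃ Y, P.t₀ + P.s * P.s = Y := ⟨_, rfl⟩
  have hX1 : 1 ≤ X := by rw [← hX]; have := P.N_pos; exact Nat.mul_pos this this
  have hss : 0 < P.s * P.s := Nat.mul_pos P.s_pos P.s_pos
  have hXY : 1 ≤ X * Y := Nat.mul_pos hX1 (by omega)
  have hXXY : X ≤ X * Y := Nat.le_mul_of_pos_right _ (by omega)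
  have h1 : stepTime P + 30 ≤ (533 + P.m) * Y := by
    have : P.m * 1 ≤ P.m * Y := Nat.mul_le_mul_left _ (by omega)
    rw [stepTime, Nat.add_mul]
    omega
  have h2 : bitTime P + 4 ≤ (1110 + 2 * P.m) * (X * Y) := by
    have := Nat.mul_le_mul_right (2 * X) h1
    rw [bitTime, hX]
    calc (stepTime P + 30) * (2 * X) + 40 + 4 ≤ (533 + P.m) * Y * (2 * X) + 44 * (X * Y) := by omega
      _ = _ := by ring
  have h3 : P.e + 1 ≤ (3 * c₀ + 11) * (j + 1) := by
    rw [he]; nlinarith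
  have h4 : squareTime P + 15 * X + 20 ≤ ((1110 + 2 * P.m) * (3 * c₀ + 11) + 67) * ((j + 1) * (X * Y)) := by
    have h5 := Nat.mul_le_mul h2 h3
    have h6 : X * Y ≤ (j + 1) * (X * Y) := Nat.le_mul_of_pos_left _ (by omega)
    rw [squareTime, hX]
    calc (bitTime P + 4) * (P.e + 1) + 16 * X + 16 + 15 * X + 20 ≤
        (1110 + 2 * P.m) * (X * Y) * ((3 * c₀ + 11) * (j + 1)) + 67 * ((j + 1) * (X * Y)) := by omega
      _ = _ := by ring
  have h5 := Nat.mul_le_mul h4 (show P.R ≤ 3 * (j + 1) by omega)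
  have h6 : (j + 1) * (X * Y) ≤ (j + 1) * (j + 1) * (X * Y) :=
    Nat.mul_le_mul_right _ (Nat.le_mul_of_pos_left _ (by omega))
  have h7 : X * Y ≤ (j + 1) * (X * Y) := Nat.le_mul_of_pos_left _ (by omega)
  have h8 : j + 1 ≤ (j + 1) * (X * Y) := Nat.le_mul_of_pos_right _ (by omega)
  have h9 : 2 * c₀ * 1 ≤ 2 * c₀ * ((j + 1) * (j + 1) * (X * Y)) := Nat.mul_le_mul_left _ (by omega)
  rw [hX] at hT
  rw [hX, hY]
  calc T ≤ ((1110 + 2 * P.m) * (3 * c₀ + 11) + 67) * ((j + 1) * (X * Y)) * (3 * (j + 1)) +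
      422 * ((j + 1) * (j + 1) * (X * Y)) + 2 * c₀ * ((j + 1) * (j + 1) * (X * Y)) := by omega
    _ = _ := by ring

/-- The inequality `x + 1 ≤ exp x` lets any positive power of `2 ^ j` absorb its logarithm. -/
lemma add_one_le_rpow {a : ℝ} (ha : 0 < a) (j : ℕ) :
    (j : ℝ) + 1 ≤ (1 / (a * Real.log 2) + 1) * ((2 ^ j : ℕ) : ℝ) ^ a := by
  have hlog : 0 < Real.log 2 := Real.log_pos (by norm_num)
  have h1 : ((2 ^ j : ℕ) : ℝ) ^ a = Real.exp (j * (a * Real.log 2)) := by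
    rw [Real.rpow_def_of_pos (by positivity)]
    push_cast
    rw [Real.log_pow]
    congr 1
    ring
  rw [h1]
  have hx : 0 ≤ (j : ℝ) * (a * Real.log 2) := by positivity
  have h2 := Real.add_one_le_exp ((j : ℝ) * (a * Real.log 2))
  have h3 : (j : ℝ) = 1 / (a * Real.log 2) * (j * (a * Real.log 2)) := by field_simp
  have h4 : (j : ℝ) ≤ 1 / (a * Real.log 2) * Real.exp (j * (a * Real.log 2)) := by
    conv_lhs => rw [h3]
    exact mul_le_mul_of_nonneg_left (by linarith) (by positivity)
  linarith

/-- The two logarithmic factors cost `s ^ δ`, half of the gain. The exponents of `s` add up to `δ +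
6 + (3 - 2δ) = 3 * (3 - δ / 3)`, and `512 = 8 ^ 3` pays for rounding `n` up to `s ^ 3 ≤ 8 * n`. -/
lemma real_time_le {δ : ℝ} (hδ : 0 < δ) (hδ' : δ ≤ 1 / 2) {K C n s j t₀ T : ℕ} (hs : s = 2 ^ j)
    (hn : 0 < n) (hsn : s * s * s ≤ 8 * n) (ht : (t₀ : ℝ) ≤ C * (s : ℝ) ^ (3 - 2 * δ))
    (hT : T ≤ K * ((j + 1) * (j + 1) * (s * s * s * (s * s * s) * (t₀ + s * s)))) :
    (T : ℝ) ≤ K * (C + 1) * 512 * (1 / (δ / 2 * Real.log 2) + 1) ^ 2 * (n : ℝ) ^ (3 - δ / 3) := by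
  have hs1 : (1 : ℝ) ≤ s := by
    have : 1 ≤ s := by rw [hs]; exact Nat.one_le_two_pow
    exact_mod_cast this
  have hs0 : (0 : ℝ) < s := by linarith
  have hlog : 0 < Real.log 2 := Real.log_pos (by norm_num)
  have hj := add_one_le_rpow (half_pos hδ) j
  rw [← hs] at hj
  set L := 1 / (δ / 2 * Real.log 2) + 1 with hL
  have hL0 : 0 < L := by positivity
  have h1 : (t₀ : ℝ) + s * s ≤ (C + 1) * (s : ℝ) ^ (3 - 2 * δ) := by
    have : (s : ℝ) ^ (2 : ℝ) ≤ (s : ℝ) ^ (3 - 2 * δ) :=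
      Real.rpow_le_rpow_of_exponent_le hs1 (by linarith)
    rw [Real.rpow_two] at this
    linarith
  have h2 : ((j : ℝ) + 1) * (j + 1) ≤ L ^ 2 * (s : ℝ) ^ δ := by
    calc ((j : ℝ) + 1) * (j + 1) ≤ (L * (s : ℝ) ^ (δ / 2)) * (L * (s : ℝ) ^ (δ / 2)) :=
          mul_le_mul hj hj (by positivity) (by positivity)
      _ = L ^ 2 * ((s : ℝ) ^ (δ / 2) * (s : ℝ) ^ (δ / 2)) := by ring
      _ = _ := by rw [← Real.rpow_add hs0, add_halves]
  have h3 : ((s : ℝ) * s * s * (s * s * s)) = (s : ℝ) ^ (6 : ℝ) := by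
    rw [show (6 : ℝ) = ((6 : ℕ) : ℝ) by norm_num, Real.rpow_natCast]; ring
  have h4 : (T : ℝ) ≤ K * ((L ^ 2 * (s : ℝ) ^ δ) * ((s : ℝ) ^ (6 : ℝ) * ((C + 1) * (s : ℝ) ^ (3 - 2 * δ)))) := by
    have : (T : ℝ) ≤ K * (((j : ℝ) + 1) * (j + 1) * ((s : ℝ) * s * s * (s * s * s) * (t₀ + s * s))) := by
      exact_mod_cast hT
    refine this.trans ?_
    rw [h3]
    gcongr
  have h5 : (s : ℝ) ^ δ * ((s : ℝ) ^ (6 : ℝ) * (s : ℝ) ^ (3 - 2 * δ)) =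
      ((s * s * s : ℕ) : ℝ) ^ (3 - δ / 3) := by
    push_cast
    rw [← Real.rpow_add hs0, ← Real.rpow_add hs0,
      show (s : ℝ) * s * s = (s : ℝ) ^ (3 : ℝ) by
        rw [show (3 : ℝ) = ((3 : ℕ) : ℝ) by norm_num, Real.rpow_natCast]; ring,
      ← Real.rpow_mul hs0.le]
    congr 1
    ring
  have h6 : ((s * s * s : ℕ) : ℝ) ^ (3 - δ / 3) ≤ 512 * (n : ℝ) ^ (3 - δ / 3) := by
    calc ((s * s * s : ℕ) : ℝ) ^ (3 - δ / 3) ≤ ((8 * n : ℕ) : ℝ) ^ (3 - δ / 3) :=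
          Real.rpow_le_rpow (by positivity) (by exact_mod_cast hsn) (by linarith)
      _ = (8 : ℝ) ^ (3 - δ / 3) * (n : ℝ) ^ (3 - δ / 3) := by
          push_cast; rw [Real.mul_rpow (by norm_num) (by positivity)]
      _ ≤ (8 : ℝ) ^ (3 : ℝ) * (n : ℝ) ^ (3 - δ / 3) := by
          gcongr
          · norm_num
          · linarith
      _ = _ := by
          rw [show (3 : ℝ) = ((3 : ℕ) : ℝ) by norm_num, Real.rpow_natCast]; norm_num
  calc (T : ℝ) ≤ _ := h4
    _ = K * (C + 1) * L ^ 2 * ((s : ℝ) ^ δ * ((s : ℝ) ^ (6 : ℝ) * (s : ℝ) ^ (3 - 2 * δ))) := by ring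
    _ ≤ K * (C + 1) * L ^ 2 * (512 * (n : ℝ) ^ (3 - δ / 3)) := by
        rw [h5]; exact mul_le_mul_of_nonneg_left h6 (by positivity)
    _ = _ := by ring

/-- Minimality means that half of `2 ^ j` is too small, so rounding up loses at most a factor `2 ^
3`. -/
lemma exists_size {n : ℕ} (hn : 0 < n) : ∃ j, n ≤ 2 ^ j * 2 ^ j * 2 ^ j ∧
    2 ^ j * 2 ^ j * 2 ^ j ≤ 8 * n ∧ ∀ i < j, 2 ^ i * 2 ^ i * 2 ^ i < n := by
  have hex : ∃ j, n ≤ 2 ^ j * 2 ^ j * 2 ^ j := ⟨n, Nat.lt_two_pow_self.le.trans (by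
    have : 0 < 2 ^ n * 2 ^ n := by positivity
    exact Nat.le_mul_of_pos_left _ this)⟩
  classical
  refine ⟨Nat.find hex, Nat.find_spec hex, ?_, fun i hi => not_le.1 (Nat.find_min hex hi)⟩
  rcases h : Nat.find hex with _ | j
  · omega
  · have := not_le.1 (Nat.find_min hex (m := j) (by omega))
    calc 2 ^ (j + 1) * 2 ^ (j + 1) * 2 ^ (j + 1) = 8 * (2 ^ j * 2 ^ j * 2 ^ j) := by ring
      _ ≤ 8 * n := by omega

/-- Reduction from all-pairs shortest paths to minimum-weight triangle. -/
theorem apsp_solvable {c₀ : ℕ} {δ : ℝ} (hδ : 0 < δ) (hδ' : δ ≤ 1 / 2)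
    (h : (MinTri (3 * c₀ + 11)).SolvableInTime fun n => (n : ℝ) ^ (3 - 2 * δ)) :
    (APSP c₀).SolvableInTime fun n => (n : ℝ) ^ (3 - δ / 3) := by
  obtain ⟨p, k, C, hp⟩ := h
  obtain ⟨m', hm'⟩ := p.exists_reg_bound
  -- The extra `2` puts the input registers 0 and 1 below `m`; from `m` on, all registers are zero
  -- before and after every call.
  set m := m' + 2
  set K := 3 * ((1110 + 2 * m) * (3 * c₀ + 11) + 67) + 422 + 2 * c₀ with hK
  set A : ℝ := K * (C + 1) * 512 * (1 / (δ / 2 * Real.log 2) + 1) ^ 2 with hA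
  refine ⟨apsp p m c₀, 5 * k + 8 * c₀ + 41, ⌈A⌉₊, ?_⟩
  intro (x : APSPInstance c₀)
  change ∃ (s : State) (t : ℕ), Exec ((5 * k + 8 * c₀ + 41) * (Nat.log 2 x.n + 1)) _ _ _ _ ∧
    (t : ℝ) ≤ _ * (x.n : ℝ) ^ _ ∧ _
  obtain ⟨j, hj1, hj2, hj3⟩ := exists_size x.n_pos
  have ht0 : 0 ≤ C * ((2 ^ j : ℕ) : ℝ) ^ (3 - 2 * δ) := by positivity
  obtain ⟨P, hn, hs, hR, hV, he, hw, hm, ht⟩ := exists_params (p := p) (c₀ := c₀) (k := k) (m := m)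
    (t₀ := ⌊C * ((2 ^ j : ℕ) : ℝ) ^ (3 - 2 * δ)⌋₊) (s := 2 ^ j) x.n_pos rfl hj1 hj2 (by omega)
    (fun w s s' t h r hr => hm' w s s' t h r (by omega)) (by
      intro y hy
      obtain ⟨s₁, t, h1, h2, h3⟩ := hp y
      change Exec (k * (Nat.log 2 y.s + 1)) _ _ _ _ at h1
      change (t : ℝ) ≤ C * (y.s : ℝ) ^ (3 - 2 * δ) at h2
      rw [hy] at h1 h2
      exact ⟨s₁, t, h1, Nat.le_floor h2, h3⟩)
  obtain ⟨S, st', t, T, hexec, htT, hq, hc, hT⟩ := apsp_runs x hn hs hR (by rw [hn]; exact hj3) hV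
    _ State.Equiv.rfl
  rw [hw, hm] at hexec
  refine ⟨S, t, hexec, ?_, ?_⟩
  · have h1 := nat_time_le P hR he (htT.trans hT)
    rw [hm, ht, Params.N, hs] at h1
    have h2 := real_time_le hδ hδ' rfl x.n_pos hj2 (Nat.floor_le ht0) h1
    exact h2.trans (mul_le_mul_of_nonneg_right (Nat.le_ceil A) (by positivity))
  · change ∀ u v : Fin x.n, _
    intro u v
    have := hc u v
    simp only [hq.1]
    exact this

end MinPlus

lemma WordRAM.Problem.SolvableInTime.mono {P : Problem} {T T' : ℕ → ℝ} (h : P.SolvableInTime T)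
    (hT : ∀ x : P.Inst, T (P.size x) ≤ T' (P.size x)) : P.SolvableInTime T' := by
  obtain ⟨p, k, C, hp⟩ := h
  refine ⟨p, k, C, fun x => ?_⟩
  obtain ⟨s, t, h1, h2, h3⟩ := hp x
  exact ⟨s, t, h1, h2.trans (mul_le_mul_of_nonneg_left (hT x) (by positivity)), h3⟩

lemma rpow_le_rpow_sub {n : ℕ} (hn : 0 < n) {a δ δ' : ℝ} (h : δ' ≤ δ) :
    (n : ℝ) ^ (a - δ) ≤ (n : ℝ) ^ (a - δ') :=
  Real.rpow_le_rpow_of_exponent_le (by exact_mod_cast hn) (by linarith)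

theorem mainTheorem5 (hAPSP : APSPHypothesis) :
    ∀ δ : ℝ, 0 < δ →
      (∃ c : ℕ, ¬ (weightedOrthantCover3 c).SolvableInTime
        (fun n => (n : ℝ) ^ ((3 : ℝ) / 2 - δ))) ∧
      (∃ c : ℕ, ¬ (weightedUnitSquareCover3 c).SolvableInTime
        (fun n => (n : ℝ) ^ ((3 : ℝ) / 2 - δ))) := by
  intro δ hδ
  -- Shrinking `δ` to at most `1/2` only weakens the assumed running time, and keeps quadratic
  -- overhead in `s` below `s ^ (3 - 2δ)`.
  have hδ₀ : 0 < min δ (1 / 2) := lt_min hδ (by norm_num)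
  have hδ₁ : min δ (1 / 2) ≤ 1 / 2 := min_le_right _ _
  obtain ⟨c, hc⟩ := hAPSP (min δ (1 / 2) / 3) (by positivity)
  -- Distances with weights up to `n ^ c` lead to triangle weights up to `(s + 1) ^ (3 * c + 11)`,
  -- and the covering instances add `6` to the exponent.
  refine ⟨⟨3 * c + 11 + 6, fun h => hc ?_⟩, ⟨3 * c + 11 + 6, fun h => hc ?_⟩⟩
  · exact MinPlus.apsp_solvable hδ₀ hδ₁ (TriCover.minTri_of_orthant _ hδ₀ hδ₁
      (h.mono fun x => rpow_le_rpow_sub x.n_pos (min_le_left _ _)))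
  · exact MinPlus.apsp_solvable hδ₀ hδ₁ (TriCover.minTri_of_unitSquare _ hδ₀ hδ₁
      (h.mono fun x => rpow_le_rpow_sub x.n_pos (min_le_left _ _)))
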